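/- **Setting.** Let $n\ge 3$ and $r\ge 1$ be integers, $d=\frac n2-r$, $A=\mathbb C[X_1,\dots,X_n]$, $\mathtt F=\sum_{i=1}^n X_i^2$ and $R_r=A/(\mathtt F^r)$. Put $\Delta_1=\frac12\sum_i\partial_{X_i}^2$, $\mathtt E_1=\sum_i X_i\partial_{X_i}$, $P_j=X_j\Delta_1-(\mathtt E_1+d)\partial_{X_j}$, and let $H(m)\subset A$ be the space of homogeneous polynomials $p$ of degree $m$ with $\Delta_1(p)=0$. Let $\ell'=\lfloor n/2\rfloor$, $\ell=\ell'+1$. Let $\mathfrak g=\mathfrak{so}(n+2,\mathbb C)$ be the Lie algebra of matrices preserving the quadratic form $\sum_{j=1}^{\ell}U_jU_{-j}+\frac12U_0^2$ in the $n+2$ variables $U_{\pm1},\dots,U_{\pm\ell}$ and (only if $n$ is odd) $U_0$. It is spanned by the elements $E_{ij}=U_i\partial_{U_j}-U_{-j}\partial_{U_{-i}}$. Let $\mathfrak h=\bigoplus_j\mathbb C E_{jj}$, with dual basis $\varepsilon_1,\dots,\varepsilon_\ell$ of $\mathfrak h^*$, and let $\mathfrak n^+$ be spanned by the $E_{ab}$,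 $E_{a,-b}$ $(1\le a<b\le\ell)$ and, if $n$ is odd, the $E_{a,0}$ $(1\le a\le \ell)$. Let $\alpha_i$ be the simple roots (so $\alpha_1=\varepsilon_1-\varepsilon_2$) and $\varpi_i$ the fundamental weights, in Bourbaki's numbering for type $\mathsf B_\ell$ ($n$ odd) or $\mathsf D_\ell$ ($n$ even). For $\nu\in\mathfrak h^*$ let $L(\nu)$ be the simple quotient of the Verma module with highest weight $\nu$. The algebra $\mathfrak g$ acts on $R_r$ as follows. In $A$ put $U_{\pm(a+1)}=X_a\mp iX_{a+\ell'}$ for $1\le a\le \ell'$ and, if $n$ is odd, $U_0=\sqrt2X_n$; similarly put $V_{\pm(a+1)}=\frac12(P_a\mp iP_{a+\ell'})$ and, if $n$ is odd, $V_0=\frac1{\sqrt2}P_n$. For $p,q\ne\pm1$, $$E_{11}\mapsto-(\mathtt E_1+d),\quad E_{p1}\mapsto U_p,\quad E_{1p}\mapsto V_{-p},\quad E_{pq}\mapsto U_p\partial_{U_q}-U_{-q}\partial_{U_{-p}}.$$ These operators preserve $(\mathtt F^r)$ and define a representation of $\mathfrak g$ on $R_r$. **Theorem.** $R_r$ is a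 highest weight $\mathfrak g$-module with highest weight $\lambda=-d\varpi_1=(r-\frac n2)\varpi_1$. 1. If $n$ is odd, or $n$ is even and $r<\frac n2$, then $R_r$ is a simple $\mathfrak g$-module and $R_r\cong L(\lambda)$. 2. If $n$ is even and $r\ge\frac n2$ (so $d\le 0$), then the socle $S$ of the $\mathfrak g$-module $R_r$ is simple and $S\cong L(\mu)$, where $\mu=\lambda+(d-1)\alpha_1$; explicitly, $\mu=(d-2)\varpi_1+(1-d)\varpi_2$ if $\ell\ge4$ and $\mu=(d-2)\varpi_1+(1-d)(\varpi_2+\varpi_3)$ if $\ell=3$. As a subset of $R_r$, $S$ is the ideal of the ring $R_r$ generated by (the image of) $H(1-d)$. The quotient $R_r/S$ is an irreducible finite-dimensional $\mathfrak g$-module, isomorphic to $L(\lambda)$ and to the space of homogeneous polynomials $f$ of degree $-d$ in the $n+2$ variables $U_i$ with $\bigl(\partial_{U_0}^2+2\sum_{j=1}^\ell\partial_{U_j}\partial_{U_{-j}}\bigr)f=0$ (the term $\partial_{U_0}^2$ being absent for $n$ even), on which $E_{ij}$ acts as $U_i\partial_{U_j}-U_{-j}\partial_{U_{-i}}$. 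-/

import Mathlib

open MvPolynomial

set_option linter.unusedSectionVars false

namespace ConformalSO

noncomputable section

/-! ## Calculus of polynomial differential operators (helper facts)

`lf v` is the linear form with coefficients `v`, `dv w` the constant vector field with
coefficients `w`, `dK K` the linear vector field `∑ K i j X_i ∂_j`. -/

section calculus
variable {σ : Type} [Fintype σ] [DecidableEq σ]

/-- The linear form `∑ i, v i * X i`. -/
def lf (v : σ → ℂ) : MvPolynomial σ ℂ := ∑ i, C (v i) * X i

/-- The constant vector field `∑ j, w j * ∂_j`. -/
def dv (w : σ → ℂ) : Derivation ℂ (MvPolynomial σ ℂ) (MvPolynomial σ ℂ) :=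
  mkDerivation ℂ fun j => C (w j)

/-- The linear vector field `∑ i j, K i j * X i * ∂_j`. -/
def dK (K : Matrix σ σ ℂ) : Derivation ℂ (MvPolynomial σ ℂ) (MvPolynomial σ ℂ) :=
  mkDerivation ℂ fun j => ∑ i, C (K i j) * X i

lemma C_half_mul_two : (C (1/2) : MvPolynomial σ ℂ) * 2 = 1 := by
  have h2 : (2 : MvPolynomial σ ℂ) = C 2 := (map_ofNat C 2).symm
  rw [h2, ← C_mul]; norm_num

lemma derivation_sum_apply {ι : Type*} (s : Finset ι)
    (D : ι → Derivation ℂ (MvPolynomial σ ℂ) (MvPolynomial σ ℂ))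
    (f : MvPolynomial σ ℂ) : (∑ i ∈ s, D i) f = ∑ i ∈ s, D i f := by
  classical
  induction s using Finset.induction_on with
  | empty => simp
  | insert a s ha ih => rw [Finset.sum_insert ha, Finset.sum_insert ha, Derivation.add_apply, ih]

lemma dv_eq (w : σ → ℂ) (f : MvPolynomial σ ℂ) : dv w f = ∑ i, C (w i) * pderiv i f := by
  have : dv w = ∑ i, (C (w i) : MvPolynomial σ ℂ) • pderiv (R := ℂ) i := by
    apply derivation_ext
    intro j
    simp only [dv, mkDerivation_X, derivation_sum_apply, Derivation.smul_apply, pderiv_X,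
      smul_eq_mul]
    simp [Pi.single_apply]
  rw [this]
  simp [derivation_sum_apply]

lemma dK_eq (K : Matrix σ σ ℂ) (f : MvPolynomial σ ℂ) :
    dK K f = ∑ i, ∑ j, C (K i j) * (X i * pderiv j f) := by
  have : dK K = ∑ i, ∑ j, (C (K i j) * X i : MvPolynomial σ ℂ) • pderiv (R := ℂ) j := by
    apply derivation_ext
    intro j
    simp only [dK, mkDerivation_X, derivation_sum_apply, Derivation.smul_apply, pderiv_X,
      smul_eq_mul]
    simp [Pi.single_apply]
  rw [this]
  simp [derivation_sum_apply, mul_assoc]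

lemma pderiv_lf (i : σ) (v : σ → ℂ) : pderiv i (lf v) = C (v i) := by
  simp [lf, pderiv_X, Pi.single_apply]

lemma dv_lf (w v : σ → ℂ) : dv w (lf v) = C (w ⬝ᵥ v) := by
  simp [dv_eq, pderiv_lf, dotProduct]

lemma dK_lf (K : Matrix σ σ ℂ) (v : σ → ℂ) : dK K (lf v) = lf (K.mulVec v) := by
  simp only [dK_eq, pderiv_lf]
  simp only [lf, Matrix.mulVec, dotProduct, map_sum, Finset.sum_mul, map_mul]
  refine Finset.sum_congr rfl fun i _ => Finset.sum_congr rfl fun j _ => by ring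

lemma pderiv_comm' (i j : σ) (f : MvPolynomial σ ℂ) :
    pderiv i (pderiv j f) = pderiv j (pderiv i f) := by
  have h : ⁅(pderiv i : Derivation ℂ (MvPolynomial σ ℂ) (MvPolynomial σ ℂ)),
      (pderiv j : Derivation ℂ (MvPolynomial σ ℂ) (MvPolynomial σ ℂ))⁆ = 0 := by
    apply derivation_ext; intro k
    simp only [Derivation.commutator_apply, pderiv_X]
    simp [Pi.single_apply, apply_ite]
  have := DFunLike.congr_fun h f
  simpa [Derivation.commutator_apply, sub_eq_zero] using this

lemma dv_comm (w v : σ → ℂ) (f : MvPolynomial σ ℂ) : dv w (dv v f) = dv v (dv w f) := by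
  have h : ⁅dv w, dv v⁆ = 0 := by
    apply derivation_ext; intro k
    simp [Derivation.commutator_apply, dv]
  have := DFunLike.congr_fun h f
  simpa [Derivation.commutator_apply, sub_eq_zero] using this

lemma dK_dv (K : Matrix σ σ ℂ) (w : σ → ℂ) (f : MvPolynomial σ ℂ) :
    dK K (dv w f) = dv w (dK K f) - dv (K.transpose.mulVec w) f := by
  have h : ⁅dK K, dv w⁆ = - dv (K.transpose.mulVec w) := by
    apply derivation_ext; intro k
    simp only [Derivation.commutator_apply, dv, dK, mkDerivation_X, Derivation.neg_apply]
    simp [Matrix.mulVec, dotProduct, Matrix.transpose_apply]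
  have := DFunLike.congr_fun h f
  simp only [Derivation.commutator_apply, Derivation.neg_apply] at this
  linear_combination this

lemma dK_comm (K L : Matrix σ σ ℂ) (f : MvPolynomial σ ℂ) :
    dK K (dK L f) = dK L (dK K f) + dK (K * L - L * K) f := by
  have h : ⁅dK K, dK L⁆ = dK (K * L - L * K) := by
    apply derivation_ext; intro k
    have e : ∀ (K : Matrix σ σ ℂ) (k), dK K (X k) = lf (fun i => K i k) := by
      intro K k; simp [dK, lf]
    simp only [Derivation.commutator_apply, e, dK_lf]
    simp [lf, Matrix.mulVec, dotProduct, Matrix.mul_apply, sub_mul]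
  have := DFunLike.congr_fun h f
  simp only [Derivation.commutator_apply] at this
  linear_combination this

/-- rank one -/
lemma dK_vecMulVec (v w : σ → ℂ) (f : MvPolynomial σ ℂ) : dK (Matrix.vecMulVec v w) f = lf v * dv w f := by
  simp only [dK_eq, Matrix.vecMulVec_apply, lf, dv_eq, Finset.sum_mul_sum, map_mul]
  refine Finset.sum_congr rfl fun i _ => Finset.sum_congr rfl fun j _ => by ring

lemma lf_add (v w : σ → ℂ) : lf (v + w) = lf v + lf w := by
  simp [lf, add_mul, Finset.sum_add_distrib]
lemma lf_smul (c : ℂ) (v : σ → ℂ) : lf (c • v) = C c * lf v := by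
  simp [lf, Finset.mul_sum, mul_assoc]
lemma lf_sub (v w : σ → ℂ) : lf (v - w) = lf v - lf w := by
  simp [lf, sub_mul, Finset.sum_sub_distrib]
lemma dv_add (v w : σ → ℂ) (f : MvPolynomial σ ℂ) : dv (v + w) f = dv v f + dv w f := by
  simp [dv_eq, add_mul, Finset.sum_add_distrib]
lemma dv_sub (v w : σ → ℂ) (f : MvPolynomial σ ℂ) : dv (v - w) f = dv v f - dv w f := by
  simp [dv_eq, sub_mul, Finset.sum_sub_distrib]
lemma dv_neg (v : σ → ℂ) (f : MvPolynomial σ ℂ) : dv (-v) f = - dv v f := by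
  simp [dv_eq]
lemma dv_smul (c : ℂ) (w : σ → ℂ) (f : MvPolynomial σ ℂ) : dv (c • w) f = C c * dv w f := by
  simp [dv_eq, Finset.mul_sum, mul_assoc]
lemma dK_add (K L : Matrix σ σ ℂ) (f : MvPolynomial σ ℂ) : dK (K + L) f = dK K f + dK L f := by
  simp [dK_eq, add_mul, Finset.sum_add_distrib]
lemma dK_sub (K L : Matrix σ σ ℂ) (f : MvPolynomial σ ℂ) : dK (K - L) f = dK K f - dK L f := by
  simp [dK_eq, sub_mul, Finset.sum_sub_distrib]
lemma dK_C (K : Matrix σ σ ℂ) (c : ℂ) : dK K (C c) = 0 :=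
  Derivation.map_algebraMap _ _
lemma dv_C (v : σ → ℂ) (c : ℂ) : dv v (C c) = 0 :=
  Derivation.map_algebraMap _ _
lemma pderiv_dK (K : Matrix σ σ ℂ) (i : σ) (f : MvPolynomial σ ℂ) :
    pderiv i (dK K f) = dK K (pderiv i f) + ∑ j, C (K i j) * pderiv j f := by
  have := dK_dv K (Pi.single i 1) f
  have e : ∀ g : MvPolynomial σ ℂ, dv (Pi.single i 1) g = pderiv i g := by
    intro g; simp [dv_eq, Pi.single_apply]
  rw [e, e] at this
  rw [this, dv_eq]
  simp

end calculus

/-! ## The operators on `A = ℂ[X_1, …, X_n]` -/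

section ops
variable {n : ℕ}

/-- The Euler operator `E₁ = ∑ X_i ∂_i`. -/
def euler (n : ℕ) : Module.End ℂ (MvPolynomial (Fin n) ℂ) :=
  ∑ i, LinearMap.mulLeft ℂ (X i) ∘ₗ (pderiv i).toLinearMap

/-- The Laplacian `Δ₁ = (1/2) ∑ ∂_i²`. -/
def laplacian (n : ℕ) : Module.End ℂ (MvPolynomial (Fin n) ℂ) :=
  (1 / 2 : ℂ) • ∑ i, (pderiv i).toLinearMap ∘ₗ (pderiv i).toLinearMap

/-- `I(d) = E₁ + d`. -/
def opI (n : ℕ) (d : ℂ) : Module.End ℂ (MvPolynomial (Fin n) ℂ) :=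
  euler n + d • LinearMap.id

/-- `P_j(d) = X_j Δ₁ - (E₁ + d) ∂_j`. -/
def opP (d : ℂ) (j : Fin n) : Module.End ℂ (MvPolynomial (Fin n) ℂ) :=
  LinearMap.mulLeft ℂ (X j) ∘ₗ laplacian n - opI n d ∘ₗ (pderiv j).toLinearMap

/-- The quadratic form `F = ∑ X_i²`. -/
def quadF (n : ℕ) : MvPolynomial (Fin n) ℂ := ∑ i, X i ^ 2

/-- The space `H(m)` of harmonic homogeneous polynomials of degree `m` in `X_1, …, X_n`. -/
def harmonicPoly (n m : ℕ) : Submodule ℂ (MvPolynomial (Fin n) ℂ) :=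
  homogeneousSubmodule (Fin n) ℂ m ⊓ LinearMap.ker (laplacian n)

lemma euler_eq (f : MvPolynomial (Fin n) ℂ) : euler n f = dK 1 f := by
  simp [euler, dK_eq, Matrix.one_apply]

lemma lap_eq (f : MvPolynomial (Fin n) ℂ) :
    laplacian n f = C (1/2) * ∑ i, pderiv i (pderiv i f) := by
  simp [laplacian, smul_eq_C_mul]

lemma lap_mul (f g : MvPolynomial (Fin n) ℂ) :
    laplacian n (f * g) = f * laplacian n g + g * laplacian n f + ∑ i, pderiv i f * pderiv i g := by
  simp only [lap_eq, Derivation.leibniz, map_add, smul_eq_mul, Finset.sum_add_distrib]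
  have hc : (C (1/2) : MvPolynomial (Fin n) ℂ) * 2 = 1 := C_half_mul_two
  simp only [← Finset.mul_sum]
  have e : ∑ i, pderiv i g * pderiv i f = ∑ i, pderiv i f * pderiv i g :=
    Finset.sum_congr rfl fun i _ => mul_comm _ _
  rw [e]
  linear_combination (∑ i, pderiv i f * pderiv i g) * hc

lemma lap_lf (v : Fin n → ℂ) : laplacian n (lf v) = 0 := by
  simp [lap_eq, pderiv_lf]

lemma lap_lf_mul (v : Fin n → ℂ) (f : MvPolynomial (Fin n) ℂ) :
    laplacian n (lf v * f) = lf v * laplacian n f + dv v f := by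
  rw [lap_mul, lap_lf, dv_eq]; simp [pderiv_lf]

lemma lap_dv (v : Fin n → ℂ) (f : MvPolynomial (Fin n) ℂ) : laplacian n (dv v f) = dv v (laplacian n f) := by
  simp only [lap_eq, dv_eq, map_sum, Derivation.leibniz, pderiv_C, smul_eq_mul,
    Finset.mul_sum]
  simp only [mul_zero, add_zero, Finset.sum_const_zero]
  rw [Finset.sum_comm]
  refine Finset.sum_congr rfl fun i _ => Finset.sum_congr rfl fun j _ => ?_
  rw [pderiv_C_mul, pderiv_comm' i j, pderiv_comm' i j (pderiv i f)]

lemma lap_dK (K : Matrix (Fin n) (Fin n) ℂ) (f : MvPolynomial (Fin n) ℂ) :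
    laplacian n (dK K f) = dK K (laplacian n f) +
      C (1/2) * ∑ i, ∑ j, C (K i j + K j i) * pderiv i (pderiv j f) := by
  simp only [lap_eq, pderiv_dK, map_add, map_sum, Finset.sum_add_distrib, Derivation.leibniz, pderiv_C,
    smul_eq_mul, add_mul]
  have hC : dK K (C (1/2)) = 0 := by
    rw [show (C (1/2) : MvPolynomial (Fin n) ℂ) = algebraMap ℂ _ (1/2) from rfl]
    exact Derivation.map_algebraMap _ _
  rw [hC]
  have e : ∑ i, ∑ j, C (K j i) * pderiv i (pderiv j f)
     = ∑ i, ∑ j, C (K i j) * pderiv j (pderiv i f) := Finset.sum_comm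
  have e2 : ∑ i, ∑ j, C (K i j) * pderiv j (pderiv i f)
     = ∑ i, ∑ j, C (K i j) * pderiv i (pderiv j f) := by
    simp only [pderiv_comm']
  simp only [mul_zero, add_zero, Finset.sum_const_zero]
  rw [e, e2]; ring

lemma lap_dK_skew (K : Matrix (Fin n) (Fin n) ℂ) (hK : K.transpose = -K) (f : MvPolynomial (Fin n) ℂ) :
    laplacian n (dK K f) = dK K (laplacian n f) := by
  have : ∀ i j, K i j + K j i = 0 := by
    intro i j
    have := congrFun (congrFun hK j) i
    simp [Matrix.transpose_apply] at this
    simp [this]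
  simp [lap_dK, this]

lemma lap_dK_one (f : MvPolynomial (Fin n) ℂ) :
    laplacian n (dK 1 f) = dK 1 (laplacian n f) + C 2 * laplacian n f := by
  rw [lap_dK, map_ofNat C 2]
  congr 1
  rw [lap_eq]
  have hc : (C (1/2) : MvPolynomial (Fin n) ℂ) * 2 = 1 := C_half_mul_two
  have : ∑ i : Fin n, ∑ j, (C ((1 : Matrix (Fin n) (Fin n) ℂ) i j + (1 : Matrix (Fin n) (Fin n) ℂ) j i) : MvPolynomial (Fin n) ℂ)
     * pderiv i (pderiv j f) = ∑ i, 2 * pderiv i (pderiv i f) := by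
    refine Finset.sum_congr rfl fun i _ => ?_
    rw [Finset.sum_eq_single i]
    · rw [Matrix.one_apply_eq, C_add, C_1]; ring
    · intro j _ hj; simp [hj, hj.symm]
    · simp
  rw [this, ← Finset.mul_sum]; ring

/-- The general operator. -/
def opT (d : ℂ) (c : ℂ) (v w : Fin n → ℂ) (K : Matrix (Fin n) (Fin n) ℂ) (f : MvPolynomial (Fin n) ℂ) :
    MvPolynomial (Fin n) ℂ :=
  - C c * (dK 1 f + C d * f) + lf v * f +
    (lf w * laplacian n f - (dK 1 (dv w f) + C d * dv w f)) + dK K f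

lemma lap_C_mul (c : ℂ) (f : MvPolynomial (Fin n) ℂ) : laplacian n (C c * f) = C c * laplacian n f := by
  rw [← smul_eq_C_mul, map_smul, smul_eq_C_mul]

lemma opT_bracket (d c c' : ℂ) (v w v' w' : Fin n → ℂ) (K K' : Matrix (Fin n) (Fin n) ℂ)
    (hK : K.transpose = -K) (hK' : K'.transpose = -K') (f : MvPolynomial (Fin n) ℂ) :
    opT d c v w K (opT d c' v' w' K' f) - opT d c' v' w' K' (opT d c v w K f) =
    opT d (w ⬝ᵥ v' - w' ⬝ᵥ v) (c' • v - c • v' + K.mulVec v' - K'.mulVec v)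
      (c • w' - c' • w + K.mulVec w' - K'.mulVec w)
      (Matrix.vecMulVec v w' - Matrix.vecMulVec w' v + Matrix.vecMulVec w v' -
        Matrix.vecMulVec v' w + (K * K' - K' * K)) f := by
  have hd : ∀ f, dK K (dv w' f) = dv w' (dK K f) + dv (K.mulVec w') f := by
    intro f; rw [dK_dv, hK, Matrix.neg_mulVec, dv_neg]; ring
  have hd' : ∀ f, dK K' (dv w f) = dv w (dK K' f) + dv (K'.mulVec w) f := by
    intro f; rw [dK_dv, hK', Matrix.neg_mulVec, dv_neg]; ring
  have h1 : ∀ (w : Fin n → ℂ) (f : MvPolynomial (Fin n) ℂ), dK 1 (dv w f) = dv w (dK 1 f) - dv w f := by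
    intro w f; rw [dK_dv]; simp
  have h2 : ∀ (L : Matrix (Fin n) (Fin n) ℂ) (f : MvPolynomial (Fin n) ℂ), dK L (dK 1 f) = dK 1 (dK L f) := by
    intro L f; rw [dK_comm]; simp [dK_eq]
  have h3 : dK K (dK K' f) = dK K' (dK K f) + dK (K * K' - K' * K) f := dK_comm _ _ _
  simp only [opT, map_add, map_sub, map_neg, neg_mul, Derivation.leibniz, smul_eq_mul, lap_C_mul, dK_C,
    dv_C, lap_lf_mul, lap_dv, dv_lf, dK_lf, Matrix.one_mulVec, lap_dK_one, lap_dK_skew K hK,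
    lap_dK_skew K' hK', lf_add, lf_sub, lf_smul, dv_add, dv_sub, dv_smul, dK_add, mul_zero, add_zero,
    h1, h2, h3, hd, hd', dv_comm w' w]
  rw [dK_sub (_ + _)]
  simp only [dK_add, dK_sub, dK_vecMulVec, dotProduct_comm w' w, map_ofNat C 2]
  ring

lemma quadF_eq (n : ℕ) : quadF n = ∑ i : Fin n, X i * X i := by
  simp [quadF, pow_two]

lemma pderiv_quadF (i : Fin n) : pderiv i (quadF n) = C 2 * X i := by
  simp only [quadF_eq, map_sum, Derivation.leibniz, pderiv_X, smul_eq_mul, map_ofNat C 2]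
  simp [Pi.single_apply, Finset.sum_add_distrib]
  ring

lemma dv_quadF (w : Fin n → ℂ) : dv w (quadF n) = C 2 * lf w := by
  simp only [dv_eq, pderiv_quadF, lf, Finset.mul_sum]
  exact Finset.sum_congr rfl fun i _ => by ring

lemma dK_quadF (K : Matrix (Fin n) (Fin n) ℂ) (hK : K.transpose = -K) : dK K (quadF n) = 0 := by
  have h1 : dK K (quadF n) = ∑ i, ∑ j, C (K i j) * (C 2 * (X i * X j)) := by
    simp only [dK_eq, pderiv_quadF]
    exact Finset.sum_congr rfl fun i _ => Finset.sum_congr rfl fun j _ => by ring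
  have h2 : dK K (quadF n) = - dK K (quadF n) := by
    conv_lhs => rw [h1, Finset.sum_comm]
    rw [h1, ← Finset.sum_neg_distrib]
    refine Finset.sum_congr rfl fun i _ => ?_
    rw [← Finset.sum_neg_distrib]
    refine Finset.sum_congr rfl fun j _ => ?_
    have := congrFun (congrFun hK i) j
    simp only [Matrix.transpose_apply, Matrix.neg_apply] at this
    rw [this, C_neg]; ring
  exact self_eq_neg.mp h2

lemma dK_one_quadF : dK 1 (quadF n) = C 2 * quadF n := by
  simp only [dK_eq, pderiv_quadF, Matrix.one_apply]
  simp only [quadF_eq, Finset.mul_sum]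
  refine Finset.sum_congr rfl fun i _ => ?_
  rw [Finset.sum_eq_single i]
  · simp; ring
  · intro j _ hj; simp [hj.symm]
  · simp

lemma lap_quadF_mul (g : MvPolynomial (Fin n) ℂ) :
    laplacian n (quadF n * g) = quadF n * laplacian n g + C (n : ℂ) * g + C 2 * dK 1 g := by
  rw [lap_mul, lap_eq (quadF n)]
  have h1 : ∑ i, pderiv i (quadF n) * pderiv i g = C 2 * dK 1 g := by
    simp only [pderiv_quadF, ← euler_eq, euler]
    simp [Finset.mul_sum, mul_assoc]
  have h2 : ∑ i : Fin n, pderiv i (pderiv i (quadF n)) = C (n : ℂ) * 2 := by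
    simp only [pderiv_quadF, pderiv_C_mul, pderiv_X_self, mul_one]
    rw [Finset.sum_const, Finset.card_univ, Fintype.card_fin, nsmul_eq_mul, map_ofNat C 2,
      map_natCast C n]
  have hc : (C (1/2) : MvPolynomial (Fin n) ℂ) * 2 = 1 := C_half_mul_two
  rw [h1, h2]
  linear_combination g * C (n : ℂ) * hc

lemma dK_one_quadF_pow (k : ℕ) (g : MvPolynomial (Fin n) ℂ) :
    dK 1 (quadF n ^ k * g) = quadF n ^ k * dK 1 g + C (2 * k : ℂ) * quadF n ^ k * g := by
  induction k with
  | zero => simp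
  | succ k ih =>
    rw [pow_succ', mul_assoc, Derivation.leibniz, ih, dK_one_quadF]
    simp only [smul_eq_mul, Nat.cast_add, Nat.cast_one, C_mul, C_add, C_1]
    ring

lemma dv_quadF_pow (w : Fin n → ℂ) (k : ℕ) (g : MvPolynomial (Fin n) ℂ) :
    dv w (quadF n ^ (k + 1) * g) =
      quadF n ^ (k + 1) * dv w g + C (2 * (k + 1) : ℂ) * quadF n ^ k * (lf w * g) := by
  induction k with
  | zero => simp [dv_quadF]; ring
  | succ k ih =>
    rw [pow_succ', mul_assoc, Derivation.leibniz, ih, dv_quadF]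
    simp only [smul_eq_mul, Nat.cast_add, Nat.cast_one, C_mul, C_add, C_1]
    ring

lemma lap_quadF_pow (k : ℕ) (g : MvPolynomial (Fin n) ℂ) :
    laplacian n (quadF n ^ (k + 1) * g) = quadF n ^ (k + 1) * laplacian n g +
      C (2 * (k + 1) : ℂ) * quadF n ^ k * dK 1 g +
      C ((k + 1) * (n + 2 * k) : ℂ) * quadF n ^ k * g := by
  induction k with
  | zero => simp [lap_quadF_mul]; ring
  | succ k ih =>
    rw [pow_succ', mul_assoc, lap_quadF_mul, ih, dK_one_quadF_pow]
    simp only [Nat.cast_add, Nat.cast_one, C_mul, C_add, C_1, map_ofNat C 2]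
    ring

lemma dK_quadF_pow (K : Matrix (Fin n) (Fin n) ℂ) (hK : K.transpose = -K) (k : ℕ)
    (g : MvPolynomial (Fin n) ℂ) : dK K (quadF n ^ k * g) = quadF n ^ k * dK K g := by
  rw [Derivation.leibniz, Derivation.leibniz_pow, dK_quadF K hK]; simp

/-- For `d = n/2 - r` the operators preserve the ideal generated by `F ^ r`. -/
lemma opT_mem (r : ℕ) (c : ℂ) (v w : Fin n → ℂ) (K : Matrix (Fin n) (Fin n) ℂ)
    (hK : K.transpose = -K) (f : MvPolynomial (Fin n) ℂ) (hf : f ∈ Ideal.span {quadF n ^ r}) :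
    opT ((n : ℂ) / 2 - r) c v w K f ∈ Ideal.span {quadF n ^ r} := by
  rw [Ideal.mem_span_singleton] at hf ⊢
  obtain ⟨g, rfl⟩ := hf
  rcases r with _ | k
  · simp
  have hn : (C (n : ℂ) : MvPolynomial (Fin n) ℂ) = C 2 * C ((n : ℂ) / 2) := by
    rw [← C_mul]; congr 1; ring
  refine ⟨- C c * (dK 1 g + C (2 * (k + 1) + ((n : ℂ) / 2 - (k + 1))) * g) + lf v * g +
    (lf w * laplacian n g - (dK 1 (dv w g) + C (2 * (k + 1) + ((n : ℂ) / 2 - (k + 1))) * dv w g)) +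
    dK K g, ?_⟩
  simp only [opT, dv_quadF_pow, lap_quadF_pow, dK_quadF_pow K hK, map_add, dK_one_quadF_pow]
  have e1 : dK 1 (C (2 * (k + 1) : ℂ) * quadF n ^ k * (lf w * g)) =
      C (2 * (k + 1) : ℂ) * (quadF n ^ k * (lf w * dK 1 g + lf w * g) +
        C (2 * k : ℂ) * quadF n ^ k * (lf w * g)) := by
    rw [mul_assoc, Derivation.leibniz, dK_C, dK_one_quadF_pow, Derivation.leibniz, dK_lf,
      Matrix.one_mulVec]
    simp only [smul_eq_mul, mul_zero, add_zero]
    ring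
  rw [e1]
  simp only [Nat.cast_add, Nat.cast_one, C_mul, C_add, C_sub, C_1, map_ofNat C 2, hn]
  ring

end ops

/-! ## The orthogonal Lie algebra `so(n + 2, ℂ)`

With `ℓ = n / 2 + 1` (natural division) we have `n + 2 = 2ℓ` for `n` even and `n + 2 = 2ℓ + 1` for
`n` odd. The index set `{±1, …, ±ℓ}` (`n` even) or `{0, ±1, …, ±ℓ}` (`n` odd) is `AIdx n`:
`Sum.inl a` stands for `a + 1`, `Sum.inr (Sum.inl a)` for `-(a + 1)`, and `Sum.inr (Sum.inr _)`
for `0`. -/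

/-- Indices `±1, …, ±k`, together with `0` when `e = 1`. -/
abbrev Idx (k e : ℕ) : Type := Fin k ⊕ Fin k ⊕ Fin e

namespace Idx

/-- The involution `i ↦ -i`. -/
def neg {k e : ℕ} : Idx k e → Idx k e
  | .inl a => .inr (.inl a)
  | .inr (.inl a) => .inl a
  | .inr (.inr z) => .inr (.inr z)

/-- The embedding of indices which sends `±a` to `±(a + 1)` and `0` to `0`. -/
def up {k e : ℕ} : Idx k e → Idx (k + 1) e
  | .inl a => .inl a.succ
  | .inr (.inl a) => .inr (.inl a.succ)
  | .inr (.inr z) => .inr (.inr z)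

@[simp] lemma neg_neg {k e : ℕ} (i : Idx k e) : i.neg.neg = i := by
  rcases i with a | a | z <;> rfl

lemma eq_neg_comm {k e : ℕ} (i j : Idx k e) : i = j.neg ↔ j = i.neg := by
  constructor <;> rintro rfl <;> simp

@[simp] lemma neg_up {k e : ℕ} (i : Idx k e) : (up i).neg = up i.neg := by
  rcases i with a | a | z <;> rfl

lemma sum_neg {k e : ℕ} {M : Type} [AddCommMonoid M] (f : Idx k e → M) :
    ∑ i : Idx k e, f i.neg = ∑ i : Idx k e, f i :=
  Fintype.sum_equiv ⟨neg, neg, neg_neg, neg_neg⟩ _ _ fun _ => rfl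

end Idx

/-- The index set of the coordinates of `ℂ^(n + 2)`. -/
abbrev AIdx (n : ℕ) : Type := Idx (n / 2 + 1) (n % 2)

/-- The index set `{(0), ±2, …, ±ℓ}` of the coordinates of `ℂ^n`; the index `±(a + 2)` is
represented by `a : Fin (n / 2)`, and `Idx.up : SIdx n → AIdx n` is the inclusion. -/
abbrev SIdx (n : ℕ) : Type := Idx (n / 2) (n % 2)

/-- The index `1`. -/
def one (n : ℕ) : AIdx n := .inl 0

lemma sum_AIdx {n : ℕ} {M : Type} [AddCommMonoid M] (f : AIdx n → M) :
    ∑ i : AIdx n, f i = f (one n) + f (one n).neg + ∑ p : SIdx n, f p.up := by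
  simp only [Fintype.sum_sum_type, Fin.sum_univ_succ, one, Idx.neg, Idx.up]
  abel

section algebra
attribute [local instance] LieRing.ofAssociativeRing

/-- The matrix of the symmetric bilinear form on `ℂ^(n + 2)` obtained by polarizing the quadratic
form `∑_{j = 1}^ℓ U_j U_{-j} + (1/2) U_0²`. -/
def polarMatrix (n : ℕ) : Matrix (AIdx n) (AIdx n) ℂ :=
  Matrix.of fun i j => if j = i.neg then 1 else 0

/-- The Lie algebra `𝔤 = so(n + 2, ℂ)` of the matrices which preserve the quadratic form
`∑_{j = 1}^ℓ U_j U_{-j} + (1/2) U_0²`. -/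
def so (n : ℕ) : LieSubalgebra ℂ (Matrix (AIdx n) (AIdx n) ℂ) :=
  skewAdjointMatricesLieSubalgebra (polarMatrix n)

lemma mem_so {n : ℕ} (M : Matrix (AIdx n) (AIdx n) ℂ) :
    M ∈ so n ↔ ∀ i j, M j.neg i.neg = - M i j := by
  unfold so
  rw [mem_skewAdjointMatricesLieSubalgebra, mem_skewAdjointMatricesSubmodule]
  unfold Matrix.IsSkewAdjoint Matrix.IsAdjointPair
  rw [← Matrix.ext_iff]
  have h1 : ∀ i j, (M.transpose * polarMatrix n) i j = M j.neg i := by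
    intro i j
    simp [Matrix.mul_apply, polarMatrix, Idx.eq_neg_comm j]
  have h2 : ∀ i j, (polarMatrix n * -M) i j = - M i.neg j := by
    intro i j
    simp [Matrix.mul_apply, polarMatrix]
  simp only [h1, h2]
  constructor
  · intro h i j
    have := h i.neg j
    simpa using this
  · intro h i j
    have := h i.neg j
    simpa using this

lemma so_lie_val {n : ℕ} (x y : so n) : (⁅x, y⁆ : so n).1 = x.1 * y.1 - y.1 * x.1 := rfl

/-- The element `E_{ij}` of `so(n + 2, ℂ)`: the matrix of the vector field
`U_i ∂_{U_j} - U_{-j} ∂_{U_{-i}}`. -/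
def E {n : ℕ} (i j : AIdx n) : so n :=
  ⟨Matrix.single i j 1 - Matrix.single j.neg i.neg 1, by
    rw [mem_so]
    intro a b
    have e1 : i = b.neg ∧ j = a.neg ↔ j.neg = a ∧ i.neg = b := by
      constructor
      · rintro ⟨rfl, rfl⟩; simp
      · rintro ⟨rfl, rfl⟩; simp
    have e2 : j.neg = b.neg ∧ i.neg = a.neg ↔ i = a ∧ j = b := by
      constructor
      · rintro ⟨h1, h2⟩
        exact ⟨by simpa using congrArg Idx.neg h2, by simpa using congrArg Idx.neg h1⟩
      · rintro ⟨rfl, rfl⟩; exact ⟨rfl, rfl⟩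
    simp only [Matrix.sub_apply, Matrix.single_apply, e1, e2]
    ring⟩

end algebra

/-- The basis `E_{11}, …, E_{ℓℓ}` of the Cartan subalgebra `𝔥` of diagonal matrices. -/
def cartan {n : ℕ} (a : Fin (n / 2 + 1)) : so n := E (.inl a) (.inl a)

/-- The subspace `𝔫⁺`, spanned by the positive root vectors `E_{ab}` (root `ε_a - ε_b`) and
`E_{a,-b}` (root `ε_a + ε_b`) for `1 ≤ a < b ≤ ℓ`, and, if `n` is odd, `E_{a,0}` (root `ε_a`). -/
def nPos (n : ℕ) : Submodule ℂ (so n) :=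
  Submodule.span ℂ
    ({x | ∃ a b : Fin (n / 2 + 1), a < b ∧
        (x = E (.inl a) (.inl b) ∨ x = E (.inl a) (.inr (.inl b)))} ∪
      {x | ∃ (a : Fin (n / 2 + 1)) (z : Fin (n % 2)), x = E (.inl a) (.inr (.inr z))})

/-! ## Weights -/

/-- A weight of `𝔤`, that is a linear form on `𝔥`, given by its coordinates with respect to the
basis `ε_1, …, ε_ℓ` of `𝔥*` dual to `E_{11}, …, E_{ℓℓ}`. -/
abbrev Weight (n : ℕ) : Type := Fin (n / 2 + 1) → ℂ

/-- The weight `ε_i`, for `1 ≤ i ≤ ℓ`. -/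
def eps (n i : ℕ) : Weight n := fun j => if (j : ℕ) + 1 = i then 1 else 0

/-- The simple root `α_i`, for `1 ≤ i ≤ ℓ`, in the standard numbering for the types `B_ℓ`
(`n` odd) and `D_ℓ` (`n` even). -/
def simpleRoot (n i : ℕ) : Weight n :=
  if i < n / 2 + 1 then eps n i - eps n (i + 1)
  else if Odd n then eps n i
  else eps n (i - 1) + eps n i

/-- The pairing `⟨μ, α_i^∨⟩` with the simple coroot `α_i^∨`, for `1 ≤ i ≤ ℓ`. These coroots are
`E_{ii} - E_{i+1,i+1}` for `i < ℓ`, and `2 E_{ℓℓ}` (`n` odd) or `E_{ℓ-1,ℓ-1} + E_{ℓℓ}` (`n` even)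
for `i = ℓ`. -/
def corootPairing (n : ℕ) (μ : Weight n) (i : ℕ) : ℂ :=
  if i < n / 2 + 1 then ∑ j, μ j * (eps n i j - eps n (i + 1) j)
  else if Odd n then ∑ j, μ j * (2 * eps n i j)
  else ∑ j, μ j * (eps n (i - 1) j + eps n i j)

/-- The fundamental weight `ϖ_i`, for `1 ≤ i ≤ ℓ`, of type `B_ℓ` (`n` odd) or `D_ℓ` (`n` even). -/
def fundWeight (n i : ℕ) : Weight n := fun j =>
  if i = n / 2 + 1 then 1 / 2
  else if Even n ∧ i = n / 2 then (if (j : ℕ) = n / 2 then -(1 / 2) else 1 / 2)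
  else if (j : ℕ) < i then 1 else 0

lemma sum_eps {n : ℕ} (μ : Weight n) (i : ℕ) (hi : 1 ≤ i) (hi' : i ≤ n / 2 + 1) :
    ∑ j, μ j * eps n i j = μ ⟨i - 1, by omega⟩ := by
  rw [Finset.sum_eq_single (⟨i - 1, by omega⟩ : Fin (n / 2 + 1))]
  · simp [eps]; omega
  · intro j _ hj
    have : (j : ℕ) + 1 ≠ i := fun h => hj (Fin.ext (by simp; omega))
    simp [eps, this]
  · simp

/-- The fundamental weights are dual to the simple coroots. -/
lemma corootPairing_fundWeight {n : ℕ} (hn : 3 ≤ n) (i j : ℕ) (hi : 1 ≤ i) (hi' : i ≤ n / 2 + 1)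
    (hj : 1 ≤ j) (hj' : j ≤ n / 2 + 1) :
    corootPairing n (fundWeight n j) i = if i = j then 1 else 0 := by
  have e2 : ∀ μ : Weight n, ∑ j, μ j * (2 * eps n i j) = 2 * ∑ j, μ j * eps n i j := by
    intro μ; rw [Finset.mul_sum]; exact Finset.sum_congr rfl fun _ _ => by ring
  unfold corootPairing
  simp only [mul_sub, mul_add, Finset.sum_sub_distrib, Finset.sum_add_distrib, e2]
  rw [sum_eps _ i hi hi']
  split_ifs with h1 h2 h3 h4 h5
  all_goals first
    | rw [sum_eps _ (i + 1) (by omega) (by omega)]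
    | rw [sum_eps _ (i - 1) (by omega) (by omega)]
    | skip
  all_goals simp only [fundWeight]
  all_goals (split_ifs <;> first | (exfalso; grind) | norm_num)

/-! ## Highest weight modules, Verma modules and their simple quotients -/

/-- `M` is a highest weight module with highest weight `lam`: it is generated by a non-zero vector
of weight `lam` which is annihilated by `𝔫⁺`. -/
def IsHighestWeightModule (n : ℕ) (M : Type) [AddCommGroup M] [Module ℂ M]
    [LieRingModule (so n) M] [LieModule ℂ (so n) M] (lam : Weight n) : Prop :=
  ∃ v : M, v ≠ 0 ∧ (∀ x ∈ nPos n, ⁅x, v⁆ = 0) ∧ (∀ a, ⁅(cartan a : so n), v⁆ = lam a • v) ∧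
    LieSubmodule.lieSpan ℂ (so n) {v} = ⊤

/-- The socle of a `𝔤`-module: the sum of its simple submodules. -/
def socle (n : ℕ) (M : Type) [AddCommGroup M] [Module ℂ M]
    [LieRingModule (so n) M] [LieModule ℂ (so n) M] : LieSubmodule ℂ (so n) M :=
  sSup {N | LieModule.IsIrreducible ℂ (so n) N}

/-- The left ideal of `U(𝔤)` generated by `𝔫⁺` and by the elements `h - lam(h)`, `h ∈ 𝔥`. -/
def vermaIdeal (n : ℕ) (lam : Weight n) :
    Submodule (UniversalEnvelopingAlgebra ℂ (so n)) (UniversalEnvelopingAlgebra ℂ (so n)) :=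
  Submodule.span _
    ((UniversalEnvelopingAlgebra.ι ℂ (L := so n)) '' (nPos n : Set (so n)) ∪
      Set.range fun a => UniversalEnvelopingAlgebra.ι ℂ (cartan a : so n) -
        algebraMap ℂ (UniversalEnvelopingAlgebra ℂ (so n)) (lam a))

/-- The Verma module `M(lam)`. -/
def Verma (n : ℕ) (lam : Weight n) : Type :=
  UniversalEnvelopingAlgebra ℂ (so n) ⧸ vermaIdeal n lam

instance (n : ℕ) (lam : Weight n) : AddCommGroup (Verma n lam) :=
  inferInstanceAs (AddCommGroup (UniversalEnvelopingAlgebra ℂ (so n) ⧸ vermaIdeal n lam))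

instance (n : ℕ) (lam : Weight n) : Module (UniversalEnvelopingAlgebra ℂ (so n)) (Verma n lam) :=
  inferInstanceAs (Module (UniversalEnvelopingAlgebra ℂ (so n))
    (UniversalEnvelopingAlgebra ℂ (so n) ⧸ vermaIdeal n lam))

instance (n : ℕ) (lam : Weight n) : Module ℂ (Verma n lam) :=
  inferInstanceAs (Module ℂ (UniversalEnvelopingAlgebra ℂ (so n) ⧸ vermaIdeal n lam))

instance (n : ℕ) (lam : Weight n) :
    IsScalarTower ℂ (UniversalEnvelopingAlgebra ℂ (so n)) (Verma n lam) :=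
  inferInstanceAs (IsScalarTower ℂ (UniversalEnvelopingAlgebra ℂ (so n))
    (UniversalEnvelopingAlgebra ℂ (so n) ⧸ vermaIdeal n lam))

section verma
attribute [local instance] LieRing.ofAssociativeRing

instance (n : ℕ) (lam : Weight n) : LieRingModule (so n) (Verma n lam) where
  bracket x m := UniversalEnvelopingAlgebra.ι ℂ x • m
  add_lie x y m := by rw [map_add, add_smul]
  lie_add x m m' := smul_add _ _ _
  leibniz_lie x y m := by
    rw [LieHom.map_lie, LieRing.of_associative_ring_bracket, sub_smul, mul_smul, mul_smul,
      sub_add_cancel]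

instance (n : ℕ) (lam : Weight n) : LieModule ℂ (so n) (Verma n lam) where
  smul_lie t x m := by
    change UniversalEnvelopingAlgebra.ι ℂ (t • x) • m = t • (UniversalEnvelopingAlgebra.ι ℂ x • m)
    rw [map_smul, smul_assoc]
  lie_smul t x m := by
    change UniversalEnvelopingAlgebra.ι ℂ x • (t • m) = t • (UniversalEnvelopingAlgebra.ι ℂ x • m)
    rw [← algebraMap_smul (UniversalEnvelopingAlgebra ℂ (so n)) t m,
      ← algebraMap_smul (UniversalEnvelopingAlgebra ℂ (so n)) t, ← mul_smul, ← mul_smul,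
      Algebra.commutes]

end verma

/-- The simple quotient `L(lam)` of the Verma module `M(lam)`: the quotient by the sum of all
proper submodules. -/
abbrev SimpleHW (n : ℕ) (lam : Weight n) : Type :=
  Verma n lam ⧸ sSup {N : LieSubmodule ℂ (so n) (Verma n lam) | N ≠ ⊤}

/-! ## The action of `𝔤` on `R_r = ℂ[X_1, …, X_n] / (F ^ r)` -/

section coordinates
variable {n : ℕ}

/-- The index of the variable `X_a`, for `1 ≤ a ≤ ℓ - 1 = n / 2`. -/
def lo (a : Fin (n / 2)) : Fin n := ⟨a, by omega⟩

/-- The index of the variable `X_{a + ℓ - 1}`, for `1 ≤ a ≤ ℓ - 1 = n / 2`. -/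
def hi (a : Fin (n / 2)) : Fin n := ⟨n / 2 + a, by omega⟩

/-- The index of the variable `X_n`, used if `n` is odd. -/
def mid (z : Fin (n % 2)) : Fin n := ⟨2 * (n / 2) + z, by omega⟩

/-- The coordinates `U_{±(a + 1)} = X_a ∓ i X_{a + ℓ - 1}` and, if `n` is odd, `U_0 = √2 X_n`. In
these coordinates `F = ∑_{j = 2}^ℓ U_j U_{-j} + (1/2) U_0²`. -/
def coordU : SIdx n → MvPolynomial (Fin n) ℂ
  | .inl a => X (lo a) - C Complex.I * X (hi a)
  | .inr (.inl a) => X (lo a) + C Complex.I * X (hi a)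
  | .inr (.inr z) => C (Real.sqrt 2 : ℂ) * X (mid z)

/-- The partial derivatives `∂_{U_j}` with respect to the coordinates `U_j`. -/
def partialU : SIdx n → Module.End ℂ (MvPolynomial (Fin n) ℂ)
  | .inl a => (1 / 2 : ℂ) •
      ((pderiv (lo a)).toLinearMap + Complex.I • (pderiv (hi a)).toLinearMap)
  | .inr (.inl a) => (1 / 2 : ℂ) •
      ((pderiv (lo a)).toLinearMap - Complex.I • (pderiv (hi a)).toLinearMap)
  | .inr (.inr z) => (1 / (Real.sqrt 2 : ℂ)) • (pderiv (mid z)).toLinearMap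

/-- The operators `V_{±(a + 1)} = (1/2) (P_a ∓ i P_{a + ℓ - 1})` and, if `n` is odd,
`V_0 = (1/√2) P_n`, where `P_j = P_j(d)`. -/
def opV (d : ℂ) : SIdx n → Module.End ℂ (MvPolynomial (Fin n) ℂ)
  | .inl a => (1 / 2 : ℂ) • (opP d (lo a) - Complex.I • opP d (hi a))
  | .inr (.inl a) => (1 / 2 : ℂ) • (opP d (lo a) + Complex.I • opP d (hi a))
  | .inr (.inr z) => (1 / (Real.sqrt 2 : ℂ)) • opP d (mid z)

/-- The linear map from `𝔤` to the differential operators on `ℂ[X_1, …, X_n]` such that, for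
`p, q ∈ {(0), ±2, …, ±ℓ}`,
`E_{11} ↦ -I(d)`, `E_{p1} ↦ U_p`, `E_{1p} ↦ V_{-p}`, `E_{pq} ↦ U_p ∂_{U_q} - U_{-q} ∂_{U_{-p}}`.
(Note that `x = (1/2) ∑ x_{ij} E_{ij}` for `x ∈ 𝔤` and that `E_{-j,-i} = -E_{ij}`.) -/
def psi (d : ℂ) : so n →ₗ[ℂ] Module.End ℂ (MvPolynomial (Fin n) ℂ) where
  toFun x := -(x.1 (one n) (one n)) • opI n d
    + ∑ p : SIdx n, x.1 p.up (one n) • LinearMap.mulLeft ℂ (coordU p)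
    + ∑ p : SIdx n, x.1 (one n) p.up • opV d p.neg
    + ∑ p : SIdx n, ∑ q : SIdx n,
        x.1 p.up q.up • (LinearMap.mulLeft ℂ (coordU p) ∘ₗ partialU q)
  map_add' x y := by
    have h : ∀ i j, (x + y).1 i j = x.1 i j + y.1 i j := fun _ _ => rfl
    simp only [h, add_smul, neg_add, Finset.sum_add_distrib]
    abel
  map_smul' c x := by
    have h : ∀ i j, (c • x).1 i j = c * x.1 i j := fun _ _ => rfl
    simp only [h, smul_add, Finset.smul_sum, smul_smul, mul_neg, RingHom.id_apply]

/-- Coefficients of `U_p` in `X_1, …, X_n`. -/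
def coefRow : SIdx n → Fin n → ℂ
  | .inl a => Pi.single (lo a) 1 - Complex.I • Pi.single (hi a) 1
  | .inr (.inl a) => Pi.single (lo a) 1 + Complex.I • Pi.single (hi a) 1
  | .inr (.inr z) => (Real.sqrt 2 : ℂ) • Pi.single (mid z) 1

/-- The matrix of the coefficients of the `U_p`. -/
def coef (n : ℕ) : Matrix (SIdx n) (Fin n) ℂ := Matrix.of coefRow

/-- The matrix of the coefficients of the `∂_{U_p}` in `∂_1, …, ∂_n`. -/
def dcoef (n : ℕ) : Matrix (SIdx n) (Fin n) ℂ :=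
  Matrix.of fun q => (1 / 2 : ℂ) • coefRow q.neg

lemma coef_row (p : SIdx n) : coef n p = coefRow p := rfl

lemma dcoef_row (p : SIdx n) : dcoef n p = (1 / 2 : ℂ) • coefRow p.neg := rfl

lemma lf_single (i : Fin n) : lf (Pi.single i 1) = X i := by
  simp [lf, Pi.single_apply]

lemma dv_single (i : Fin n) (f : MvPolynomial (Fin n) ℂ) : dv (Pi.single i 1) f = pderiv i f := by
  simp [dv_eq, Pi.single_apply]

lemma coordU_eq (p : SIdx n) : coordU p = lf (coef n p) := by
  rcases p with a | a | z <;>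
  simp only [coordU, coef_row, coefRow, lf_sub, lf_add, lf_smul, lf_single]

lemma inv_sqrt_two : (1 / (Real.sqrt 2 : ℂ)) = 1 / 2 * (Real.sqrt 2 : ℂ) := by
  have h : (Real.sqrt 2 : ℂ) * (Real.sqrt 2 : ℂ) = 2 := by
    rw [← Complex.ofReal_mul, Real.mul_self_sqrt (by norm_num)]; simp
  have h0 : (Real.sqrt 2 : ℂ) ≠ 0 := by
    intro h0; rw [h0] at h; norm_num at h
  field_simp
  rw [pow_two, h]

lemma partialU_eq (q : SIdx n) (f : MvPolynomial (Fin n) ℂ) :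
    partialU q f = dv (dcoef n q) f := by
  rcases q with a | a | z <;>
  simp only [partialU, dcoef_row, coefRow, dv_sub, dv_add, dv_smul, dv_single, Idx.neg,
    LinearMap.smul_apply, LinearMap.add_apply, LinearMap.sub_apply, smul_eq_C_mul,
    inv_sqrt_two, C_mul, mul_assoc] <;> rfl

/-- `P_w` for a vector `w`. -/
def vecP (d : ℂ) (w : Fin n → ℂ) (f : MvPolynomial (Fin n) ℂ) : MvPolynomial (Fin n) ℂ :=
  lf w * laplacian n f - (dK 1 (dv w f) + C d * dv w f)

lemma opP_eq (d : ℂ) (j : Fin n) (f : MvPolynomial (Fin n) ℂ) :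
    opP d j f = vecP d (Pi.single j 1) f := by
  simp [opP, opI, vecP, lf_single, dv_single, euler_eq, smul_eq_C_mul]

lemma vecP_add (d : ℂ) (v w : Fin n → ℂ) (f : MvPolynomial (Fin n) ℂ) :
    vecP d (v + w) f = vecP d v f + vecP d w f := by
  simp only [vecP, lf_add, dv_add, map_add]; ring

lemma vecP_smul (d c : ℂ) (w : Fin n → ℂ) (f : MvPolynomial (Fin n) ℂ) :
    vecP d (c • w) f = C c * vecP d w f := by
  simp only [vecP, lf_smul, dv_smul, Derivation.leibniz, dK_C, smul_eq_mul]; ring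

lemma vecP_sub (d : ℂ) (v w : Fin n → ℂ) (f : MvPolynomial (Fin n) ℂ) :
    vecP d (v - w) f = vecP d v f - vecP d w f := by
  simp only [vecP, lf_sub, dv_sub, map_sub]; ring

lemma vecP_sum {ι : Type} (s : Finset ι) (d : ℂ) (w : ι → Fin n → ℂ)
    (f : MvPolynomial (Fin n) ℂ) : vecP d (∑ i ∈ s, w i) f = ∑ i ∈ s, vecP d (w i) f := by
  classical
  induction s using Finset.induction_on with
  | empty => simp [vecP, lf, dv_eq]
  | insert a s ha ih => rw [Finset.sum_insert ha, Finset.sum_insert ha, vecP_add, ih]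

lemma lf_sum {ι : Type} (s : Finset ι) (w : ι → Fin n → ℂ) :
    lf (∑ i ∈ s, w i) = ∑ i ∈ s, lf (w i) := by
  classical
  induction s using Finset.induction_on with
  | empty => simp [lf]
  | insert a s ha ih => rw [Finset.sum_insert ha, Finset.sum_insert ha, lf_add, ih]

lemma opV_eq (d : ℂ) (p : SIdx n) (f : MvPolynomial (Fin n) ℂ) :
    opV d p.neg f = vecP d (dcoef n p) f := by
  rcases p with a | a | z <;>
  simp only [opV, dcoef_row, coefRow, vecP_sub, vecP_add, vecP_smul, opP_eq, Idx.neg,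
    LinearMap.smul_apply, LinearMap.add_apply, LinearMap.sub_apply, smul_eq_C_mul,
    inv_sqrt_two, C_mul, mul_assoc]

lemma coef_dot (p q : SIdx n) : dcoef n q ⬝ᵥ coef n p = if p = q then 1 else 0 := by
  have hs : (Real.sqrt 2 : ℂ) * (Real.sqrt 2 : ℂ) = 2 := by
    rw [← Complex.ofReal_mul, Real.mul_self_sqrt (by norm_num)]; simp
  have h1 : ∀ a b : Fin (n / 2), lo a = lo b ↔ a = b := fun a b => by
    simp [lo, Fin.ext_iff]
  have h2 : ∀ a b : Fin (n / 2), hi a = hi b ↔ a = b := fun a b => by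
    simp [hi, Fin.ext_iff]
  have h3 : ∀ a b : Fin (n / 2), lo a ≠ hi b := fun a b => by
    simp [lo, hi, Fin.ext_iff]; omega
  have h4 : ∀ (a : Fin (n / 2)) (z : Fin (n % 2)), lo a ≠ mid z := fun a z => by
    simp [lo, mid, Fin.ext_iff]; omega
  have h5 : ∀ (a : Fin (n / 2)) (z : Fin (n % 2)), hi a ≠ mid z := fun a z => by
    simp [hi, mid, Fin.ext_iff]; omega
  have h6 : ∀ (a b : Fin (n % 2)), a = b := fun a b => by omega
  rcases p with a | a | z <;> rcases q with b | b | y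
  all_goals
    simp only [dcoef_row, coef_row, coefRow, Idx.neg, smul_dotProduct, dotProduct_smul,
      sub_dotProduct, dotProduct_sub, add_dotProduct, dotProduct_add, single_one_dotProduct,
      Pi.single_apply, h1, h2, h3, h4, h5, (h3 _ _).symm, (h4 _ _).symm, (h5 _ _).symm, smul_eq_mul]
  all_goals simp [eq_comm]
  · by_cases h : a = b <;> simp [h]
    linear_combination (1 / 2 : ℂ) * Complex.I_mul_I
  · by_cases h : a = b <;> simp [h]
    linear_combination (-1 / 2 : ℂ) * Complex.I_mul_I
  · by_cases h : a = b <;> simp [h]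
    linear_combination (-1 / 2 : ℂ) * Complex.I_mul_I
  · by_cases h : a = b <;> simp [h]
    linear_combination (1 / 2 : ℂ) * Complex.I_mul_I
  · rw [if_pos (h6 z y), if_pos (by rw [h6 z y])]
    linear_combination (-1 / 2 : ℂ) * hs

lemma dcoef_mul_coef : dcoef n * (coef n).transpose = 1 := by
  ext q p
  rw [Matrix.mul_apply]
  have := coef_dot p q
  rw [dotProduct] at this
  simp only [Matrix.transpose_apply]
  rw [this, Matrix.one_apply]
  simp [eq_comm]

/-- The block of `x` with indices different from `±1`. -/
def blk (x : so n) : Matrix (SIdx n) (SIdx n) ℂ := Matrix.of fun p q => x.1 p.up q.up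

/-- The part of the first column of `x` with indices different from `±1`. -/
def col (x : so n) : SIdx n → ℂ := fun p => x.1 p.up (one n)

/-- The part of the first row of `x` with indices different from `±1`. -/
def row (x : so n) : SIdx n → ℂ := fun p => x.1 (one n) p.up

lemma psi_eq (d : ℂ) (x : so n) (f : MvPolynomial (Fin n) ℂ) :
    psi d x f = opT d (x.1 (one n) (one n)) (Matrix.mulVec (coef n).transpose (col x))
      (Matrix.vecMul (row x) (dcoef n)) ((coef n).transpose * blk x * dcoef n) f := by
  have h1 : Matrix.mulVec (coef n).transpose (col x) = ∑ p, col x p • coef n p := by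
    ext i; simp [Matrix.mulVec, dotProduct, mul_comm]
  have h2 : Matrix.vecMul (row x) (dcoef n) = ∑ p, row x p • dcoef n p := by
    ext i; simp [Matrix.vecMul, dotProduct]
  have h3 : dK ((coef n).transpose * blk x * dcoef n) f =
      ∑ p, ∑ q, C (blk x p q) * (lf (coef n p) * dv (dcoef n q) f) := by
    have e : ∀ i j, ((coef n).transpose * blk x * dcoef n) i j =
        ∑ p, ∑ q, blk x p q * coef n p i * dcoef n q j := by
      intro i j
      simp only [Matrix.mul_apply, Matrix.transpose_apply, Finset.sum_mul]
      rw [Finset.sum_comm]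
      exact Finset.sum_congr rfl fun p _ => Finset.sum_congr rfl fun q _ => by ring
    have r : ∀ p q, C (blk x p q) * (lf (coef n p) * dv (dcoef n q) f) =
        ∑ i, ∑ j, C (blk x p q * coef n p i * dcoef n q j) * (X i * pderiv j f) := by
      intro p q
      rw [lf, dv_eq, Finset.sum_mul_sum, Finset.mul_sum]
      refine Finset.sum_congr rfl fun i _ => ?_
      rw [Finset.mul_sum]
      refine Finset.sum_congr rfl fun j _ => ?_
      simp only [C_mul]; ring
    simp only [r, dK_eq, e, map_sum, Finset.sum_mul]
    rw [Finset.sum_congr rfl fun i _ => Finset.sum_comm]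
    rw [Finset.sum_comm]
    refine Finset.sum_congr rfl fun p _ => ?_
    rw [Finset.sum_congr rfl fun i _ => Finset.sum_congr rfl fun j _ => rfl]
    rw [Finset.sum_congr rfl fun i _ => Finset.sum_comm]
    rw [Finset.sum_comm]
  have h4 : ∀ w, lf w * laplacian n f - (dK 1 (dv w f) + C d * dv w f) = vecP d w f :=
    fun _ => rfl
  rw [opT, h3, h4, h1, h2, lf_sum, vecP_sum]
  have h5 : psi d x f = -(x.1 (one n) (one n)) • opI n d f
      + ∑ p : SIdx n, x.1 p.up (one n) • (coordU p * f)
      + ∑ p : SIdx n, x.1 (one n) p.up • opV d p.neg f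
      + ∑ p : SIdx n, ∑ q : SIdx n, x.1 p.up q.up • (coordU p * partialU q f) := by
    simp only [psi, LinearMap.coe_mk, AddHom.coe_mk, LinearMap.add_apply, LinearMap.sum_apply,
      LinearMap.smul_apply, LinearMap.mulLeft_apply, LinearMap.comp_apply]
  have h6 : opI n d f = dK 1 f + C d * f := by
    simp [opI, euler_eq, smul_eq_C_mul]
  rw [h5, h6]
  simp only [partialU_eq, coordU_eq, opV_eq, vecP_smul, lf_smul, smul_eq_C_mul, Finset.sum_mul,
    C_neg, mul_assoc]
  rfl

section blocks
variable (x y : so n)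

lemma so_apply (i j : AIdx n) : x.1 j.neg i.neg = - x.1 i j := (mem_so x.1).1 x.2 i j

lemma so_one_neg : x.1 (one n) (one n).neg = 0 := by
  have := so_apply x (one n) (one n).neg
  rw [Idx.neg_neg] at this
  exact self_eq_neg.mp this

lemma so_neg_one : x.1 (one n).neg (one n) = 0 := by
  have := so_apply x (one n).neg (one n)
  rw [Idx.neg_neg] at this
  exact self_eq_neg.mp this

lemma so_up_neg (p : SIdx n) : x.1 p.up (one n).neg = - row x p.neg := by
  have := so_apply x (one n) p.neg.up
  rw [Idx.neg_up, Idx.neg_neg] at this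
  rw [this]; rfl

lemma so_neg_up (p : SIdx n) : x.1 (one n).neg p.up = - col x p.neg := by
  have := so_apply x p.neg.up (one n)
  rw [Idx.neg_up, Idx.neg_neg] at this
  rw [this]; rfl

lemma blk_neg (p q : SIdx n) : blk x q.neg p.neg = - blk x p q := by
  have := so_apply x p.up q.up
  rw [Idx.neg_up, Idx.neg_up] at this
  exact this

lemma lie_apply (i j : AIdx n) : (⁅x, y⁆ : so n).1 i j =
    ∑ k, x.1 i k * y.1 k j - ∑ k, y.1 i k * x.1 k j := by
  rw [so_lie_val]; rfl

lemma lie_one_one : (⁅x, y⁆ : so n).1 (one n) (one n) = row x ⬝ᵥ col y - row y ⬝ᵥ col x := by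
  rw [lie_apply, sum_AIdx, sum_AIdx]
  simp only [so_one_neg, dotProduct, row, col]
  ring

lemma col_lie : col ⁅x, y⁆ = y.1 (one n) (one n) • col x - x.1 (one n) (one n) • col y +
    Matrix.mulVec (blk x) (col y) - Matrix.mulVec (blk y) (col x) := by
  ext p
  rw [col, lie_apply, sum_AIdx, sum_AIdx]
  simp only [so_neg_one, Pi.add_apply, Pi.sub_apply, Pi.smul_apply, smul_eq_mul, Matrix.mulVec,
    dotProduct, col, blk, Matrix.of_apply]
  ring

lemma row_lie : row ⁅x, y⁆ = x.1 (one n) (one n) • row y - y.1 (one n) (one n) • row x +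
    Matrix.vecMul (row x) (blk y) - Matrix.vecMul (row y) (blk x) := by
  ext p
  rw [row, lie_apply, sum_AIdx, sum_AIdx]
  simp only [so_one_neg, Pi.add_apply, Pi.sub_apply, Pi.smul_apply, smul_eq_mul, Matrix.vecMul,
    dotProduct, row, blk, Matrix.of_apply]
  ring

lemma blk_lie : blk ⁅x, y⁆ = Matrix.vecMulVec (col x) (row y) - Matrix.vecMulVec (col y) (row x) +
    Matrix.vecMulVec (fun p : SIdx n => row x p.neg) (fun q : SIdx n => col y q.neg) -
    Matrix.vecMulVec (fun p : SIdx n => row y p.neg) (fun q : SIdx n => col x q.neg) +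
    (blk x * blk y - blk y * blk x) := by
  ext p q
  have h : blk ⁅x, y⁆ p q = (⁅x, y⁆ : so n).1 p.up q.up := rfl
  rw [h, lie_apply, sum_AIdx, sum_AIdx]
  simp only [so_up_neg, so_neg_up, Matrix.add_apply, Matrix.sub_apply, Matrix.vecMulVec_apply,
    Matrix.mul_apply, blk, Matrix.of_apply, row, col]
  ring

lemma dcoef_apply (p : SIdx n) (i : Fin n) : dcoef n p i = (1 / 2 : ℂ) * coef n p.neg i := rfl

lemma transpose_mulVec_neg (v : SIdx n → ℂ) :
    Matrix.mulVec (coef n).transpose (fun p => v p.neg) = (2 : ℂ) • Matrix.vecMul v (dcoef n) := by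
  ext i
  simp only [Matrix.mulVec, Matrix.vecMul, dotProduct, Matrix.transpose_apply, Pi.smul_apply,
    smul_eq_mul, Finset.mul_sum, dcoef_apply]
  rw [← Idx.sum_neg]
  simp only [Idx.neg_neg]
  exact Finset.sum_congr rfl fun p _ => by ring

lemma vecMul_neg (v : SIdx n → ℂ) : (2 : ℂ) • Matrix.vecMul (fun p => v p.neg) (dcoef n) =
    Matrix.mulVec (coef n).transpose v := by
  rw [← transpose_mulVec_neg]; simp only [Idx.neg_neg]

lemma skew_blk : ((coef n).transpose * blk x * dcoef n).transpose =
    -((coef n).transpose * blk x * dcoef n) := by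
  ext i j
  have e : ∀ i j, ((coef n).transpose * blk x * dcoef n) i j =
      ∑ q : SIdx n, ∑ p : SIdx n, coef n p i * blk x p q * dcoef n q j := by
    intro i j
    simp only [Matrix.mul_apply, Matrix.transpose_apply, Finset.sum_mul]
  rw [Matrix.transpose_apply, Matrix.neg_apply, e, e, Finset.sum_comm, ← Idx.sum_neg,
    ← Finset.sum_neg_distrib]
  refine Finset.sum_congr rfl fun q _ => ?_
  rw [← Idx.sum_neg, ← Finset.sum_neg_distrib]
  refine Finset.sum_congr rfl fun p _ => ?_
  rw [blk_neg x p q, dcoef_apply, dcoef_apply, Idx.neg_neg]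
  ring

lemma psi_lie (d : ℂ) (f : MvPolynomial (Fin n) ℂ) :
    psi d ⁅x, y⁆ f = psi d x (psi d y f) - psi d y (psi d x f) := by
  simp only [psi_eq]
  rw [opT_bracket _ _ _ _ _ _ _ _ _ (skew_blk x) (skew_blk y)]
  have hm : ∀ A : Matrix (SIdx n) (SIdx n) ℂ, ∀ v : SIdx n → ℂ,
      ((coef n).transpose * A * dcoef n).mulVec ((coef n).transpose.mulVec v) =
      (coef n).transpose.mulVec (A.mulVec v) := by
    intro A v
    rw [Matrix.mulVec_mulVec, Matrix.mul_assoc, dcoef_mul_coef, Matrix.mul_one,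
      Matrix.mulVec_mulVec]
  have hd : ∀ v w : SIdx n → ℂ,
      Matrix.vecMul v (dcoef n) ⬝ᵥ (coef n).transpose.mulVec w = v ⬝ᵥ w := by
    intro v w
    rw [← Matrix.dotProduct_mulVec, Matrix.mulVec_mulVec, dcoef_mul_coef, Matrix.one_mulVec]
  have hv : ∀ z : so n, ∀ v : SIdx n → ℂ,
      ((coef n).transpose * blk z * dcoef n).mulVec (Matrix.vecMul v (dcoef n)) =
      - Matrix.vecMul (Matrix.vecMul v (blk z)) (dcoef n) := by
    intro z v
    rw [← Matrix.vecMul_transpose, skew_blk, Matrix.vecMul_neg, Matrix.vecMul_vecMul,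
      ← Matrix.mul_assoc, ← Matrix.mul_assoc, dcoef_mul_coef, Matrix.one_mul,
      Matrix.vecMul_vecMul]
  have hp : ∀ A B : Matrix (SIdx n) (SIdx n) ℂ,
      ((coef n).transpose * A * dcoef n) * ((coef n).transpose * B * dcoef n) =
      (coef n).transpose * (A * B) * dcoef n := by
    intro A B
    calc _ = (coef n).transpose * A * (dcoef n * (coef n).transpose) * B * dcoef n := by
          simp only [Matrix.mul_assoc]
      _ = _ := by rw [dcoef_mul_coef, Matrix.mul_one]; simp only [Matrix.mul_assoc]
  have hw : ∀ v w : SIdx n → ℂ, (coef n).transpose *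
      (Matrix.vecMulVec v w : Matrix (SIdx n) (SIdx n) ℂ) * dcoef n =
      Matrix.vecMulVec ((coef n).transpose.mulVec v) (Matrix.vecMul w (dcoef n)) := by
    intro v w
    rw [Matrix.mul_vecMulVec, Matrix.vecMulVec_mul]
  have hw' : ∀ v w : SIdx n → ℂ,
      Matrix.vecMulVec ((coef n).transpose.mulVec fun p : SIdx n => v p.neg)
        (Matrix.vecMul (fun p : SIdx n => w p.neg) (dcoef n)) =
      Matrix.vecMulVec (Matrix.vecMul v (dcoef n)) ((coef n).transpose.mulVec w) := by
    intro v w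
    rw [transpose_mulVec_neg, ← vecMul_neg w]
    ext i j
    simp only [Matrix.vecMulVec_apply, Pi.smul_apply, smul_eq_mul]
    ring
  congr 1
  · rw [lie_one_one, hd, hd]
  · simp only [col_lie, Matrix.mulVec_add, Matrix.mulVec_sub, Matrix.mulVec_smul, hm]
  · simp only [row_lie, Matrix.add_vecMul, Matrix.sub_vecMul, Matrix.smul_vecMul, hv]
    abel
  · simp only [blk_lie, Matrix.mul_add, Matrix.mul_sub, Matrix.add_mul, Matrix.sub_mul, hw, hw', hp]
    abel

end blocks

/-- The operators `psi d x` with `d = n/2 - r` preserve the ideal `(F ^ r)`. -/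
lemma psi_mem (r : ℕ) (x : so n) (f : MvPolynomial (Fin n) ℂ)
    (hf : f ∈ Ideal.span {quadF n ^ r}) :
    psi ((n : ℂ) / 2 - r) x f ∈ Ideal.span {quadF n ^ r} := by
  rw [psi_eq]
  exact opT_mem r _ _ _ _ (skew_blk x) f hf

end coordinates

/-- The ring `R_r = ℂ[X_1, …, X_n] / (F ^ r)`. -/
def Rr (n r : ℕ) : Type := MvPolynomial (Fin n) ℂ ⧸ Ideal.span {quadF n ^ r}

instance (n r : ℕ) : CommRing (Rr n r) :=
  inferInstanceAs (CommRing (MvPolynomial (Fin n) ℂ ⧸ Ideal.span {quadF n ^ r}))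

instance (n r : ℕ) : Algebra ℂ (Rr n r) :=
  inferInstanceAs (Algebra ℂ (MvPolynomial (Fin n) ℂ ⧸ Ideal.span {quadF n ^ r}))

/-- The projection `ℂ[X_1, …, X_n] → R_r`. -/
def toRr (n r : ℕ) : MvPolynomial (Fin n) ℂ →ₐ[ℂ] Rr n r :=
  Ideal.Quotient.mkₐ ℂ (Ideal.span {quadF n ^ r})

lemma toRr_surjective (n r : ℕ) : Function.Surjective (toRr n r) :=
  Ideal.Quotient.mkₐ_surjective ℂ _

lemma toRr_eq_iff {n r : ℕ} (f g : MvPolynomial (Fin n) ℂ) :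
    toRr n r f = toRr n r g ↔ f - g ∈ Ideal.span {quadF n ^ r} :=
  Ideal.Quotient.eq

/-- The operator on `R_r` induced by `psi d x`, where `d = n/2 - r`. -/
def actRr (n r : ℕ) (x : so n) : Rr n r → Rr n r :=
  Quotient.map' (psi ((n : ℂ) / 2 - r) x) (by
    intro f g h
    rw [← Quotient.eq''] at h
    have h' : toRr n r f = toRr n r g := h
    rw [toRr_eq_iff] at h'
    rw [← Quotient.eq'']
    change toRr n r _ = toRr n r _
    rw [toRr_eq_iff, ← map_sub]
    exact psi_mem r x _ h')

lemma actRr_toRr (n r : ℕ) (x : so n) (f : MvPolynomial (Fin n) ℂ) :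
    actRr n r x (toRr n r f) = toRr n r (psi ((n : ℂ) / 2 - r) x f) := rfl

/-- The action of `𝔤 = so(n + 2, ℂ)` on `R_r`. -/
instance (n r : ℕ) : LieRingModule (so n) (Rr n r) where
  bracket x m := actRr n r x m
  add_lie x y m := by
    obtain ⟨f, rfl⟩ := toRr_surjective n r m
    simp only [actRr_toRr, map_add, LinearMap.add_apply]
  lie_add x m m' := by
    obtain ⟨f, rfl⟩ := toRr_surjective n r m
    obtain ⟨g, rfl⟩ := toRr_surjective n r m'
    simp only [← map_add, actRr_toRr]
  leibniz_lie x y m := by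
    obtain ⟨f, rfl⟩ := toRr_surjective n r m
    simp only [actRr_toRr, ← map_add, psi_lie, sub_add_cancel]

lemma lie_toRr {n r : ℕ} (x : so n) (f : MvPolynomial (Fin n) ℂ) :
    ⁅x, toRr n r f⁆ = toRr n r (psi ((n : ℂ) / 2 - r) x f) := rfl

instance (n r : ℕ) : LieModule ℂ (so n) (Rr n r) where
  smul_lie t x m := by
    obtain ⟨f, rfl⟩ := toRr_surjective n r m
    rw [lie_toRr, lie_toRr, ← map_smul, map_smul (psi ((n : ℂ) / 2 - r)) t x, LinearMap.smul_apply]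
  lie_smul t x m := by
    obtain ⟨f, rfl⟩ := toRr_surjective n r m
    simp only [lie_toRr, ← map_smul]

/-! ## Harmonic polynomials in `n + 2` variables -/

/-- The Laplacian `Δ = ∂_{U_0}² + 2 ∑_{j = 1}^ℓ ∂_{U_j} ∂_{U_{-j}}` (without the term `∂_{U_0}²` if
`n` is even) on the polynomials in the `n + 2` variables `U_i`, written as `∑_i ∂_{U_i} ∂_{U_{-i}}`
with `i` running over all indices. -/
def ambLaplacian (n : ℕ) : Module.End ℂ (MvPolynomial (AIdx n) ℂ) :=
  ∑ i : AIdx n, (pderiv i).toLinearMap ∘ₗ (pderiv i.neg).toLinearMap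

/-- The space of harmonic homogeneous polynomials of degree `k` in the `n + 2` variables `U_i`. -/
def AmbHarmonic (n k : ℕ) : Submodule ℂ (MvPolynomial (AIdx n) ℂ) :=
  homogeneousSubmodule (AIdx n) ℂ k ⊓ LinearMap.ker (ambLaplacian n)

lemma ambLaplacian_dK {n : ℕ} (x : so n) (f : MvPolynomial (AIdx n) ℂ) :
    ambLaplacian n (dK x.1 f) = dK x.1 (ambLaplacian n f) := by
  have e : ∀ g : MvPolynomial (AIdx n) ℂ,
      ambLaplacian n g = ∑ i : AIdx n, pderiv i (pderiv i.neg g) := by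
    intro g; simp [ambLaplacian]
  have h0 : ∑ i : AIdx n, ∑ j : AIdx n, C (x.1 i.neg j) * pderiv i (pderiv j f) = 0 := by
    apply self_eq_neg.mp
    conv_lhs => rw [Finset.sum_comm]
    rw [← Finset.sum_neg_distrib]
    refine Finset.sum_congr rfl fun i _ => ?_
    rw [← Finset.sum_neg_distrib]
    refine Finset.sum_congr rfl fun j _ => ?_
    have := so_apply x i.neg j
    rw [Idx.neg_neg] at this
    rw [this, C_neg, pderiv_comm' j i]; ring
  have h1 : ∑ i : AIdx n, ∑ j : AIdx n, C (x.1 i j) * pderiv j (pderiv i.neg f) = 0 := by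
    rw [← h0, ← Idx.sum_neg]
    refine Finset.sum_congr rfl fun i _ => Finset.sum_congr rfl fun j _ => ?_
    rw [Idx.neg_neg, pderiv_comm' j i]
  rw [e, e]
  simp only [pderiv_dK, map_add, map_sum, Finset.sum_add_distrib, pderiv_C_mul, h0, h1, add_zero]

lemma dK_homogeneous {n k : ℕ} (K : Matrix (AIdx n) (AIdx n) ℂ) (f : MvPolynomial (AIdx n) ℂ)
    (hf : f.IsHomogeneous k) : (dK K f).IsHomogeneous k := by
  rw [dK_eq]
  refine IsHomogeneous.sum _ _ _ fun i _ => IsHomogeneous.sum _ _ _ fun j _ => ?_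
  apply IsHomogeneous.C_mul
  rcases k with _ | k
  · have h : pderiv j f = 0 := by
      rw [totalDegree_eq_zero_iff_eq_C.1 (Nat.le_zero.1 hf.totalDegree_le), pderiv_C]
    simp only [h, mul_zero]
    exact isHomogeneous_zero _ _ _
  · have := (isHomogeneous_X ℂ i).mul (hf.pderiv (i := j))
    simpa [add_comm] using this

/-- The action of `x ∈ 𝔤` on harmonic polynomials through the vector field
`∑ x_{ij} U_i ∂_{U_j}`; in particular `E_{ij}` acts as `U_i ∂_{U_j} - U_{-j} ∂_{U_{-i}}`. -/
def actHarmonic {n k : ℕ} (x : so n) (m : AmbHarmonic n k) : AmbHarmonic n k :=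
  ⟨∑ i, ∑ j, C (x.1 i j) * (X i * pderiv j m.1), by
    rw [← dK_eq]
    refine ⟨dK_homogeneous _ _ m.2.1, ?_⟩
    have h : ambLaplacian n m.1 = 0 := m.2.2
    change ambLaplacian n _ = 0
    rw [ambLaplacian_dK, h, map_zero]⟩

lemma actHarmonic_val {n k : ℕ} (x : so n) (m : AmbHarmonic n k) :
    (actHarmonic x m).1 = dK x.1 m.1 := by
  rw [dK_eq]; rfl

instance (n k : ℕ) : LieRingModule (so n) (AmbHarmonic n k) where
  bracket x m := actHarmonic x m
  add_lie x y m := by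
    apply Subtype.ext
    simp only [Submodule.coe_add, actHarmonic_val]
    exact dK_add x.1 y.1 m.1
  lie_add x m m' := by
    apply Subtype.ext
    simp only [Submodule.coe_add, actHarmonic_val, map_add]
  leibniz_lie x y m := by
    apply Subtype.ext
    simp only [Submodule.coe_add, actHarmonic_val]
    rw [so_lie_val, dK_comm]
    ring

lemma lie_ambHarmonic {n k : ℕ} (x : so n) (m : AmbHarmonic n k) :
    (⁅x, m⁆ : AmbHarmonic n k).1 = dK x.1 m.1 := actHarmonic_val x m

instance (n k : ℕ) : LieModule ℂ (so n) (AmbHarmonic n k) where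
  smul_lie t x m := by
    apply Subtype.ext
    rw [Submodule.coe_smul, lie_ambHarmonic, lie_ambHarmonic, dK_eq, dK_eq, smul_eq_C_mul,
      Finset.mul_sum]
    refine Finset.sum_congr rfl fun i _ => ?_
    rw [Finset.mul_sum]
    refine Finset.sum_congr rfl fun j _ => ?_
    have : (t • x).1 i j = t * x.1 i j := rfl
    rw [this, C_mul]; ring
  lie_smul t x m := by
    apply Subtype.ext
    rw [Submodule.coe_smul, lie_ambHarmonic, lie_ambHarmonic, Submodule.coe_smul,
      Derivation.map_smul]

/-! ## The weights `λ` and `μ` -/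

/-- The weight `λ = -d ϖ_1 = (r - n/2) ϖ_1`, where `d = n/2 - r`. -/
def lamWeight (n r : ℕ) : Weight n := (-((n : ℂ) / 2 - r)) • fundWeight n 1

/-- The weight `μ = λ + (d - 1) α_1`, where `d = n/2 - r`. -/
def muWeight (n r : ℕ) : Weight n := lamWeight n r + ((n : ℂ) / 2 - r - 1) • simpleRoot n 1

end

end ConformalSO

open ConformalSO

namespace ConformalSO

noncomputable section


/-! ## Highest weight modules -/

/-! The elements `E p.up (one n)` act on `Rr n r` as multiplication by the coordinates. Submodules
are therefore ideals of `ℂ[X_1, …, X_n]` that contain `F ^ r` and are stable under all `P_w`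
(`IsStable`). Commuting `P_w` with coordinates produces the Euler operator and the rotations, so
these ideals are homogeneous and rotation stable.

If `N` is not contained in `N₀`, take a homogeneous `g` of minimal degree `m` in `N` but not in
`N₀`. Since `P_w` lowers degrees, all `P_w g` lie in `N₀`. Modulo `N₀`, the sum `∑ X_j P_j` gives `F
Δ₁ g ≡ m(m - 1 + d) g`. If `m ≠ 1 - d`, the rotations kill `g` too, and their Casimir operator gives
`2 F Δ₁ g ≡ m(m + n - 2) g`; hence `m(m - 2r) g ≡ 0`. The case `m = 2r` is settled by pulling out
powers of `F` until `F ^ r` appears. So either `m = 0` and `N` is everything, or `m = 1 - d`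
(`eq_top_or_exists`). A positive `m = 1 - d` exists only for `n` even and `r ≥ n/2`; otherwise `Rr n
r` is simple.

In degree `1 - d` the operator `P_w` reduces to `f ↦ w Δ₁ f`. It kills `H(1 - d)`, which therefore
generates a submodule `S` (`harmonicSubmodule`). Comparing degrees shows that a submodule not inside
`S` is everything. Irreducibility of `H(1 - d)` under rotations shows that a nonzero submodule
contains `S`. Thus `S` is the socle and the quotient by it is simple.

Harmonic polynomials are treated once for `n` and `n + 2` variables (`splitHarm_le_of_stable`): a
nonzero stable subspace contains the power of an isotropic coordinate, and so would its complement
for the Fischer form, on which that power is not isotropic.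

Finally, an irreducible module with a highest weight vector of weight `ν` is `L(ν)`
(`IsHighestWeightVector.nonempty_equiv`), by a principal grading and the universal property of Verma
modules. The quotient by the socle and the harmonic polynomials of degree `-d` in `n + 2` variables
are both `L(λ)`, which also gives finite dimension. -/

lemma mem_of_sum_eigenvectors_mem {V ι : Type*} [AddCommGroup V] [Module ℂ V] (T : Module.End ℂ V)
    (N : Submodule ℂ V) (hN : ∀ x ∈ N, T x ∈ N) (μ : ι → ℂ) (s : Finset ι)
    (hμ : Set.InjOn μ s) (v : ι → V) (hv : ∀ i ∈ s, T (v i) = μ i • v i)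
    (h : ∑ i ∈ s, v i ∈ N) : ∀ i ∈ s, v i ∈ N := by
  classical
  induction s using Finset.induction_on generalizing v with
  | empty => simp
  | insert a s ha ih =>
    -- Applying `T - μ a` kills `v a` and rescales every other term by the nonzero factor `μ i - μ
    -- a`.
    have h1 : ∑ i ∈ s, (μ i - μ a) • v i ∈ N := by
      have h2 := N.sub_mem (hN _ h) (N.smul_mem (μ a) h)
      rw [map_sum, Finset.smul_sum, ← Finset.sum_sub_distrib, Finset.sum_insert ha,
        hv a (by simp), sub_self, zero_add] at h2
      convert h2 using 2 with i hi
      rw [hv i (Finset.mem_insert_of_mem hi), sub_smul]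
    have h3 : ∀ i ∈ s, v i ∈ N := by
      intro i hi
      have h4 := ih (hμ.mono (by simp)) (fun i => (μ i - μ a) • v i) (fun i hi => by
        rw [map_smul, hv i (Finset.mem_insert_of_mem hi), smul_comm]) h1 i hi
      have h5 : μ i - μ a ≠ 0 := by
        intro h0
        have := hμ (Finset.mem_insert_of_mem hi) (Finset.mem_insert_self a s) (sub_eq_zero.1 h0)
        exact ha (this ▸ hi)
      simpa [smul_smul, inv_mul_cancel₀ h5] using N.smul_mem (μ i - μ a)⁻¹ h4
    intro i hi
    rcases Finset.mem_insert.1 hi with rfl | hi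
    · rw [Finset.sum_insert ha] at h
      exact (N.add_mem_iff_left (N.sum_mem h3)).1 h
    · exact h3 i hi

/-! ### The principal grading of the orthogonal Lie algebra -/

/-- The integral weights of the coordinates `U_i` which define a principal grading of `so n`. -/
def idxWt (n : ℕ) : AIdx n → ℤ
  | .inl a => (n / 2 + 1 : ℕ) - (a : ℕ)
  | .inr (.inl a) => (a : ℕ) - (n / 2 + 1 : ℕ)
  | .inr (.inr _) => 0

lemma idxWt_neg {n : ℕ} (i : AIdx n) : idxWt n i.neg = - idxWt n i := by
  rcases i with a | a | z <;> simp [Idx.neg, idxWt]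

lemma idxWt_injective (n : ℕ) : Function.Injective (idxWt n) := by
  rintro (⟨a, ha⟩ | ⟨a, ha⟩ | ⟨a, ha⟩) (⟨b, hb⟩ | ⟨b, hb⟩ | ⟨b, hb⟩) h <;>
  simp [idxWt] at h ⊢ <;> omega

/-- The element of the Cartan subalgebra which defines a principal grading of `so n`. -/
def gradElt (n : ℕ) : so n :=
  ∑ a : Fin (n / 2 + 1), ((idxWt n (.inl a) : ℤ) : ℂ) • cartan a

lemma E_val {n : ℕ} (i j : AIdx n) :
    (E i j : so n).1 = Matrix.single i j 1 - Matrix.single j.neg i.neg 1 := rfl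

lemma E_neg {n : ℕ} (i j : AIdx n) : (E j.neg i.neg : so n) = - E i j := by
  apply Subtype.ext
  change (E j.neg i.neg : so n).1 = - (E i j : so n).1
  rw [E_val, E_val, Idx.neg_neg, Idx.neg_neg, neg_sub]

lemma E_self_neg {n : ℕ} (i : AIdx n) : (E i i.neg : so n) = 0 := by
  apply Subtype.ext
  change (E i i.neg : so n).1 = 0
  rw [E_val, Idx.neg_neg, sub_self]

section
attribute [local instance] LieRing.ofAssociativeRing

lemma so_coe_sum {n : ℕ} {ι : Type*} (s : Finset ι) (f : ι → so n) :
    (∑ i ∈ s, f i : so n).1 = ∑ i ∈ s, (f i).1 :=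
  map_sum (so n).toSubmodule.subtype f s

end

lemma so_coe_smul {n : ℕ} (c : ℂ) (x : so n) : (c • x : so n).1 = c • x.1 := rfl

lemma gradElt_val (n : ℕ) : (gradElt n).1 = Matrix.diagonal fun i => ((idxWt n i : ℤ) : ℂ) := by
  rw [gradElt, so_coe_sum]
  ext i j
  rw [Matrix.sum_apply]
  simp only [so_coe_smul, cartan, E_val, Matrix.smul_apply, Matrix.sub_apply, Matrix.single_apply,
    Matrix.diagonal_apply, Idx.neg]
  rcases i with a | a | z <;> rcases j with b | b | y <;>
    simp [idxWt, ite_and]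
  split_ifs <;> simp

lemma gradElt_lie_E {n : ℕ} (i j : AIdx n) :
    ⁅gradElt n, (E i j : so n)⁆ = ((idxWt n i - idxWt n j : ℤ) : ℂ) • E i j := by
  apply Subtype.ext
  rw [so_lie_val, so_coe_smul, gradElt_val, E_val]
  ext a b
  simp only [Matrix.sub_apply, Matrix.diagonal_mul, Matrix.mul_diagonal, Matrix.smul_apply,
    Matrix.single_apply, smul_eq_mul]
  by_cases h : i = a ∧ j = b
  · obtain ⟨rfl, rfl⟩ := h
    by_cases h : j.neg = i ∧ i.neg = j
    · simp [h]
    · simp only [h]; simp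
  · by_cases h' : j.neg = a ∧ i.neg = b
    · obtain ⟨rfl, rfl⟩ := h'
      simp only [h, idxWt_neg]; simp
    · simp only [h, h']; simp

/-- The factor `1 / 2` compensates for each root vector occurring twice, as `E i j` and as `-E j.neg
i.neg`. -/
lemma so_eq_sum {n : ℕ} (x : so n) :
    x = ∑ i : AIdx n, ∑ j : AIdx n, (1 / 2 * x.1 i j : ℂ) • (E i j : so n) := by
  apply Subtype.ext
  rw [so_coe_sum]
  simp only [so_coe_sum, so_coe_smul, E_val]
  ext a b
  simp only [Matrix.sum_apply, Matrix.smul_apply, Matrix.sub_apply, Matrix.single_apply,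
    smul_eq_mul, mul_sub, Finset.sum_sub_distrib]
  have h1 : ∑ i : AIdx n, ∑ j : AIdx n, 1 / 2 * x.1 i j * (if i = a ∧ j = b then 1 else 0) =
      1 / 2 * x.1 a b := by
    simp [ite_and]
  have h2 : ∑ i : AIdx n, ∑ j : AIdx n, 1 / 2 * x.1 i j * (if j.neg = a ∧ i.neg = b then 1 else 0) =
      1 / 2 * x.1 b.neg a.neg := by
    rw [Finset.sum_comm, ← Idx.sum_neg]
    simp_rw [← Idx.sum_neg (fun i => 1 / 2 * x.1 i _ * _)]
    simp [ite_and]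
  rw [h1, h2, so_apply]
  ring

/-- The weights decrease along `1, …, ℓ, 0, -ℓ, …, -1`. Pairs that are not of the listed form are
reduced to it by `E j.neg i.neg = -E i j`, and `E i i.neg = 0`. -/
lemma E_mem_nPos {n : ℕ} (i j : AIdx n) (h : idxWt n j < idxWt n i) : (E i j : so n) ∈ nPos n := by
  have hs : ∀ a b : Fin (n / 2 + 1), a < b →
      (E (.inl a) (.inl b) : so n) ∈ nPos n ∧ (E (.inl a) (.inr (.inl b)) : so n) ∈ nPos n :=
    fun a b hab => ⟨Submodule.subset_span (.inl ⟨a, b, hab, .inl rfl⟩),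
      Submodule.subset_span (.inl ⟨a, b, hab, .inr rfl⟩)⟩
  have h0 : ∀ (a : Fin (n / 2 + 1)) (z : Fin (n % 2)),
      (E (.inl a) (.inr (.inr z)) : so n) ∈ nPos n :=
    fun a z => Submodule.subset_span (.inr ⟨a, z, rfl⟩)
  have hneg : (E j.neg i.neg : so n) ∈ nPos n → (E i j : so n) ∈ nPos n := by
    rw [E_neg, Submodule.neg_mem_iff]; exact id
  rcases i with a | a | z <;> rcases j with b | b | y <;> simp only [idxWt] at h
  · exact (hs a b (by omega)).1
  · rcases lt_trichotomy a b with hab | rfl | hab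
    · exact (hs a b hab).2
    · rw [show (Sum.inr (Sum.inl a) : AIdx n) = Idx.neg (.inl a) from rfl, E_self_neg]
      exact Submodule.zero_mem _
    · exact hneg (hs b a hab).2
  · exact h0 a y
  · omega
  · exact hneg (hs b a (by omega)).1
  · omega
  · omega
  · exact hneg (h0 b z)
  · omega

/-! ### Highest weight vectors and the part of a module below the top degree -/

section highestWeight

variable {n : ℕ} {M : Type} [AddCommGroup M] [Module ℂ M] [LieRingModule (so n) M]
  [LieModule ℂ (so n) M]

lemma cartan_or_zero (i : AIdx n) : (∃ a, (E i i : so n) = cartan a) ∨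
    (∃ a, (E i i : so n) = - cartan a) ∨ (E i i : so n) = 0 := by
  rcases i with a | a | z
  · exact .inl ⟨a, rfl⟩
  · exact .inr (.inl ⟨a, E_neg (.inl a) (.inl a)⟩)
  · exact .inr (.inr (E_self_neg (.inr (.inr z))))

/-- The vectors obtained from `v` by applying root vectors of negative degree, with their depth
with respect to the principal grading. -/
inductive IsDescendant (v : M) : ℕ → M → Prop
  | base : IsDescendant v 0 v
  | step {k : ℕ} {u : M} (l : ℕ) (i j : AIdx n) (h : idxWt n i + (l + 1) = idxWt n j)
      (hu : IsDescendant v k u) : IsDescendant v (k + (l + 1)) ⁅(E i j : so n), u⁆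

lemma lie_mem_of_forall_E (P : Submodule ℂ M) (u : M) (h : ∀ i j, ⁅(E i j : so n), u⁆ ∈ P)
    (x : so n) : ⁅x, u⁆ ∈ P := by
  rw [so_eq_sum x, sum_lie]
  refine P.sum_mem fun i _ => ?_
  rw [sum_lie]
  refine P.sum_mem fun j _ => ?_
  rw [smul_lie]
  exact P.smul_mem _ (h i j)

/-- `v` is annihilated by `nPos n` and has weight `lam`. -/
structure IsHighestWeightVector (lam : Weight n) (v : M) : Prop where
  nPos_lie : ∀ x ∈ nPos n, ⁅x, v⁆ = 0
  cartan_lie : ∀ a, ⁅(cartan a : so n), v⁆ = lam a • v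

/-- The eigenvalue of `gradElt n` on vectors of weight `lam`. -/
def gradValue (lam : Weight n) : ℂ := ∑ a, ((idxWt n (.inl a) : ℤ) : ℂ) * lam a

/-- The sum of the eigenspaces of `gradElt n` strictly below `gradValue lam`. -/
def lowerPart (lam : Weight n) (M : Type) [AddCommGroup M] [Module ℂ M] [LieRingModule (so n) M]
    [LieModule ℂ (so n) M] : Submodule ℂ M :=
  ⨆ k : ℕ, (LieModule.toEnd ℂ (so n) M (gradElt n)).eigenspace (gradValue lam - (k + 1))

namespace IsHighestWeightVector

variable {lam : Weight n} {v : M} (hv : IsHighestWeightVector lam v)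
include hv

lemma gradElt_lie : ⁅gradElt n, v⁆ = gradValue lam • v := by
  rw [gradElt, sum_lie, gradValue, Finset.sum_smul]
  exact Finset.sum_congr rfl fun a _ => by rw [smul_lie, hv.cartan_lie, smul_smul]

lemma gradElt_lie_descendant {k : ℕ} {u : M} (hu : IsDescendant (n := n) v k u) :
    ⁅gradElt n, u⁆ = (gradValue lam - k) • u := by
  induction hu with
  | base => simpa using hv.gradElt_lie
  | @step k u l i j h hu ih =>
    rw [leibniz_lie, gradElt_lie_E, ih, lie_smul, smul_lie, ← add_smul]
    congr 1
    have : idxWt n i - idxWt n j = -((l : ℤ) + 1) := by omega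
    rw [this]; push_cast; ring

/-- Quantifying over all `x` in the induction replaces the Poincaré–Birkhoff–Witt theorem: moving
`x` past a lowering operator leaves a commutator acting on a shorter word, which the induction
hypothesis covers. -/
lemma lie_descendant_mem {k : ℕ} {u : M} (hu : IsDescendant (n := n) v k u) (x : so n) :
    ⁅x, u⁆ ∈ Submodule.span ℂ {u | ∃ k, IsDescendant (n := n) v k u} := by
  have hlow : ∀ (i j : AIdx n), idxWt n i < idxWt n j →
      ∀ p ∈ Submodule.span ℂ {u | ∃ k, IsDescendant (n := n) v k u},
        ⁅(E i j : so n), p⁆ ∈ Submodule.span ℂ {u | ∃ k, IsDescendant (n := n) v k u} := by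
    intro i j hij p hp
    induction hp using Submodule.span_induction with
    | mem u hu =>
      obtain ⟨k, hk⟩ := hu
      refine Submodule.subset_span ⟨_, hk.step (idxWt n j - idxWt n i - 1).toNat i j ?_⟩
      omega
    | zero => rw [lie_zero]; exact Submodule.zero_mem _
    | add _ _ _ _ h1 h2 => rw [lie_add]; exact Submodule.add_mem _ h1 h2
    | smul _ _ _ h => rw [lie_smul]; exact Submodule.smul_mem _ _ h
  induction hu generalizing x with
  | base =>
    have hvm : v ∈ Submodule.span ℂ {u | ∃ k, IsDescendant (n := n) v k u} :=
      Submodule.subset_span ⟨0, .base⟩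
    refine lie_mem_of_forall_E _ _ (fun i j => ?_) x
    rcases lt_trichotomy (idxWt n i) (idxWt n j) with h | h | h
    · exact hlow i j h v hvm
    · obtain rfl := idxWt_injective n h
      rcases cartan_or_zero i with ⟨a, h⟩ | ⟨a, h⟩ | h <;> rw [h]
      · rw [hv.cartan_lie]; exact Submodule.smul_mem _ _ hvm
      · rw [neg_lie, hv.cartan_lie]; exact Submodule.neg_mem _ (Submodule.smul_mem _ _ hvm)
      · rw [zero_lie]; exact Submodule.zero_mem _
    · rw [hv.nPos_lie _ (E_mem_nPos i j h)]; exact Submodule.zero_mem _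
  | step l i j h hu ih =>
    rw [leibniz_lie]
    exact Submodule.add_mem _ (ih _) (hlow i j (by omega) _ (ih x))

/-- The span of the descendants is a submodule containing `v`, hence everything; all descendants
other than `v` itself have positive depth. -/
lemma exists_smul_add (hgen : LieSubmodule.lieSpan ℂ (so n) {v} = ⊤) (m : M) :
    ∃ (a : ℂ), ∃ w ∈ lowerPart lam M, m = a • v + w := by
  let P : LieSubmodule ℂ (so n) M :=
    { Submodule.span ℂ {u | ∃ k, IsDescendant (n := n) v k u} with
      lie_mem := by
        intro x p hp
        change p ∈ Submodule.span ℂ {u | ∃ k, IsDescendant (n := n) v k u} at hp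
        change ⁅x, p⁆ ∈ Submodule.span ℂ {u | ∃ k, IsDescendant (n := n) v k u}
        induction hp using Submodule.span_induction with
        | mem u hu => exact hv.lie_descendant_mem hu.choose_spec x
        | zero => rw [lie_zero]; exact Submodule.zero_mem _
        | add _ _ _ _ h1 h2 => rw [lie_add]; exact Submodule.add_mem _ h1 h2
        | smul _ _ _ h => rw [lie_smul]; exact Submodule.smul_mem _ _ h }
  have hP : m ∈ P := by
    have h1 : LieSubmodule.lieSpan ℂ (so n) {v} ≤ P :=
      LieSubmodule.lieSpan_le.2 (Set.singleton_subset_iff.2 (Submodule.subset_span ⟨0, .base⟩))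
    rw [hgen] at h1
    exact h1 trivial
  change m ∈ Submodule.span ℂ {u | ∃ k, IsDescendant (n := n) v k u} at hP
  induction hP using Submodule.span_induction with
  | mem u hu =>
    obtain ⟨k, hk⟩ := hu
    cases hk with
    | base => exact ⟨1, 0, Submodule.zero_mem _, by simp⟩
    | @step k u l i j h hu =>
      refine ⟨0, _, ?_, (by rw [zero_smul, zero_add])⟩
      refine Submodule.mem_iSup_of_mem (k + l) ?_
      rw [Module.End.mem_eigenspace_iff]
      have := hv.gradElt_lie_descendant (hu.step l i j h)
      rw [LieModule.toEnd_apply_apply, this]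
      congr 1; push_cast; ring
  | zero => exact ⟨0, 0, Submodule.zero_mem _, by simp⟩
  | add _ _ _ _ h1 h2 =>
    obtain ⟨a, w, hw, rfl⟩ := h1
    obtain ⟨b, u, hu, rfl⟩ := h2
    exact ⟨a + b, w + u, Submodule.add_mem _ hw hu, by rw [add_smul]; abel⟩
  | smul c _ _ h =>
    obtain ⟨a, w, hw, rfl⟩ := h
    exact ⟨c * a, c • w, Submodule.smul_mem _ _ hw, by rw [smul_add, smul_smul]⟩

/-- `a • v` is the component of `a • v + w` for the top eigenvalue of `gradElt n`, and a subspace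
stable under `gradElt n` contains the eigencomponents of its elements. -/
lemma smul_mem_of_add_mem (N : Submodule ℂ M) (hN : ∀ x ∈ N, ⁅gradElt n, x⁆ ∈ N) (a : ℂ) (w : M)
    (hw : w ∈ lowerPart lam M) (h : a • v + w ∈ N) : a • v ∈ N := by
  classical
  obtain ⟨f, hf, rfl⟩ := (Submodule.mem_iSup_iff_exists_finsupp _ _).1 hw
  have := mem_of_sum_eigenvectors_mem (LieModule.toEnd ℂ (so n) M (gradElt n)) N hN
    -- The index `none` carries the top eigenvalue and `some k` the eigenvalue lower by `k + 1`.
    (fun o : Option ℕ => o.elim (gradValue lam) fun k => gradValue lam - (k + 1))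
    (Finset.insertNone f.support) (by
      rintro (_ | k) _ (_ | l) _ h
      · rfl
      · have h' : gradValue lam = gradValue lam - ((l : ℂ) + 1) := h
        exact absurd (show ((l : ℂ) + 1) = 0 by linear_combination h') (Nat.cast_add_one_ne_zero l)
      · have h' : gradValue lam - ((k : ℂ) + 1) = gradValue lam := h
        exact absurd (show ((k : ℂ) + 1) = 0 by linear_combination -h') (Nat.cast_add_one_ne_zero k)
      · have h' : gradValue lam - ((k : ℂ) + 1) = gradValue lam - ((l : ℂ) + 1) := h
        have : (k : ℂ) = l := by linear_combination -h'
        rw [Nat.cast_injective this])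
    (fun o => o.elim (a • v) f)
    (by
      rintro (_ | k) _
      · change ⁅gradElt n, a • v⁆ = gradValue lam • a • v
        rw [lie_smul, hv.gradElt_lie, smul_comm]
      · exact Module.End.mem_eigenspace_iff.1 (hf k))
    (by rw [Finset.sum_insertNone]; exact h)
  exact this none (by simp)

lemma notMem_lowerPart (hv0 : v ≠ 0) : v ∉ lowerPart lam M := by
  intro h
  have := hv.smul_mem_of_add_mem ⊥ (by rintro x rfl; simp) 1 (-v) (Submodule.neg_mem _ h) (by simp)
  exact hv0 (by simpa using this)

/-- An element with a nonzero top component would put the generator `v` into `N`. Consequently sums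
of proper submodules stay proper. -/
lemma le_lowerPart (hgen : LieSubmodule.lieSpan ℂ (so n) {v} = ⊤) (N : LieSubmodule ℂ (so n) M)
    (hN : N ≠ ⊤) : N.toSubmodule ≤ lowerPart lam M := by
  intro m hm
  obtain ⟨a, w, hw, rfl⟩ := hv.exists_smul_add hgen m
  have h1 := hv.smul_mem_of_add_mem N.toSubmodule (fun x hx => N.lie_mem hx) a w hw hm
  by_cases ha : a = 0
  · simpa [ha] using hw
  · exfalso
    apply hN
    have h2 : v ∈ N := by
      simpa [smul_smul, inv_mul_cancel₀ ha] using N.smul_mem a⁻¹ h1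
    rw [eq_top_iff, ← hgen]
    exact LieSubmodule.lieSpan_le.2 (Set.singleton_subset_iff.2 h2)

end IsHighestWeightVector

end highestWeight


/-! ### Verma modules: universal property and simple quotient -/

section verma

variable {n : ℕ} {M : Type} [AddCommGroup M] [Module ℂ M] [LieRingModule (so n) M]
  [LieModule ℂ (so n) M]

/-- The action of the enveloping algebra on a `so n`-module. -/
def envelopingAction (n : ℕ) (M : Type) [AddCommGroup M] [Module ℂ M] [LieRingModule (so n) M]
    [LieModule ℂ (so n) M] : UniversalEnvelopingAlgebra ℂ (so n) →ₐ[ℂ] Module.End ℂ M :=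
  UniversalEnvelopingAlgebra.lift ℂ (LieModule.toEnd ℂ (so n) M)

lemma envelopingAction_ι (x : so n) (m : M) :
    envelopingAction n M (UniversalEnvelopingAlgebra.ι ℂ x) m = ⁅x, m⁆ := by
  rw [envelopingAction, UniversalEnvelopingAlgebra.lift_ι_apply, LieModule.toEnd_apply_apply]

/-- The canonical generator of the Verma module. -/
def vermaGen (n : ℕ) (lam : Weight n) : Verma n lam :=
  (vermaIdeal n lam).mkQ 1

lemma mkQ_eq_smul_vermaGen {lam : Weight n} (u : UniversalEnvelopingAlgebra ℂ (so n)) :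
    ((vermaIdeal n lam).mkQ u : Verma n lam) = u • vermaGen n lam := by
  have : u = u • 1 := by simp
  conv_lhs => rw [this, map_smul]
  rfl

lemma ι_smul_verma {lam : Weight n} (x : so n) (m : Verma n lam) :
    UniversalEnvelopingAlgebra.ι ℂ x • m = ⁅x, m⁆ := rfl

lemma algebraMap_smul_verma {lam : Weight n} (c : ℂ) (m : Verma n lam) :
    algebraMap ℂ (UniversalEnvelopingAlgebra ℂ (so n)) c • m = c • m :=
  algebraMap_smul _ c m

lemma isHighestWeightVector_vermaGen (lam : Weight n) :
    IsHighestWeightVector lam (vermaGen n lam) where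
  nPos_lie x hx := by
    rw [← ι_smul_verma, ← mkQ_eq_smul_vermaGen]
    exact (Submodule.Quotient.mk_eq_zero _).2 (Submodule.subset_span (.inl ⟨x, hx, rfl⟩))
  cartan_lie a := by
    rw [← ι_smul_verma, ← algebraMap_smul_verma, ← sub_eq_zero, ← sub_smul,
      ← mkQ_eq_smul_vermaGen]
    exact (Submodule.Quotient.mk_eq_zero _).2 (Submodule.subset_span (.inr ⟨a, rfl⟩))

section
attribute [local instance] LieRing.ofAssociativeRing

/-- The inclusion of `so n` into `S` lifts to the enveloping algebra, and by uniqueness of lifts its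
composite with the embedding of `S` is the identity. -/
lemma enveloping_mem_subalgebra (S : Subalgebra ℂ (UniversalEnvelopingAlgebra ℂ (so n)))
    (hS : ∀ x : so n, UniversalEnvelopingAlgebra.ι ℂ x ∈ S)
    (u : UniversalEnvelopingAlgebra ℂ (so n)) : u ∈ S := by
  let f : so n →ₗ⁅ℂ⁆ S :=
    { toFun := fun x => ⟨UniversalEnvelopingAlgebra.ι ℂ x, hS x⟩
      map_add' := fun x y => Subtype.ext (map_add _ x y)
      map_smul' := fun c x => Subtype.ext (map_smul (UniversalEnvelopingAlgebra.ι ℂ) c x)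
      map_lie' := fun {x y} => Subtype.ext (LieHom.map_lie _ x y) }
  have h : S.val.comp (UniversalEnvelopingAlgebra.lift ℂ f) = AlgHom.id ℂ _ := by
    apply UniversalEnvelopingAlgebra.hom_ext
    ext x
    change S.val (UniversalEnvelopingAlgebra.lift ℂ f (UniversalEnvelopingAlgebra.ι ℂ x)) = _
    rw [UniversalEnvelopingAlgebra.lift_ι_apply]
    rfl
  rw [← AlgHom.id_apply (R := ℂ) u, ← h]
  exact (UniversalEnvelopingAlgebra.lift ℂ f u).2

end

lemma enveloping_smul_mem {lam : Weight n} (N : LieSubmodule ℂ (so n) (Verma n lam))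
    (u : UniversalEnvelopingAlgebra ℂ (so n)) (m : Verma n lam) (hm : m ∈ N) : u • m ∈ N := by
  let S : Subalgebra ℂ (UniversalEnvelopingAlgebra ℂ (so n)) :=
    { carrier := {u | ∀ m ∈ N, u • m ∈ N}
      mul_mem' := fun ha hb m hm => by rw [mul_smul]; exact ha _ (hb _ hm)
      add_mem' := fun ha hb m hm => by rw [add_smul]; exact N.add_mem (ha _ hm) (hb _ hm)
      algebraMap_mem' := fun c m hm => by rw [algebraMap_smul_verma]; exact N.smul_mem c hm }
  exact enveloping_mem_subalgebra S (fun x m hm => N.lie_mem hm) u m hm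

lemma lieSpan_vermaGen (lam : Weight n) :
    LieSubmodule.lieSpan ℂ (so n) {vermaGen n lam} = ⊤ := by
  rw [eq_top_iff]
  intro m _
  obtain ⟨u, rfl⟩ := (vermaIdeal n lam).mkQ_surjective m
  rw [mkQ_eq_smul_vermaGen]
  exact enveloping_smul_mem _ _ _ (LieSubmodule.subset_lieSpan (Set.mem_singleton _))

/-- The annihilator of `v` is a left ideal and contains the generators of `vermaIdeal n lam`. -/
lemma envelopingAction_eq_zero_of_mem {lam : Weight n} {v : M} (hv : IsHighestWeightVector lam v)
    (u : UniversalEnvelopingAlgebra ℂ (so n)) (hu : u ∈ vermaIdeal n lam) :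
    envelopingAction n M u v = 0 := by
  induction hu using Submodule.span_induction with
  | mem u hu =>
    rcases hu with ⟨x, hx, rfl⟩ | ⟨a, rfl⟩
    · rw [envelopingAction_ι, hv.nPos_lie x hx]
    · simp only [map_sub, LinearMap.sub_apply, envelopingAction_ι, hv.cartan_lie,
        AlgHom.commutes, Module.algebraMap_end_apply, sub_self]
  | zero => simp
  | add a b _ _ ha hb => rw [map_add, LinearMap.add_apply, ha, hb, add_zero]
  | smul a b _ hb => rw [smul_eq_mul, map_mul, Module.End.mul_apply, hb, map_zero]

/-- The universal property of the Verma module. -/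
lemma exists_hom_verma {lam : Weight n} {v : M} (hv : IsHighestWeightVector lam v) :
    ∃ φ : Verma n lam →ₗ⁅ℂ, so n⁆ M, φ (vermaGen n lam) = v := by
  let _ : Module (UniversalEnvelopingAlgebra ℂ (so n)) M :=
    Module.compHom M (envelopingAction n M).toRingHom
  have hs : ∀ (u : UniversalEnvelopingAlgebra ℂ (so n)) (m : M),
      u • m = envelopingAction n M u m := fun _ _ => rfl
  let φ : Verma n lam →ₗ[UniversalEnvelopingAlgebra ℂ (so n)] M :=
    (vermaIdeal n lam).liftQ (LinearMap.toSpanSingleton _ M v) (by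
      intro u hu
      rw [LinearMap.mem_ker, LinearMap.toSpanSingleton_apply, hs]
      exact envelopingAction_eq_zero_of_mem hv u hu)
  refine ⟨{ toFun := φ, map_add' := map_add φ, map_smul' := ?_, map_lie' := ?_ }, ?_⟩
  · intro c m
    rw [← algebraMap_smul_verma, map_smul, hs, AlgHom.commutes, Module.algebraMap_end_apply,
      RingHom.id_apply]
  · intro x m
    change φ (UniversalEnvelopingAlgebra.ι ℂ x • m) = _
    rw [map_smul, hs, envelopingAction_ι]
  · have h : φ (vermaGen n lam) =
        LinearMap.toSpanSingleton (UniversalEnvelopingAlgebra ℂ (so n)) M v 1 := rfl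
    rw [LinearMap.toSpanSingleton_apply, one_smul] at h
    exact h

/-- An irreducible module with a highest weight vector of weight `lam` is isomorphic to
`SimpleHW n lam`. -/
lemma IsHighestWeightVector.nonempty_equiv {lam : Weight n} {v : M}
    (hv : IsHighestWeightVector lam v) (hv0 : v ≠ 0) (hM : LieModule.IsIrreducible ℂ (so n) M) :
    Nonempty (M ≃ₗ⁅ℂ, so n⁆ SimpleHW n lam) := by
  obtain ⟨φ, hφ⟩ := exists_hom_verma hv
  have hw := isHighestWeightVector_vermaGen lam
  have hgen := lieSpan_vermaGen lam
  have hrange : φ.range = ⊤ := by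
    rcases eq_bot_or_eq_top φ.range with h | h
    · exfalso
      apply hv0
      have : v ∈ φ.range := ⟨_, hφ⟩
      rwa [h, LieSubmodule.mem_bot] at this
    · exact h
  have hsurj : Function.Surjective φ := fun m => by
    have : m ∈ φ.range := hrange ▸ LieSubmodule.mem_top m
    exact this
  have hmap : ∀ m ∈ lowerPart lam (Verma n lam), φ m ∈ lowerPart lam M := by
    intro m hm
    rw [lowerPart] at hm
    induction hm using Submodule.iSup_induction' with
    | mem k x hx =>
      refine Submodule.mem_iSup_of_mem k ?_
      rw [Module.End.mem_eigenspace_iff, LieModule.toEnd_apply_apply] at hx ⊢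
      rw [← LieModuleHom.map_lie, hx, map_smul]
    | zero => rw [map_zero]; exact Submodule.zero_mem _
    | add _ _ _ _ h1 h2 => rw [map_add]; exact Submodule.add_mem _ h1 h2
  -- The image of a proper `N` is `⊥` or `⊤`. If it were `⊤`, then `v` would be the image of an
  -- element of the lower part, although `v` is not in the lower part of `M`. Conversely the kernel
  -- is itself proper, because `v ≠ 0`.
  have hker : sSup {N : LieSubmodule ℂ (so n) (Verma n lam) | N ≠ ⊤} = φ.ker := by
    apply le_antisymm
    · refine sSup_le fun N hN => ?_
      rcases eq_bot_or_eq_top (N.map φ) with h | h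
      · intro m hm
        have : φ m ∈ N.map φ := LieSubmodule.mem_map_of_mem hm
        rw [h, LieSubmodule.mem_bot] at this
        exact this
      · exfalso
        have : v ∈ N.map φ := h ▸ LieSubmodule.mem_top v
        obtain ⟨m, hm, hmv⟩ := (LieSubmodule.mem_map _).1 this
        exact hv.notMem_lowerPart hv0 (hmv ▸ hmap m (hw.le_lowerPart hgen N hN hm))
    · refine le_sSup ?_
      intro h
      apply hv0
      have : vermaGen n lam ∈ φ.ker := h ▸ LieSubmodule.mem_top _
      rw [← hφ]
      exact this
  let e : SimpleHW n lam ≃ₗ[ℂ] M :=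
    (Submodule.quotEquivOfEq _ _ (by rw [hker]; rfl)).trans
      (LinearMap.quotKerEquivOfSurjective (φ : Verma n lam →ₗ[ℂ] M) hsurj)
  let e' : SimpleHW n lam ≃ₗ⁅ℂ, so n⁆ M :=
    { e with
      map_lie' := by
        intro x m
        obtain ⟨m, rfl⟩ := Submodule.Quotient.mk_surjective _ m
        exact LieModuleHom.map_lie φ x m }
  exact ⟨e'.symm⟩

end verma


/-! ## Irreducibility of spaces of harmonic polynomials -/

section harmonic

variable {σ : Type} [Fintype σ] [DecidableEq σ]

/-- The vector field `X_p ∂_q - X_{τ q} ∂_{τ p}`. -/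
def rot (τ : σ → σ) (p q : σ) : Module.End ℂ (MvPolynomial σ ℂ) :=
  LinearMap.mulLeft ℂ (X p) ∘ₗ (pderiv q).toLinearMap -
    LinearMap.mulLeft ℂ (X (τ q)) ∘ₗ (pderiv (τ p)).toLinearMap

/-- The Laplacian `∑ i, ∂_i ∂_{τ i}`. -/
def splitLap (τ : σ → σ) : Module.End ℂ (MvPolynomial σ ℂ) :=
  ∑ i, (pderiv i).toLinearMap ∘ₗ (pderiv (τ i)).toLinearMap

/-- Homogeneous polynomials of degree `m` in the kernel of `splitLap τ`. -/
def splitHarm (τ : σ → σ) (m : ℕ) : Submodule ℂ (MvPolynomial σ ℂ) :=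
  homogeneousSubmodule σ ℂ m ⊓ LinearMap.ker (splitLap τ)

instance finite_homogeneousSubmodule (m : ℕ) :
    FiniteDimensional ℂ (homogeneousSubmodule σ ℂ m) :=
  Module.Finite.iff_fg.2 (homogeneousSubmodule_fg σ ℂ m)

instance finite_splitHarm (τ : σ → σ) (m : ℕ) : FiniteDimensional ℂ (splitHarm τ m) :=
  Submodule.finiteDimensional_of_le (inf_le_left : _ ≤ homogeneousSubmodule σ ℂ m)

lemma rot_apply (τ : σ → σ) (p q : σ) (f : MvPolynomial σ ℂ) :
    rot τ p q f = X p * pderiv q f - X (τ q) * pderiv (τ p) f := rfl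

lemma splitLap_apply (τ : σ → σ) (f : MvPolynomial σ ℂ) :
    splitLap τ f = ∑ i, pderiv i (pderiv (τ i) f) := by
  simp [splitLap]

lemma isHomogeneous_X_mul_pderiv {m : ℕ} (p q : σ) {f : MvPolynomial σ ℂ} (hf : f.IsHomogeneous m) :
    (X p * pderiv q f).IsHomogeneous m := by
  rcases m with _ | m
  · have h : pderiv q f = 0 := by
      rw [totalDegree_eq_zero_iff_eq_C.1 (Nat.le_zero.1 hf.totalDegree_le), pderiv_C]
    rw [h, mul_zero]
    exact isHomogeneous_zero _ _ _
  · simpa [add_comm] using (isHomogeneous_X ℂ p).mul (hf.pderiv (i := q))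

/-- The two cross terms come from `i = p` and `i = τ p`, and both equal `pderiv (τ p) g`. -/
lemma splitLap_X_mul {τ : σ → σ} (hτ : ∀ i, τ (τ i) = i) (p : σ) (g : MvPolynomial σ ℂ) :
    splitLap τ (X p * g) = X p * splitLap τ g + 2 * pderiv (τ p) g := by
  have h : ∀ i, pderiv i (pderiv (τ i) (X p * g)) = X p * pderiv i (pderiv (τ i) g) +
      ((if i = τ p then pderiv i g else 0) + (if i = p then pderiv (τ i) g else 0)) := by
    intro i
    have h1 : τ i = p ↔ i = τ p := ⟨fun h => by rw [← h, hτ], fun h => by rw [h, hτ]⟩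
    have hX : ∀ j, pderiv j (X p : MvPolynomial σ ℂ) = C (if j = p then 1 else 0) := by
      intro j
      rw [pderiv_X, Pi.single_apply]
      by_cases hj : j = p
      · simp [hj]
      · simp [hj, Ne.symm hj]
    rw [pderiv_mul, map_add, pderiv_mul, pderiv_mul, hX, hX, pderiv_C]
    simp only [h1]
    split_ifs <;> simp <;> ring
  simp only [splitLap_apply, h, Finset.sum_add_distrib, ← Finset.mul_sum]
  simp
  ring

lemma splitLap_pderiv (τ : σ → σ) (q : σ) (g : MvPolynomial σ ℂ) :
    splitLap τ (pderiv q g) = pderiv q (splitLap τ g) := by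
  simp only [splitLap_apply, map_sum]
  exact Finset.sum_congr rfl fun i _ => by rw [pderiv_comm' (τ i) q, pderiv_comm' i q]

lemma rot_mem_splitHarm {τ : σ → σ} (hτ : ∀ i, τ (τ i) = i) {m : ℕ} (p q : σ)
    {f : MvPolynomial σ ℂ} (hf : f ∈ splitHarm τ m) : rot τ p q f ∈ splitHarm τ m := by
  obtain ⟨h1, h2⟩ := hf
  refine ⟨(isHomogeneous_X_mul_pderiv _ _ h1).sub (isHomogeneous_X_mul_pderiv _ _ h1), ?_⟩
  rw [SetLike.mem_coe, LinearMap.mem_ker] at h2 ⊢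
  rw [rot_apply, map_sub, splitLap_X_mul hτ, splitLap_X_mul hτ, splitLap_pderiv, splitLap_pderiv,
    h2, hτ, pderiv_comm' q]
  simp

lemma coeff_X_mul_pderiv (i : σ) (f : MvPolynomial σ ℂ) (s : σ →₀ ℕ) :
    coeff s (X i * pderiv i f) = s i * coeff s f := by
  rw [coeff_X_mul']
  split_ifs with h
  · have h1 : 1 ≤ s i := Nat.one_le_iff_ne_zero.2 (Finsupp.mem_support_iff.1 h)
    have h2 : s - Finsupp.single i 1 + Finsupp.single i 1 = s :=
      tsub_add_cancel_of_le (Finsupp.single_le_iff.2 h1)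
    rw [coeff_pderiv, h2, Finsupp.tsub_apply, Finsupp.single_eq_same, Nat.cast_sub h1]
    push_cast; ring
  · rw [Finsupp.notMem_support_iff.1 h]; simp

/-- The operator is diagonal on monomials, and on `X^s` its eigenvalue `∑ i, (1 + s (κ i))` is a
positive integer. -/
lemma eq_zero_of_sum_theta {κ : σ → σ} [Nonempty σ] (g : MvPolynomial σ ℂ)
    (h : ∑ i, (g + X (κ i) * pderiv (κ i) g) = 0) : g = 0 := by
  ext s
  have h1 := congrArg (coeff s) h
  simp only [coeff_sum, coeff_add, coeff_X_mul_pderiv, coeff_zero] at h1 ⊢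
  have h2 : ((∑ i, (1 + s (κ i)) : ℕ) : ℂ) * coeff s g = 0 := by
    rw [← h1]; push_cast; rw [Finset.sum_mul]
    exact Finset.sum_congr rfl fun i _ => by ring
  refine (mul_eq_zero.1 h2).resolve_left ?_
  refine Nat.cast_ne_zero.2 ?_
  exact ne_of_gt (Finset.sum_pos (fun i _ => by omega) Finset.univ_nonempty)

/-- Harmonic polynomials annihilated by the nilradical attached to the isotropic coordinate
`X_{i₀}` depend only on `X_{i₀}`. -/
lemma pderiv_eq_zero_of_rot_eq_zero {τ : σ → σ} (hτ : ∀ i, τ (τ i) = i) {i₀ p₀ : σ}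
    (hi₀ : τ i₀ ≠ i₀) (hp₀ : p₀ ≠ i₀) (hp₀' : p₀ ≠ τ i₀) {f : MvPolynomial σ ℂ}
    (hf : splitLap τ f = 0) (h : ∀ p, p ≠ i₀ → p ≠ τ i₀ → rot τ i₀ p f = 0) (p : σ) (hp : p ≠ i₀) :
    pderiv p f = 0 := by
  have h' : ∀ p, p ≠ i₀ → p ≠ τ i₀ → X i₀ * pderiv p f = X (τ p) * pderiv (τ i₀) f :=
    fun p hp hp' => sub_eq_zero.1 (h p hp hp')
  -- `X i₀` is prime and divides `X (τ p₀) * pderiv (τ i₀) f`, while `τ p₀ ≠ i₀`. The quotient `g`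
  -- then controls all derivatives in directions other than `i₀`.
  have hdvd : X i₀ ∣ pderiv (τ i₀) f := by
    refine (X_dvd_mul_iff.1 (Dvd.intro _ (h' p₀ hp₀ hp₀'))).resolve_left ?_
    rw [X_dvd_X]
    rintro h0
    exact hp₀' (by rw [h0, hτ])
  obtain ⟨g, hg⟩ := hdvd
  have h2 : ∀ p, p ≠ i₀ → p ≠ τ i₀ → pderiv p f = X (τ p) * g := fun p hp hp' => by
    apply mul_left_cancel₀ (X_ne_zero (R := ℂ) i₀)
    rw [h' p hp hp', hg]; ring
  have hg0 : g = 0 := by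
    have : Nonempty σ := ⟨i₀⟩
    -- After substituting the formulas for the derivatives, each term `∂_i ∂_{τ i} f` of the
    -- Laplacian is `∂_j (X_j g)` with `j = i`, except that `i = τ i₀` contributes `j = i₀`.
    refine eq_zero_of_sum_theta (κ := fun i => if i = τ i₀ then i₀ else i) g ?_
    rw [← hf, splitLap_apply]
    refine Finset.sum_congr rfl fun i _ => ?_
    have hX : ∀ j : σ, pderiv j (X j * g) = g + X j * pderiv j g := fun j => by
      rw [pderiv_mul, pderiv_X_self, one_mul]
    by_cases h3 : i = τ i₀
    · subst h3
      rw [if_pos rfl, hτ, pderiv_comm', hg, hX]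
    · rw [if_neg h3]
      by_cases h4 : i = i₀
      · subst h4; rw [hg, hX]
      · rw [h2 (τ i) (fun h => h3 (by rw [← h, hτ])) (fun h => h4 (by rw [← hτ i, h, hτ])), hτ, hX]
  by_cases hp' : p = τ i₀
  · rw [hp', hg, hg0, mul_zero]
  · rw [h2 p hp hp', hg0, mul_zero]

lemma eq_C_mul_X_pow_of_pderiv_eq_zero {i₀ : σ} {m : ℕ} {f : MvPolynomial σ ℂ}
    (hf : f.IsHomogeneous m) (h : ∀ p, p ≠ i₀ → pderiv p f = 0) :
    ∃ a : ℂ, f = C a * X i₀ ^ m := by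
  refine ⟨coeff (Finsupp.single i₀ m) f, ?_⟩
  rw [C_mul_X_pow_eq_monomial]
  ext s
  rw [coeff_monomial]
  split_ifs with hs
  · rw [hs]
  · by_contra h0
    apply hs
    have h1 : ∀ p, p ≠ i₀ → s p = 0 := by
      intro p hp
      have := coeff_X_mul_pderiv p f s
      rw [h p hp, mul_zero, coeff_zero] at this
      simpa using (mul_eq_zero.1 this.symm).resolve_right h0
    have h2 : s = Finsupp.single i₀ (s i₀) := by
      ext p
      by_cases hp : p = i₀
      · subst hp; simp
      · rw [h1 p hp, Finsupp.single_eq_of_ne hp]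
    have h3 : s.degree = m := by
      by_contra h3
      exact h0 (hf.coeff_eq_zero h3)
    rw [h2, Finsupp.degree_single] at h3
    rw [h2, h3]

/-- This is the commutator relation `[E_{i₀i₀}, E_{i₀p}] = E_{i₀p}`: the operators `rot τ i₀ p`
raise eigenvalues of `rot τ i₀ i₀` by one. -/
lemma rot_self_rot {τ : σ → σ} (hτ : ∀ i, τ (τ i) = i) {i₀ p : σ} (hi₀ : τ i₀ ≠ i₀)
    (hp : p ≠ i₀) (hp' : p ≠ τ i₀) (f : MvPolynomial σ ℂ) :
    rot τ i₀ i₀ (rot τ i₀ p f) = rot τ i₀ p (rot τ i₀ i₀ f) + rot τ i₀ p f := by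
  have h1 : τ p ≠ i₀ := fun h => hp' (by rw [← h, hτ])
  have h2 : τ p ≠ τ i₀ := fun h => hp (by rw [← hτ p, h, hτ])
  simp only [rot_apply, map_sub, pderiv_mul, pderiv_X, Pi.single_apply, hi₀.symm, h1,
    h2, hp.symm, hp'.symm, if_true, if_false, pderiv_comm' p,
    pderiv_comm' (τ i₀) i₀]
  ring

/-- A nonzero invariant space of harmonic polynomials contains `X_{i₀} ^ m`. -/
lemma X_pow_mem_of_stable {τ : σ → σ} (hτ : ∀ i, τ (τ i) = i) {i₀ p₀ : σ}
    (hi₀ : τ i₀ ≠ i₀) (hp₀ : p₀ ≠ i₀) (hp₀' : p₀ ≠ τ i₀) {m : ℕ}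
    (W : Submodule ℂ (MvPolynomial σ ℂ)) (hW : W ≤ splitHarm τ m) (hW0 : W ≠ ⊥)
    (hs : ∀ p q, ∀ f ∈ W, rot τ p q f ∈ W) : X i₀ ^ m ∈ W := by
  have : FiniteDimensional ℂ W := Submodule.finiteDimensional_of_le hW
  have : Nontrivial W := Submodule.nontrivial_iff_ne_bot.2 hW0
  let T : Module.End ℂ W := (rot τ i₀ i₀).restrict (hs i₀ i₀)
  -- An eigenvalue of maximal real part is chosen, so that the raising operators must annihilate its
  -- eigenvectors.
  obtain ⟨c, hc, hmax⟩ := Set.exists_max_image {μ : ℂ | T.HasEigenvalue μ} Complex.re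
    T.finite_hasEigenvalue T.exists_eigenvalue
  obtain ⟨⟨f, hfW⟩, hf, hf0⟩ := Module.End.HasEigenvalue.exists_hasEigenvector hc
  rw [Module.End.mem_eigenspace_iff] at hf
  have hf' : rot τ i₀ i₀ f = c • f := congrArg Subtype.val hf
  have hsing : ∀ p, p ≠ i₀ → p ≠ τ i₀ → rot τ i₀ p f = 0 := by
    intro p hp hp'
    by_contra h0
    have h1 : T.HasEigenvalue (c + 1) := by
      refine Module.End.hasEigenvalue_of_hasEigenvector (x := ⟨rot τ i₀ p f, hs _ _ f hfW⟩) ⟨?_, ?_⟩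
      · rw [Module.End.mem_eigenspace_iff]
        apply Subtype.ext
        change rot τ i₀ i₀ (rot τ i₀ p f) = (c + 1) • rot τ i₀ p f
        rw [rot_self_rot hτ hi₀ hp hp', hf', map_smul, add_smul, one_smul]
      · exact fun h => h0 (congrArg Subtype.val h)
    have := hmax _ h1
    simp at this
    linarith
  obtain ⟨a, ha⟩ := eq_C_mul_X_pow_of_pderiv_eq_zero (hW hfW).1
    (pderiv_eq_zero_of_rot_eq_zero hτ hi₀ hp₀ hp₀' (hW hfW).2 hsing)
  have ha0 : a ≠ 0 := by
    rintro rfl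
    exact hf0 (Subtype.ext (ha.trans (by simp)))
  have : X i₀ ^ m = a⁻¹ • f := by
    rw [ha, ← smul_eq_C_mul, smul_smul, inv_mul_cancel₀ ha0, one_smul]
  rw [this]
  exact W.smul_mem _ hfW

/-! ### The Fischer form and irreducibility -/

/-- The bilinear form with `⟨X^s, X^t⟩ = s! δ_{st}`. -/
def fischer : MvPolynomial σ ℂ →ₗ[ℂ] MvPolynomial σ ℂ →ₗ[ℂ] ℂ :=
  (basisMonomials σ ℂ).constr ℂ fun s => (∏ i, (s i).factorial : ℂ) • lcoeff ℂ s

lemma fischer_monomial (s : σ →₀ ℕ) (a : ℂ) (g : MvPolynomial σ ℂ) :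
    fischer (monomial s a) g = a * (∏ i, (s i).factorial : ℂ) * coeff s g := by
  have h : (monomial s a : MvPolynomial σ ℂ) = a • basisMonomials σ ℂ s := by
    rw [coe_basisMonomials, smul_monomial, smul_eq_mul, mul_one]
  rw [h, map_smul, fischer, Module.Basis.constr_basis]
  simp [mul_assoc]

lemma fischer_comm (f g : MvPolynomial σ ℂ) : fischer f g = fischer g f := by
  induction f using MvPolynomial.induction_on' with
  | add f f' h h' => simp [h, h']
  | monomial s a =>
    induction g using MvPolynomial.induction_on' with
    | add f f' h h' => simp [h, h']
    | monomial t b =>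
      simp only [fischer_monomial, coeff_monomial]
      by_cases h : s = t
      · subst h; simp; ring
      · simp [h, Ne.symm h]

/-- Multiplication by `X i` is adjoint to `∂_i`, because `(s_i + 1)! = (s_i + 1) s_i!`. Hence `rot τ
p q` is adjoint to `rot τ q p`, and orthogonal complements of stable subspaces are stable. -/
lemma fischer_X_mul (i : σ) (f g : MvPolynomial σ ℂ) :
    fischer (X i * f) g = fischer f (pderiv i g) := by
  induction f using MvPolynomial.induction_on' with
  | add f f' h h' => simp [mul_add, h, h']
  | monomial s a =>
    rw [mul_comm, ← pow_one (X i), ← monomial_add_single, fischer_monomial, fischer_monomial, coeff_pderiv]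
    have : (∏ j, ((s + Finsupp.single i 1 : σ →₀ ℕ) j).factorial : ℂ) =
        (∏ j, (s j).factorial : ℂ) * (s i + 1) := by
      rw [← Finset.prod_erase_mul _ _ (Finset.mem_univ i), ← Finset.prod_erase_mul (a := i) _
        (fun j => ((s j).factorial : ℂ)) (Finset.mem_univ i), mul_assoc]
      congr 1
      · refine Finset.prod_congr rfl fun j hj => ?_
        rw [Finsupp.add_apply, Finsupp.single_eq_of_ne (Finset.ne_of_mem_erase hj), add_zero]
      · rw [Finsupp.add_apply, Finsupp.single_eq_same, Nat.factorial_succ]; push_cast; ring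
    rw [this]; ring

lemma fischer_X_mul_pderiv (p q : σ) (f g : MvPolynomial σ ℂ) :
    fischer (X p * pderiv q f) g = fischer f (X q * pderiv p g) := by
  rw [fischer_X_mul, fischer_comm, ← fischer_X_mul, fischer_comm]

lemma fischer_rot {τ : σ → σ} (p q : σ) (f g : MvPolynomial σ ℂ) :
    fischer (rot τ p q f) g = fischer f (rot τ q p g) := by
  simp only [rot_apply, map_sub, LinearMap.sub_apply, fischer_X_mul_pderiv]

lemma fischer_X_pow (i : σ) (m : ℕ) : fischer (X i ^ m) (X i ^ m : MvPolynomial σ ℂ) ≠ 0 := by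
  rw [X_pow_eq_monomial, fischer_monomial, coeff_monomial, if_pos rfl]
  simp only [one_mul, mul_one]
  exact Finset.prod_ne_zero_iff.2 fun i _ => Nat.cast_ne_zero.2 (Nat.factorial_ne_zero _)

/-- The space of harmonic polynomials of degree `m` is irreducible. -/
lemma splitHarm_le_of_stable {τ : σ → σ} (hτ : ∀ i, τ (τ i) = i) {i₀ p₀ : σ}
    (hi₀ : τ i₀ ≠ i₀) (hp₀ : p₀ ≠ i₀) (hp₀' : p₀ ≠ τ i₀) {m : ℕ}
    (W : Submodule ℂ (MvPolynomial σ ℂ)) (hW : W ≤ splitHarm τ m) (hW0 : W ≠ ⊥)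
    (hs : ∀ p q, ∀ f ∈ W, rot τ p q f ∈ W) : splitHarm τ m ≤ W := by
  by_contra hlt
  have hlt : W < splitHarm τ m := lt_of_le_of_ne hW fun h => hlt h.ge
  have : FiniteDimensional ℂ W := Submodule.finiteDimensional_of_le hW
  let L : splitHarm τ m →ₗ[ℂ] Module.Dual ℂ W :=
    (LinearMap.lcomp ℂ ℂ W.subtype) ∘ₗ fischer ∘ₗ (splitHarm τ m).subtype
  have hL : ∀ f w, L f w = fischer f.1 w.1 := fun _ _ => rfl
  -- The kernel of `L` is the orthogonal complement of `W` inside the harmonic polynomials. The form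
  -- is only bilinear, so the complement is seen to be nonzero by comparing dimensions, not by
  -- positivity.
  have hker : LinearMap.ker L ≠ ⊥ := by
    apply LinearMap.ker_ne_bot_of_finrank_lt
    rw [Subspace.dual_finrank_eq]
    exact Submodule.finrank_lt_finrank_of_lt hlt
  let K : Submodule ℂ (MvPolynomial σ ℂ) := (LinearMap.ker L).map (splitHarm τ m).subtype
  have hK : X i₀ ^ m ∈ K := by
    apply X_pow_mem_of_stable hτ hi₀ hp₀ hp₀'
    · exact Submodule.map_subtype_le _ _
    · obtain ⟨x, hx, hx0⟩ := Submodule.exists_mem_ne_zero_of_ne_bot hker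
      exact (Submodule.ne_bot_iff _).2 ⟨x.1, ⟨x, hx, rfl⟩, fun h => hx0 (Subtype.ext h)⟩
    · rintro p q _ ⟨f, hf, rfl⟩
      refine ⟨⟨_, rot_mem_splitHarm hτ p q f.2⟩, ?_, rfl⟩
      rw [SetLike.mem_coe, LinearMap.mem_ker] at hf ⊢
      ext w
      rw [hL, fischer_rot]
      exact DFunLike.congr_fun hf ⟨_, hs q p _ w.2⟩
  -- `X i₀ ^ m` lies both in `W` and in its complement, although it pairs with itself to `m! ≠ 0`.
  have hXW : X i₀ ^ m ∈ W := X_pow_mem_of_stable hτ hi₀ hp₀ hp₀' W hW hW0 hs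
  obtain ⟨f, hf, hfX⟩ := hK
  have h := DFunLike.congr_fun (LinearMap.mem_ker.1 hf) ⟨_, hXW⟩
  rw [hL] at h
  rw [Submodule.subtype_apply] at hfX
  rw [hfX] at h
  exact fischer_X_pow i₀ m h

end harmonic


/-! ### The root vectors as explicit differential operators -/

section elements

variable {n : ℕ}

lemma Idx.up_ne_one (p : SIdx n) : p.up ≠ one n := by
  rcases p with a | a | z <;> simp [Idx.up, one]

lemma Idx.up_ne_one_neg (p : SIdx n) : p.up ≠ (one n).neg := by
  rcases p with a | a | z <;> simp [Idx.up, one, Idx.neg]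

lemma one_ne_one_neg : one n ≠ (one n).neg := by simp [one, Idx.neg]

lemma Idx.up_inj (p q : SIdx n) : p.up = q.up ↔ p = q := by
  rcases p with a | a | z <;> rcases q with b | b | y <;> simp [Idx.up]

lemma E_apply (i j a b : AIdx n) : (E i j : so n).1 a b =
    (if i = a ∧ j = b then 1 else 0) - (if j.neg = a ∧ i.neg = b then 1 else 0) := by
  rw [E_val, Matrix.sub_apply, Matrix.single_apply, Matrix.single_apply]

lemma psi_apply (d : ℂ) (x : so n) (f : MvPolynomial (Fin n) ℂ) :
    psi d x f = -(x.1 (one n) (one n)) • (dK 1 f + C d * f)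
      + ∑ p : SIdx n, x.1 p.up (one n) • (coordU p * f)
      + ∑ p : SIdx n, x.1 (one n) p.up • vecP d (dcoef n p) f
      + ∑ p : SIdx n, ∑ q : SIdx n, x.1 p.up q.up • (coordU p * dv (dcoef n q) f) := by
  have h6 : opI n d f = dK 1 f + C d * f := by
    simp [opI, euler_eq, smul_eq_C_mul]
  simp only [psi, LinearMap.coe_mk, AddHom.coe_mk, LinearMap.add_apply, LinearMap.sum_apply,
    LinearMap.smul_apply, LinearMap.mulLeft_apply, LinearMap.comp_apply, h6, opV_eq, partialU_eq]

lemma psi_E_one_one (d : ℂ) (f : MvPolynomial (Fin n) ℂ) :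
    psi d (E (one n) (one n)) f = -(dK 1 f + C d * f) := by
  rw [psi_apply]
  simp [E_apply, (Idx.up_ne_one _).symm, (Idx.up_ne_one_neg _).symm, one_ne_one_neg.symm, add_comm]

lemma psi_E_up_one (d : ℂ) (p : SIdx n) (f : MvPolynomial (Fin n) ℂ) :
    psi d (E p.up (one n)) f = coordU p * f := by
  rw [psi_apply]
  simp [E_apply, Idx.up_ne_one, (Idx.up_ne_one _).symm, (Idx.up_ne_one_neg _).symm,
    one_ne_one_neg.symm, Idx.up_inj]

lemma psi_E_one_up (d : ℂ) (p : SIdx n) (f : MvPolynomial (Fin n) ℂ) :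
    psi d (E (one n) p.up) f = vecP d (dcoef n p) f := by
  rw [psi_apply]
  simp [E_apply, Idx.up_ne_one, (Idx.up_ne_one _).symm, (Idx.up_ne_one_neg _).symm,
    one_ne_one_neg.symm, Idx.up_inj]

lemma psi_E_up_up (d : ℂ) (p q : SIdx n) (f : MvPolynomial (Fin n) ℂ) :
    psi d (E p.up q.up) f =
      coordU p * dv (dcoef n q) f - coordU q.neg * dv (dcoef n p.neg) f := by
  rw [psi_apply]
  simp [E_apply, Idx.up_ne_one, Idx.up_inj, sub_smul, ite_and,
    Finset.sum_sub_distrib]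

lemma dK_E (i j : AIdx n) (f : MvPolynomial (AIdx n) ℂ) :
    dK (E i j : so n).1 f = rot Idx.neg i j f := by
  rw [E_val, dK_sub, rot_apply]
  simp [dK_eq, Matrix.single_apply, ite_and, apply_ite C]

/-- A criterion for a vector to be annihilated by `nPos n`. -/
lemma nPos_lie_eq_zero {M : Type} [AddCommGroup M] [Module ℂ M] [LieRingModule (so n) M]
    [LieModule ℂ (so n) M] (v : M) (h1 : ∀ p : SIdx n, ⁅(E (one n) p.up : so n), v⁆ = 0)
    (h2 : ∀ (a : Fin (n / 2)) (p : SIdx n), (∀ h : 0 < n / 2, p ≠ .inl ⟨0, h⟩) →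
      ⁅(E (Idx.up (.inl a : SIdx n)) p.up : so n), v⁆ = 0) :
    ∀ x ∈ nPos n, ⁅x, v⁆ = 0 := by
  have key : ∀ (a : Fin (n / 2 + 1)) (j : AIdx n),
      ((∃ b, a < b ∧ (j = .inl b ∨ j = .inr (.inl b))) ∨ ∃ z, j = .inr (.inr z)) →
      ⁅(E (.inl a) j : so n), v⁆ = 0 := by
    intro a j hj
    -- For `a < b` the second index is at least `2`, so it comes from `SIdx n`. It is exactly `2`,
    -- that is `.inl 0` in `SIdx n`, only if the first index is `1`; this is why `h2` may omit that
    -- case.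
    obtain ⟨p, rfl, hp⟩ : ∃ p : SIdx n, j = p.up ∧
        (a ≠ 0 → ∀ h : 0 < n / 2, p ≠ .inl ⟨0, h⟩) := by
      rcases hj with ⟨b, hab, hj⟩ | ⟨z, rfl⟩
      · obtain ⟨c, rfl⟩ := Fin.exists_succ_eq.2 (Fin.ne_zero_of_lt hab)
        rcases hj with rfl | rfl
        · refine ⟨.inl c, rfl, fun ha h hc => ?_⟩
          have h3 : c = ⟨0, h⟩ := Sum.inl.inj hc
          subst h3
          rw [Fin.lt_def] at hab
          simp at hab
          exact ha hab
        · exact ⟨.inr (.inl c), rfl, fun _ _ => by simp⟩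
      · exact ⟨.inr (.inr z), rfl, fun _ _ => by simp⟩
    rcases Fin.eq_zero_or_eq_succ a with rfl | ⟨c, rfl⟩
    · exact h1 p
    · exact h2 c p (hp (Fin.succ_ne_zero c))
  intro x hx
  induction hx using Submodule.span_induction with
  | mem x hx =>
    rcases hx with ⟨a, b, hab, rfl | rfl⟩ | ⟨a, z, rfl⟩
    · exact key _ _ (.inl ⟨b, hab, .inl rfl⟩)
    · exact key _ _ (.inl ⟨b, hab, .inr rfl⟩)
    · exact key _ _ (.inr ⟨z, rfl⟩)
  | zero => exact zero_lie _
  | add x y _ _ hx hy => rw [add_lie, hx, hy, add_zero]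
  | smul c x _ hx => rw [smul_lie, hx, smul_zero]

end elements

/-! ## Harmonic polynomials in `n + 2` variables -/

section ambient

variable {n : ℕ}

lemma X_pow_mem_splitHarm {σ : Type} [Fintype σ] [DecidableEq σ] (τ : σ → σ) {i : σ}
    (hi : τ i ≠ i) (m : ℕ) : (X i ^ m : MvPolynomial σ ℂ) ∈ splitHarm τ m := by
  refine ⟨by simpa using (isHomogeneous_X ℂ i).pow m, ?_⟩
  rw [SetLike.mem_coe, LinearMap.mem_ker, splitLap_apply]
  refine Finset.sum_eq_zero fun j _ => ?_
  by_cases h : τ j = i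
  · have h2 : j ≠ i := fun h' => hi (h' ▸ h)
    rw [pderiv_comm', pderiv_pow, pderiv_X_of_ne h2.symm, mul_zero, map_zero]
  · rw [pderiv_pow, pderiv_X_of_ne (Ne.symm h), mul_zero, map_zero]

/-- The highest weight vector `U_1 ^ k`. -/
def ambTop (n k : ℕ) : AmbHarmonic n k :=
  ⟨X (one n) ^ k, X_pow_mem_splitHarm Idx.neg one_ne_one_neg.symm k⟩

lemma ambTop_ne_zero (n k : ℕ) : ambTop n k ≠ 0 := fun h =>
  pow_ne_zero k (X_ne_zero (R := ℂ) (one n)) (congrArg Subtype.val h)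

lemma E_lie_ambHarmonic {k : ℕ} (i j : AIdx n) (m : AmbHarmonic n k) :
    (⁅(E i j : so n), m⁆ : AmbHarmonic n k).1 = rot Idx.neg i j m.1 := by
  rw [lie_ambHarmonic, dK_E]

lemma isIrreducible_ambHarmonic (hn : 3 ≤ n) (k : ℕ) :
    LieModule.IsIrreducible ℂ (so n) (AmbHarmonic n k) := by
  have : Nontrivial (AmbHarmonic n k) := ⟨_, _, ambTop_ne_zero n k⟩
  refine LieModule.IsIrreducible.mk fun N hN => ?_
  have hp : (Sum.inl ⟨1, by omega⟩ : AIdx n) ≠ one n := by simp [one]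
  have hp' : (Sum.inl ⟨1, by omega⟩ : AIdx n) ≠ (one n).neg := by simp [one, Idx.neg]
  have h := splitHarm_le_of_stable (τ := Idx.neg) (m := k) Idx.neg_neg (one_ne_one_neg (n := n)).symm
    hp hp' (N.toSubmodule.map (AmbHarmonic n k).subtype) (Submodule.map_subtype_le _ _) (by
      obtain ⟨x, hx, hx0⟩ := Submodule.exists_mem_ne_zero_of_ne_bot
        (fun h => hN ((LieSubmodule.toSubmodule_eq_bot N).1 h))
      exact (Submodule.ne_bot_iff _).2 ⟨x.1, ⟨x, hx, rfl⟩, fun h => hx0 (Subtype.ext h)⟩) (by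
      rintro p q _ ⟨f, hf, rfl⟩
      exact ⟨_, N.lie_mem (x := E p q) hf, E_lie_ambHarmonic p q f⟩)
  rw [eq_top_iff]
  intro x _
  obtain ⟨y, hy, hyx⟩ := h x.2
  rwa [← Subtype.ext hyx]

lemma pderiv_X_pow_of_ne {σ : Type} {i j : σ} (h : j ≠ i) (k : ℕ) :
    pderiv j (X i ^ k : MvPolynomial σ ℂ) = 0 := by
  rw [pderiv_pow, pderiv_X_of_ne h.symm, mul_zero]

lemma rot_X_pow_eq_zero {σ : Type} [Fintype σ] [DecidableEq σ] (τ : σ → σ) {i p q : σ}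
    (hq : q ≠ i) (hp : τ p ≠ i) (k : ℕ) : rot τ p q (X i ^ k) = 0 := by
  rw [rot_apply, pderiv_X_pow_of_ne hq, pderiv_X_pow_of_ne hp]
  simp

lemma rot_self_X_pow {σ : Type} [Fintype σ] [DecidableEq σ] (τ : σ → σ) {i : σ}
    (hi : τ i ≠ i) (k : ℕ) : rot τ i i (X i ^ k) = (k : ℂ) • X i ^ k := by
  rw [rot_apply, pderiv_X_pow_of_ne hi, pderiv_pow, pderiv_X_self, smul_eq_C_mul, map_natCast]
  rcases k with _ | k
  · simp
  · rw [Nat.add_sub_cancel]; ring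

/-- For `n ≥ 3` the first node is never a spin node, so `ϖ_1 = ε_1`. -/
lemma lamWeight_apply (hn : 3 ≤ n) (r : ℕ) (a : Fin (n / 2 + 1)) :
    lamWeight n r a = if a = 0 then (r : ℂ) - n / 2 else 0 := by
  have h1 : ¬ (1 = n / 2 + 1) := by omega
  have h2 : ¬ (Even n ∧ 1 = n / 2) := by rintro ⟨⟨k, hk⟩, h⟩; omega
  simp only [lamWeight, Pi.smul_apply, fundWeight, h1, h2, if_false, smul_eq_mul, Nat.lt_one_iff,
    Fin.val_eq_zero_iff]
  split_ifs <;> ring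

lemma isHighestWeightVector_ambTop (hn : 3 ≤ n) (he : Even n) {r : ℕ} (hr : n / 2 ≤ r) :
    IsHighestWeightVector (lamWeight n r) (ambTop n (r - n / 2)) where
  nPos_lie := nPos_lie_eq_zero _
    (fun p => Subtype.ext ((E_lie_ambHarmonic _ _ _).trans
      (rot_X_pow_eq_zero _ (Idx.up_ne_one p) one_ne_one_neg.symm _)))
    (fun a p _ => Subtype.ext ((E_lie_ambHarmonic _ _ _).trans
      (rot_X_pow_eq_zero _ (Idx.up_ne_one p) (by rw [Idx.neg_up]; exact Idx.up_ne_one _) _)))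
  cartan_lie a := by
    apply Subtype.ext
    rw [cartan, E_lie_ambHarmonic, lamWeight_apply hn]
    change rot Idx.neg (.inl a) (.inl a) (X (one n) ^ (r - n / 2)) = _ • X (one n) ^ (r - n / 2)
    split_ifs with ha
    · subst ha
      have h := rot_self_X_pow Idx.neg (one_ne_one_neg (n := n)).symm (r - n / 2)
      rw [show (Sum.inl 0 : AIdx n) = one n from rfl, h, Nat.cast_sub hr]
      rw [Nat.cast_div he.two_dvd (by norm_num)]
      norm_num
    · rw [zero_smul]
      exact rot_X_pow_eq_zero _ (by simpa [one] using ha) (by simp [one, Idx.neg]) _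

end ambient

/-! ## Harmonic polynomials in `n` variables -/

section coordinateChange

variable {n : ℕ}

/-- `SIdx n` has `n` elements, so a one-sided inverse is two-sided. -/
lemma coef_mul_dcoef : (coef n).transpose * dcoef n = 1 := by
  have hc : Fintype.card (SIdx n) = Fintype.card (Fin n) := by
    simp only [Fintype.card_sum, Fintype.card_fin]; omega
  exact (Matrix.mul_eq_one_comm_of_card_eq _ _ _ hc).1 dcoef_mul_coef

lemma sum_coef_mul_dcoef (i j : Fin n) :
    ∑ p, coef n p i * dcoef n p j = if i = j then 1 else 0 := by
  have := congrFun (congrFun (coef_mul_dcoef (n := n)) i) j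
  rwa [Matrix.mul_apply, Matrix.one_apply] at this

lemma sum_coef_smul_dcoef (i : Fin n) : ∑ p, coef n p i • dcoef n p = Pi.single i 1 := by
  ext j
  simp only [Finset.sum_apply, Pi.smul_apply, smul_eq_mul, sum_coef_mul_dcoef, Pi.single_apply,
    eq_comm]

lemma sum_dcoef_smul_coef (i : Fin n) : ∑ p, dcoef n p i • coef n p = Pi.single i 1 := by
  ext j
  simp only [Finset.sum_apply, Pi.smul_apply, smul_eq_mul, mul_comm (dcoef n _ i),
    sum_coef_mul_dcoef, Pi.single_apply]

/-- The isomorphism of `ℂ[U_p]` with `ℂ[X_1, …, X_n]`. -/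
def coordEquiv (n : ℕ) : MvPolynomial (SIdx n) ℂ ≃ₐ[ℂ] MvPolynomial (Fin n) ℂ :=
  AlgEquiv.ofAlgHom (aeval coordU) (aeval fun i => ∑ p, C (dcoef n p i) * X p)
    (by
      ext1 i
      simp only [AlgHom.comp_apply, aeval_X, map_sum, map_mul, algHom_C, AlgHom.id_apply, coordU_eq]
      simp only [algebraMap_eq, ← lf_smul, ← lf_sum, sum_dcoef_smul_coef, lf_single])
    (by
      ext1 p
      simp only [AlgHom.comp_apply, aeval_X, AlgHom.id_apply, coordU_eq, lf, map_sum, map_mul,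
        algHom_C, algebraMap_eq, Finset.mul_sum]
      rw [Finset.sum_comm]
      have : ∀ q : SIdx n, ∑ i, C (coef n p i) * (C (dcoef n q i) * X q) =
          C (dcoef n q ⬝ᵥ coef n p) * (X q : MvPolynomial (SIdx n) ℂ) := by
        intro q
        simp only [dotProduct, map_sum, map_mul, Finset.sum_mul]
        exact Finset.sum_congr rfl fun i _ => by ring
      simp only [this, coef_dot]
      simp)

lemma coordEquiv_X (p : SIdx n) : coordEquiv n (X p) = coordU p := aeval_X _ _

lemma coordEquiv_pderiv (q : SIdx n) (f : MvPolynomial (SIdx n) ℂ) :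
    coordEquiv n (pderiv q f) = dv (dcoef n q) (coordEquiv n f) := by
  induction f using MvPolynomial.induction_on with
  | C a => rw [pderiv_C, map_zero, ← algebraMap_eq, AlgEquiv.commutes, algebraMap_eq, dv_C]
  | add f g hf hg => simp only [map_add, hf, hg]
  | mul_X f p hf =>
    rw [pderiv_mul, map_add, map_mul, map_mul, map_mul, coordEquiv_X, Derivation.leibniz, hf,
      coordU_eq, dv_lf, coef_dot, pderiv_X, Pi.single_apply]
    simp only [smul_eq_mul]
    by_cases h : p = q <;> simp [h] <;> ring

lemma coordEquiv_rot (d : ℂ) (p q : SIdx n) (f : MvPolynomial (SIdx n) ℂ) :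
    coordEquiv n (rot Idx.neg p q f) = psi d (E p.up q.up) (coordEquiv n f) := by
  rw [rot_apply, psi_E_up_up, map_sub, map_mul, map_mul, coordEquiv_X, coordEquiv_X,
    coordEquiv_pderiv, coordEquiv_pderiv]

lemma sum_coef_mul_dv (i : Fin n) (g : MvPolynomial (Fin n) ℂ) :
    ∑ p, C (coef n p i) * dv (dcoef n p) g = pderiv i g := by
  rw [← dv_single i g, ← sum_coef_smul_dcoef]
  simp only [dv_eq, Finset.sum_apply, Pi.smul_apply, smul_eq_mul, map_sum, map_mul, Finset.sum_mul,
    Finset.mul_sum, mul_assoc]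
  exact Finset.sum_comm

/-- The factor `1 / 2` in `laplacian` matches `∂_{U_{-q}} = (1/2) ∑ coef_{q i} ∂_i`; the remaining
sum over `q` is the inverse change of coordinates. -/
lemma coordEquiv_splitLap (f : MvPolynomial (SIdx n) ℂ) :
    coordEquiv n (splitLap Idx.neg f) = laplacian n (coordEquiv n f) := by
  have h : ∀ q : SIdx n, (dcoef n q.neg) = (1 / 2 : ℂ) • coef n q := fun q => by
    rw [dcoef_row, Idx.neg_neg, coef_row]
  rw [splitLap_apply, map_sum, lap_eq, Finset.mul_sum]
  simp only [coordEquiv_pderiv, h, dv_smul, dv_eq (coef n _), Derivation.leibniz, dv_C, smul_eq_mul,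
    map_sum, mul_zero, add_zero]
  rw [← Finset.mul_sum, Finset.sum_comm, ← Finset.mul_sum]
  exact congrArg _ (Finset.sum_congr rfl fun i _ => sum_coef_mul_dv i _)

lemma isHomogeneous_lf (v : Fin n → ℂ) : (lf v).IsHomogeneous 1 :=
  IsHomogeneous.sum _ _ _ fun i _ => (isHomogeneous_X ℂ i).C_mul _

lemma isHomogeneous_coordEquiv {m : ℕ} {f : MvPolynomial (SIdx n) ℂ} :
    (coordEquiv n f).IsHomogeneous m ↔ f.IsHomogeneous m := by
  constructor
  · intro h
    rw [← (coordEquiv n).symm_apply_apply f]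
    have := h.aeval (fun i => ∑ p, C (dcoef n p i) * X p : Fin n → MvPolynomial (SIdx n) ℂ) (n := 1)
      fun i => IsHomogeneous.sum _ _ _ fun p _ => (isHomogeneous_X ℂ p).C_mul _
    rwa [one_mul] at this
  · intro h
    have := h.aeval (coordU : SIdx n → MvPolynomial (Fin n) ℂ) (n := 1) fun p => by
      rw [coordU_eq]; exact isHomogeneous_lf _
    rwa [one_mul] at this

lemma coordEquiv_mem_harmonicPoly {m : ℕ} {f : MvPolynomial (SIdx n) ℂ} :
    coordEquiv n f ∈ harmonicPoly n m ↔ f ∈ splitHarm Idx.neg m := by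
  rw [harmonicPoly, splitHarm, Submodule.mem_inf, Submodule.mem_inf, LinearMap.mem_ker,
    LinearMap.mem_ker, ← coordEquiv_splitLap, EmbeddingLike.map_eq_zero_iff,
    mem_homogeneousSubmodule, mem_homogeneousSubmodule, isHomogeneous_coordEquiv]

/-- The space `H(m)` is irreducible under the rotations. -/
lemma harmonicPoly_le_of_stable (hn : 3 ≤ n) {m : ℕ} (d : ℂ)
    (J : Submodule ℂ (MvPolynomial (Fin n) ℂ))
    (hJ : ∀ p q : SIdx n, ∀ f ∈ J, psi d (E p.up q.up) f ∈ J)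
    {h : MvPolynomial (Fin n) ℂ} (hhJ : h ∈ J) (hh : h ∈ harmonicPoly n m) (h0 : h ≠ 0) :
    harmonicPoly n m ≤ J := by
  -- A coordinate different from `U_{±2}` is needed: `U_3` if `n ≥ 4`, and `U_0` if `n = 3`.
  obtain ⟨p, hp, hp'⟩ : ∃ p : SIdx n, p ≠ Sum.inl ⟨0, by omega⟩ ∧
      p ≠ Idx.neg (Sum.inl ⟨0, by omega⟩) := by
    by_cases h4 : 4 ≤ n
    · exact ⟨.inl ⟨1, by omega⟩, by simp, by simp [Idx.neg]⟩
    · exact ⟨.inr (.inr ⟨0, by omega⟩), by simp, by simp [Idx.neg]⟩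
  have key := splitHarm_le_of_stable (τ := Idx.neg) (m := m) Idx.neg_neg (by simp [Idx.neg]) hp hp'
    (J.comap (coordEquiv n).toLinearMap ⊓ splitHarm Idx.neg m) inf_le_right (by
      refine (Submodule.ne_bot_iff _).2 ⟨(coordEquiv n).symm h, ⟨?_, ?_⟩, ?_⟩
      · simpa using hhJ
      · rw [SetLike.mem_coe, ← coordEquiv_mem_harmonicPoly, AlgEquiv.apply_symm_apply]
        exact hh
      · simpa using h0) (by
      rintro p q f ⟨hf1, hf2⟩
      refine ⟨?_, rot_mem_splitHarm Idx.neg_neg _ _ hf2⟩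
      change coordEquiv n (rot Idx.neg p q f) ∈ J
      rw [coordEquiv_rot d]
      exact hJ p q _ hf1)
  intro f hf
  rw [← (coordEquiv n).apply_symm_apply f] at hf ⊢
  exact (key (coordEquiv_mem_harmonicPoly.1 hf)).1

end coordinateChange


/-! ## Ideals stable under the operators `P_w` -/

section stable

variable {n : ℕ}

lemma dK_one_eq (f : MvPolynomial (Fin n) ℂ) : dK 1 f = ∑ i, X i * pderiv i f := by
  rw [← euler_eq, euler]; simp

lemma dK_one_of_isHomogeneous {m : ℕ} {f : MvPolynomial (Fin n) ℂ} (hf : f.IsHomogeneous m) :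
    dK 1 f = C (m : ℂ) * f := by
  rw [dK_one_eq, hf.sum_X_mul_pderiv, nsmul_eq_mul, map_natCast]

lemma dv_of_isHomogeneous_zero {f : MvPolynomial (Fin n) ℂ} (hf : f.IsHomogeneous 0)
    (w : Fin n → ℂ) : dv w f = 0 := by
  rw [totalDegree_eq_zero_iff_eq_C.1 (Nat.le_zero.1 hf.totalDegree_le), dv_C]

lemma isHomogeneous_dv {m : ℕ} {f : MvPolynomial (Fin n) ℂ} (hf : f.IsHomogeneous m)
    (w : Fin n → ℂ) : (dv w f).IsHomogeneous (m - 1) := by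
  rw [dv_eq]
  exact IsHomogeneous.sum _ _ _ fun i _ => hf.pderiv.C_mul _

lemma isHomogeneous_laplacian {m : ℕ} {f : MvPolynomial (Fin n) ℂ} (hf : f.IsHomogeneous m) :
    (laplacian n f).IsHomogeneous (m - 1 - 1) := by
  rw [lap_eq]
  exact (IsHomogeneous.sum _ _ _ fun i _ => hf.pderiv.pderiv).C_mul _

lemma laplacian_eq_zero_of_isHomogeneous {m : ℕ} {f : MvPolynomial (Fin n) ℂ}
    (hf : f.IsHomogeneous m) (hm : m ≤ 1) : laplacian n f = 0 := by
  rw [lap_eq]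
  rw [Finset.sum_eq_zero, mul_zero]
  intro i _
  have h : (pderiv i f).IsHomogeneous 0 := by
    have := hf.pderiv (i := i)
    rwa [Nat.sub_eq_zero_of_le hm] at this
  rw [← dv_single i (pderiv i f)]
  exact dv_of_isHomogeneous_zero h _

lemma dK_one_dv_of_isHomogeneous {m : ℕ} {f : MvPolynomial (Fin n) ℂ} (hf : f.IsHomogeneous m)
    (w : Fin n → ℂ) : dK 1 (dv w f) = C ((m : ℂ) - 1) * dv w f := by
  rw [dK_dv, dK_one_of_isHomogeneous hf, Derivation.leibniz, dv_C, Matrix.transpose_one,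
    Matrix.one_mulVec, C_sub, C_1]
  simp only [smul_eq_mul]; ring

/-- The scalar `m - 1 + d` vanishes exactly in the critical degree `m = 1 - d`, where only the
Laplacian term survives. -/
lemma vecP_of_isHomogeneous {m : ℕ} {f : MvPolynomial (Fin n) ℂ} (hf : f.IsHomogeneous m) (d : ℂ)
    (w : Fin n → ℂ) : vecP d w f = lf w * laplacian n f - C ((m : ℂ) - 1 + d) * dv w f := by
  rw [vecP, dK_one_dv_of_isHomogeneous hf, C_add]; ring

lemma isHomogeneous_vecP {m : ℕ} {f : MvPolynomial (Fin n) ℂ} (hf : f.IsHomogeneous m) (d : ℂ)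
    (w : Fin n → ℂ) : (vecP d w f).IsHomogeneous (m - 1) := by
  rw [vecP_of_isHomogeneous hf]
  refine IsHomogeneous.sub ?_ ((isHomogeneous_dv hf w).C_mul _)
  -- With truncated subtraction, `1 + (m - 1 - 1)` is `m - 1` only for `m ≥ 2`; below that the
  -- Laplacian term is zero.
  by_cases hm : m ≤ 1
  · rw [laplacian_eq_zero_of_isHomogeneous hf hm, mul_zero]
    exact isHomogeneous_zero _ _ _
  · have := (isHomogeneous_lf w).mul (isHomogeneous_laplacian hf)
    convert! this using 1
    omega

lemma vecP_of_isHomogeneous_zero {f : MvPolynomial (Fin n) ℂ} (hf : f.IsHomogeneous 0) (d : ℂ)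
    (w : Fin n → ℂ) : vecP d w f = 0 := by
  rw [vecP_of_isHomogeneous hf, laplacian_eq_zero_of_isHomogeneous hf zero_le_one,
    dv_of_isHomogeneous_zero hf, mul_zero, mul_zero, sub_zero]

lemma vecP_lf_mul (d : ℂ) (v w : Fin n → ℂ) (f : MvPolynomial (Fin n) ℂ) :
    vecP d w (lf v * f) = lf v * vecP d w f - C (w ⬝ᵥ v) * (dK 1 f + C d * f) +
      (lf w * dv v f - lf v * dv w f) := by
  have h1 : dK 1 (dv w f) = dv w (dK 1 f) - dv w f := by
    rw [dK_dv]; simp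
  simp only [vecP, lap_lf_mul, Derivation.leibniz, smul_eq_mul, map_add, dv_lf, dK_C, dK_lf,
    Matrix.one_mulVec, mul_zero, h1]
  ring

/-- The Casimir operator of the rotations. -/
lemma sum_rot_rot {m : ℕ} {f : MvPolynomial (Fin n) ℂ} (hf : f.IsHomogeneous m) :
    ∑ i, ∑ j, rot id i j (rot id i j f) =
      C 2 * (C 2 * quadF n * laplacian n f - C ((m : ℂ) * (m + n - 2)) * f) := by
  have h1 : ∀ i j, rot id i j (rot id i j f) =
      (X i * pderiv j (X i * pderiv j f) - X i * pderiv j (X j * pderiv i f)) +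
      (X j * pderiv i (X j * pderiv i f) - X j * pderiv i (X i * pderiv j f)) := by
    intro i j
    simp only [rot_apply, id, map_sub]; ring
  simp only [h1, Finset.sum_add_distrib]
  -- The second half of the summand is the first one with `i` and `j` exchanged, so the double sum
  -- is twice the first half.
  rw [Finset.sum_comm (f := fun i j => X j * pderiv i (X j * pderiv i f) -
    X j * pderiv i (X i * pderiv j f)), ← two_mul]
  have h2 : ∀ i j : Fin n, X i * pderiv j (X i * pderiv j f) =
      (if i = j then X i * pderiv j f else 0) + X i ^ 2 * pderiv j (pderiv j f) := by
    intro i j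
    rw [pderiv_mul, pderiv_X, Pi.single_apply]
    by_cases h : i = j <;> simp [h] <;> ring
  have h3 : ∀ i j : Fin n, X i * pderiv j (X j * pderiv i f) =
      X i * pderiv i f + X i * (X j * pderiv j (pderiv i f)) := by
    intro i j
    rw [pderiv_mul, pderiv_X_self]; ring
  have h4 : ∑ i : Fin n, X i * pderiv i f = C (m : ℂ) * f := by
    rw [← dK_one_eq, dK_one_of_isHomogeneous hf]
  have h5 : ∀ i : Fin n, ∑ j : Fin n, X j * pderiv j (pderiv i f) =
      C ((m : ℂ) - 1) * pderiv i f := by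
    intro i
    rw [← dK_one_eq, ← dv_single, dK_one_dv_of_isHomogeneous hf]
  have h6 : ∑ j, pderiv j (pderiv j f) = C 2 * laplacian n f := by
    rw [lap_eq, ← mul_assoc, ← C_mul]; norm_num
  simp only [h2, h3, Finset.sum_sub_distrib, Finset.sum_add_distrib, Finset.sum_ite_eq,
    Finset.mem_univ, if_true, ← Finset.mul_sum, h4, h5, h6, Finset.sum_const, Finset.card_univ,
    Fintype.card_fin, ← Finset.sum_mul]
  have h7 : ∑ i : Fin n, X i * (C ((m : ℂ) - 1) * pderiv i f) =
      C ((m : ℂ) - 1) * (C (m : ℂ) * f) := by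
    rw [← h4, Finset.mul_sum]
    exact Finset.sum_congr rfl fun i _ => by ring
  have h8 : ∑ i : Fin n, X i * n • pderiv i f = C (n : ℂ) * (C (m : ℂ) * f) := by
    rw [← h4, Finset.mul_sum]
    exact Finset.sum_congr rfl fun i _ => by rw [nsmul_eq_mul, map_natCast]; ring
  rw [h7, h8, ← quadF]
  simp only [C_mul, C_sub, C_add, C_1, map_ofNat]
  ring

lemma sum_X_mul_vecP {m : ℕ} {f : MvPolynomial (Fin n) ℂ} (hf : f.IsHomogeneous m) (d : ℂ) :
    ∑ j, X j * vecP d (Pi.single j 1) f =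
      quadF n * laplacian n f - C (((m : ℂ) - 1 + d) * m) * f := by
  have h : ∀ j : Fin n, X j * vecP d (Pi.single j 1) f =
      X j ^ 2 * laplacian n f - C ((m : ℂ) - 1 + d) * (X j * pderiv j f) := by
    intro j
    rw [vecP_of_isHomogeneous hf, lf_single, dv_single]; ring
  simp only [h, Finset.sum_sub_distrib, ← Finset.mul_sum, ← Finset.sum_mul]
  rw [← dK_one_eq, dK_one_of_isHomogeneous hf, ← quadF, C_mul]
  ring

/-- The extra factor `F` keeps the formula free of `F ^ (s - 1)`, so it also covers `s = 0`. -/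
lemma quadF_mul_laplacian_quadF_pow {m : ℕ} {g : MvPolynomial (Fin n) ℂ} (hg : g.IsHomogeneous m)
    (s : ℕ) : quadF n * laplacian n (quadF n ^ s * g) =
      quadF n ^ (s + 1) * laplacian n g +
        C ((s : ℂ) * (2 * m + n + 2 * s - 2)) * (quadF n ^ s * g) := by
  rcases s with _ | s
  · simp
  · rw [lap_quadF_pow, dK_one_of_isHomogeneous hg]
    simp only [C_mul, C_add, C_sub, Nat.cast_add, Nat.cast_one, C_1, map_ofNat]
    ring

lemma isHomogeneous_quadF : (quadF n).IsHomogeneous 2 :=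
  IsHomogeneous.sum _ _ _ fun i _ => by simpa using (isHomogeneous_X ℂ i).pow 2

/-- An ideal stable under the operators `P_w`. -/
def IsStable (d : ℂ) (J : Ideal (MvPolynomial (Fin n) ℂ)) : Prop :=
  ∀ w, ∀ f ∈ J, vecP d w f ∈ J

namespace IsStable

variable {d : ℂ} {J : Ideal (MvPolynomial (Fin n) ℂ)} (hJ : IsStable d J)
include hJ

/-- The element is `[P_w, v] f`. The choice `v = w = e_0` yields the Euler operator and orthogonal
unit vectors yield the rotations, so a stable ideal is closed under both. -/
lemma bracket_mem (v w : Fin n → ℂ) {f : MvPolynomial (Fin n) ℂ} (hf : f ∈ J) :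
    (lf w * dv v f - lf v * dv w f) - C (w ⬝ᵥ v) * (dK 1 f + C d * f) ∈ J := by
  have h := J.sub_mem (hJ w _ (J.mul_mem_left (lf v) hf)) (J.mul_mem_left (lf v) (hJ w _ hf))
  rw [vecP_lf_mul] at h
  convert! h using 1
  ring

lemma dK_one_mem (hn : 1 ≤ n) {f : MvPolynomial (Fin n) ℂ} (hf : f ∈ J) : dK 1 f ∈ J := by
  have h := hJ.bracket_mem (Pi.single ⟨0, hn⟩ 1) (Pi.single ⟨0, hn⟩ 1) hf
  simp only [sub_self, single_one_dotProduct, Pi.single_eq_same, C_1, one_mul, zero_sub,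
    Ideal.neg_mem_iff] at h
  exact (J.add_mem_iff_left (J.mul_mem_left _ hf)).1 h

lemma rot_mem (i j : Fin n) {f : MvPolynomial (Fin n) ℂ} (hf : f ∈ J) : rot id i j f ∈ J := by
  by_cases hij : i = j
  · subst hij
    rw [rot_apply, id, sub_self]; exact J.zero_mem
  · have h := hJ.bracket_mem (Pi.single j 1) (Pi.single i 1) hf
    rw [single_one_dotProduct, Pi.single_eq_of_ne hij, C_0, zero_mul, sub_zero, lf_single,
      lf_single, dv_single, dv_single] at h
    exact h

lemma homogeneousComponent_mem (hn : 1 ≤ n) {f : MvPolynomial (Fin n) ℂ} (hf : f ∈ J) (m : ℕ) :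
    homogeneousComponent m f ∈ J := by
  by_cases hm : f.totalDegree < m
  · rw [homogeneousComponent_eq_zero _ _ hm]; exact J.zero_mem
  · have := mem_of_sum_eigenvectors_mem (euler n) (J.restrictScalars ℂ)
      (fun x hx => by rw [euler_eq]; exact hJ.dK_one_mem hn hx) (fun m : ℕ => (m : ℂ))
      (Finset.range (f.totalDegree + 1)) Nat.cast_injective.injOn
      (fun i => homogeneousComponent i f) (fun i _ => by
        rw [euler_eq, dK_one_of_isHomogeneous (homogeneousComponent_isHomogeneous i f),
          smul_eq_C_mul])
      (by rw [sum_homogeneousComponent]; exact hf)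
    exact this m (Finset.mem_range.2 (by omega))

lemma quadF_mul_laplacian_mem {m : ℕ} {f : MvPolynomial (Fin n) ℂ} (hf : f.IsHomogeneous m)
    (hfJ : f ∈ J) : quadF n * laplacian n f ∈ J := by
  have h : ∑ j, X j * vecP d (Pi.single j 1) f ∈ J :=
    J.sum_mem fun j _ => J.mul_mem_left _ (hJ _ _ hfJ)
  rw [sum_X_mul_vecP hf] at h
  exact (J.sub_mem_iff_left (J.mul_mem_left _ hfJ)).1 h

/-- `r(2r + n - 2)` is the eigenvalue of `F Δ₁` on `F ^ r`. It differs from the one attached to `F ^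
s` times a harmonic polynomial of degree `2r - 2s` for `s < r`, which forces `f` to become divisible
by `F ^ r` modulo `J`. -/
lemma mem_of_quadF_mul_laplacian (hn : 3 ≤ n) {r : ℕ} (hF : quadF n ^ r ∈ J)
    {f : MvPolynomial (Fin n) ℂ} (hf : f.IsHomogeneous (2 * r))
    (h : quadF n * laplacian n f - C ((r : ℂ) * (2 * r + n - 2)) * f ∈ J) : f ∈ J := by
  have key : ∀ s ≤ r, ∃ g : MvPolynomial (Fin n) ℂ, g.IsHomogeneous (2 * r - 2 * s) ∧
      f - quadF n ^ s * g ∈ J := by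
    intro s
    induction s with
    | zero => exact fun _ => ⟨f, hf, by simp⟩
    | succ s ih =>
      intro hs
      obtain ⟨g, hg, hgJ⟩ := ih (by omega)
      have hhom : (f - quadF n ^ s * g).IsHomogeneous (2 * r) := by
        refine hf.sub ?_
        have := (isHomogeneous_quadF (n := n)).pow s |>.mul hg
        convert! this using 1
        omega
      have h1 := hJ.quadF_mul_laplacian_mem hhom hgJ
      rw [map_sub, mul_sub, quadF_mul_laplacian_quadF_pow hg] at h1
      -- This number is `r(2r + n - 2)` minus the coefficient `s(2(2r - 2s) + n + 2s - 2)` in `F Δ₁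
      -- (F ^ s g)`. As it is invertible, `f ≡ F ^ s g` improves to `f ≡ F ^ (s + 1) e⁻¹ Δ₁ g`.
      have hne : ((r : ℂ) - s) * (2 * (r - s) + n - 2) ≠ 0 := by
        have h3 : ((r : ℂ) - s) * (2 * (r - s) + n - 2) =
            (((r - s) * (2 * (r - s) + (n - 2)) : ℕ) : ℂ) := by
          rw [Nat.cast_mul, Nat.cast_add, Nat.cast_mul, Nat.cast_sub (by omega),
            Nat.cast_sub (by omega)]
          push_cast; ring
        rw [h3, Nat.cast_ne_zero]
        exact Nat.mul_ne_zero (by omega) (by omega)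
      set e := ((r : ℂ) - s) * (2 * (r - s) + n - 2) with he
      refine ⟨C e⁻¹ * laplacian n g, ?_, ?_⟩
      · have := (isHomogeneous_laplacian hg).C_mul e⁻¹
        convert! this using 1
      · have h4 : C e⁻¹ * (C e * (f - quadF n ^ (s + 1) * (C e⁻¹ * laplacian n g))) ∈ J := by
          refine J.mul_mem_left _ ?_
          have h5 := J.sub_mem h1 (J.add_mem h (J.mul_mem_left
            (C ((s : ℂ) * (2 * (2 * (r - s)) + n + 2 * s - 2))) hgJ))
          have hee : (C e : MvPolynomial (Fin n) ℂ) * C e⁻¹ = 1 := by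
            rw [← C_mul, mul_inv_cancel₀ hne, C_1]
          have hcast : ((2 * r - 2 * s : ℕ) : ℂ) = 2 * (r - s) := by
            rw [Nat.cast_sub (by omega)]; push_cast; ring
          have hsplit : (C e : MvPolynomial (Fin n) ℂ) = C ((r : ℂ) * (2 * r + n - 2)) -
              C ((s : ℂ) * (2 * (2 * (r - s)) + n + 2 * s - 2)) := by
            rw [← C_sub]; congr 1; rw [he]; ring
          rw [hcast] at h5
          convert! h5 using 1
          linear_combination f * hsplit - quadF n ^ (s + 1) * laplacian n g * hee
        rwa [← mul_assoc, ← C_mul, inv_mul_cancel₀ hne, C_1, one_mul] at h4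
  obtain ⟨g, -, hg⟩ := key r le_rfl
  exact (J.sub_mem_iff_left (J.mul_mem_right _ hF)).1 hg

end IsStable

/-- A homogeneous polynomial of positive degree `m` which is annihilated by the operators `P_w`
modulo a stable ideal containing `F ^ r` lies in this ideal, unless `m = 1 - d`. -/
lemma IsStable.mem_of_vecP_mem (hn : 3 ≤ n) {r : ℕ} {J : Ideal (MvPolynomial (Fin n) ℂ)}
    (hJ : IsStable ((n : ℂ) / 2 - r) J) (hF : quadF n ^ r ∈ J) {m : ℕ} (hm : m ≠ 0)
    (hmr : 2 * m + n ≠ 2 * r + 2) {f : MvPolynomial (Fin n) ℂ} (hf : f.IsHomogeneous m)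
    (h : ∀ w, vecP ((n : ℂ) / 2 - r) w f ∈ J) : f ∈ J := by
  have hCJ : ∀ (a : ℂ) (g : MvPolynomial (Fin n) ℂ), a ≠ 0 → C a * g ∈ J → g ∈ J := by
    intro a g ha hg
    have := J.mul_mem_left (C a⁻¹) hg
    rwa [← mul_assoc, ← C_mul, inv_mul_cancel₀ ha, C_1, one_mul] at this
  set c : ℂ := (m : ℂ) - 1 + (n / 2 - r) with hc
  have hc0 : c ≠ 0 := by
    intro h0
    apply hmr
    have : ((2 * m + n : ℕ) : ℂ) = ((2 * r + 2 : ℕ) : ℂ) := by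
      push_cast; rw [hc] at h0; linear_combination 2 * h0
    exact_mod_cast this
  -- In `X_j P_i f - X_i P_j f` the Laplacian terms cancel and `c` times the rotation remains.
  have hrot : ∀ i j, rot id i j f ∈ J := by
    intro i j
    apply hCJ c _ hc0
    have := J.sub_mem (J.mul_mem_left (X j) (h (Pi.single i 1)))
      (J.mul_mem_left (X i) (h (Pi.single j 1)))
    rw [vecP_of_isHomogeneous hf, vecP_of_isHomogeneous hf, lf_single, lf_single, dv_single,
      dv_single] at this
    convert! this using 1
    rw [rot_apply, id, id]; ring
  have h1 : C 2 * (C 2 * quadF n * laplacian n f - C ((m : ℂ) * (m + n - 2)) * f) ∈ J := by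
    rw [← sum_rot_rot hf]
    exact J.sum_mem fun i _ => J.sum_mem fun j _ => hJ.rot_mem i j (hrot i j)
  have h2 : quadF n * laplacian n f - C (c * m) * f ∈ J := by
    rw [← sum_X_mul_vecP hf]
    exact J.sum_mem fun j _ => J.mul_mem_left _ (h _)
  by_cases hm2 : m = 2 * r
  · subst hm2
    refine hJ.mem_of_quadF_mul_laplacian hn hF hf ?_
    convert! h2 using 4
    rw [hc]; push_cast; ring
  -- Subtracting twice `h2` from the Casimir relation eliminates `F Δ₁ f`, and `2cm - m(m + n - 2) =
  -- m(m - 2r)`.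
  · have h3 := J.sub_mem (hCJ 2 _ two_ne_zero h1) (J.mul_mem_left (C 2) h2)
    refine hCJ ((m : ℂ) * (m - 2 * r)) f ?_ ?_
    · refine mul_ne_zero (Nat.cast_ne_zero.2 hm) (sub_ne_zero.2 ?_)
      exact_mod_cast hm2
    · convert! h3 using 1
      have : (m : ℂ) * (m - 2 * r) = 2 * (c * m) - (m : ℂ) * (m + n - 2) := by rw [hc]; ring
      rw [this, C_sub, C_mul (a := 2)]; ring

/-- Polynomials of minimal degree in a stable ideal outside another one. -/
lemma IsStable.exists_isHomogeneous (hn : 1 ≤ n) {d : ℂ} {J₀ J : Ideal (MvPolynomial (Fin n) ℂ)}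
    (hJ : IsStable d J) (h : ¬ J ≤ J₀) :
    ∃ (m : ℕ) (g : MvPolynomial (Fin n) ℂ), g.IsHomogeneous m ∧ g ∈ J ∧ g ∉ J₀ ∧
      ∀ w, vecP d w g ∈ J₀ := by
  classical
  have hex : ∃ (m : ℕ) (g : MvPolynomial (Fin n) ℂ), g.IsHomogeneous m ∧ g ∈ J ∧ g ∉ J₀ := by
    obtain ⟨f, hf, hf0⟩ := SetLike.not_le_iff_exists.1 h
    by_contra! hall
    apply hf0
    rw [← sum_homogeneousComponent f]
    exact J₀.sum_mem fun i _ => hall i _ (homogeneousComponent_isHomogeneous i f)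
      (hJ.homogeneousComponent_mem hn hf i)
  obtain ⟨g, hg, hgJ, hgJ₀⟩ := Nat.find_spec hex
  refine ⟨Nat.find hex, g, hg, hgJ, hgJ₀, fun w => ?_⟩
  rcases Nat.eq_zero_or_pos (Nat.find hex) with h0 | hpos
  · rw [h0] at hg
    rw [vecP_of_isHomogeneous_zero hg]; exact J₀.zero_mem
  · by_contra hw
    -- `P_w g` has degree one less and lies in `J`, so outside `J₀` it would contradict minimality.
    exact Nat.find_min hex (Nat.sub_lt hpos one_pos)
      ⟨_, isHomogeneous_vecP hg d w, hJ w g hgJ, hw⟩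

end stable


/-! ## Submodules of `R_r` -/

section Rr

variable {n r : ℕ}

lemma toRr_eq_zero_iff (f : MvPolynomial (Fin n) ℂ) :
    toRr n r f = 0 ↔ f ∈ Ideal.span {quadF n ^ r} := by
  rw [← map_zero (toRr n r), toRr_eq_iff, sub_zero]

lemma lie_E_up_one (p : SIdx n) (z : Rr n r) :
    ⁅(E p.up (one n) : so n), z⁆ = toRr n r (coordU p) * z := by
  obtain ⟨f, rfl⟩ := toRr_surjective n r z
  rw [lie_toRr, psi_E_up_one, map_mul]

lemma X_mul_eq_sum (i : Fin n) (z : Rr n r) : toRr n r (X i) * z =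
    ∑ p : SIdx n, dcoef n p i • ⁅(E p.up (one n) : so n), z⁆ := by
  simp only [lie_E_up_one, coordU_eq, ← smul_mul_assoc, ← map_smul, ← Finset.sum_mul, ← map_sum,
    smul_eq_C_mul, ← lf_smul, ← lf_sum, sum_dcoef_smul_coef, lf_single]

/-- `so n`-submodules of `R_r` are closed under multiplication. -/
lemma mul_mem_of_mem (N : LieSubmodule ℂ (so n) (Rr n r)) (a : Rr n r) {z : Rr n r} (hz : z ∈ N) :
    a * z ∈ N := by
  obtain ⟨f, rfl⟩ := toRr_surjective n r a
  induction f using MvPolynomial.induction_on with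
  | C a =>
    rw [← algebraMap_eq, AlgHom.commutes, ← Algebra.smul_def]
    exact N.smul_mem a hz
  | add f g hf hg => rw [map_add, add_mul]; exact N.add_mem hf hg
  | mul_X f i hf =>
    rw [mul_comm f, map_mul, mul_assoc, X_mul_eq_sum]
    exact N.toSubmodule.sum_mem fun p _ => N.smul_mem _ (N.lie_mem hf)

/-- The ideal of the polynomials whose image lies in a submodule of `R_r`. -/
def idealOf (N : LieSubmodule ℂ (so n) (Rr n r)) : Ideal (MvPolynomial (Fin n) ℂ) where
  carrier := {f | toRr n r f ∈ N}
  add_mem' hf hg := by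
    rw [Set.mem_ofPred_eq, map_add]; exact N.add_mem hf hg
  zero_mem' := by
    rw [Set.mem_ofPred_eq, map_zero]; exact N.zero_mem
  smul_mem' a f hf := by
    rw [Set.mem_ofPred_eq, smul_eq_mul, map_mul]; exact mul_mem_of_mem N _ hf

lemma mem_idealOf {N : LieSubmodule ℂ (so n) (Rr n r)} {f : MvPolynomial (Fin n) ℂ} :
    f ∈ idealOf N ↔ toRr n r f ∈ N := Iff.rfl

lemma quadF_pow_mem_idealOf (N : LieSubmodule ℂ (so n) (Rr n r)) : quadF n ^ r ∈ idealOf N := by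
  rw [mem_idealOf, (toRr_eq_zero_iff _).2 (Ideal.mem_span_singleton_self _)]
  exact N.zero_mem

lemma idealOf_le_iff {N N' : LieSubmodule ℂ (so n) (Rr n r)} : idealOf N ≤ idealOf N' ↔ N ≤ N' := by
  constructor
  · intro h z hz
    obtain ⟨f, rfl⟩ := toRr_surjective n r z
    exact h hz
  · exact fun h f hf => h hf

lemma vecP_eq_sum (d : ℂ) (w : Fin n → ℂ) (f : MvPolynomial (Fin n) ℂ) :
    vecP d w f = ∑ p, C (coef n p ⬝ᵥ w) * vecP d (dcoef n p) f := by
  have hw : w = ∑ p, (coef n p ⬝ᵥ w) • dcoef n p := by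
    have h := congrArg (fun M : Matrix (Fin n) (Fin n) ℂ => Matrix.vecMul w M)
      (coef_mul_dcoef (n := n))
    simp only [Matrix.vecMul_one] at h
    rw [← Matrix.vecMul_vecMul] at h
    conv_lhs => rw [← h]
    ext i
    simp [Matrix.vecMul, dotProduct, mul_comm]
  conv_lhs => rw [hw, vecP_sum]
  simp only [vecP_smul]

lemma isStable_idealOf (N : LieSubmodule ℂ (so n) (Rr n r)) :
    IsStable ((n : ℂ) / 2 - r) (idealOf N) := by
  intro w f hf
  rw [vecP_eq_sum]
  refine Ideal.sum_mem _ fun p _ => Ideal.mul_mem_left _ _ ?_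
  rw [← psi_E_one_up, mem_idealOf, ← lie_toRr]
  exact N.lie_mem hf

lemma eq_top_of_one_mem {N : LieSubmodule ℂ (so n) (Rr n r)} (h : (1 : Rr n r) ∈ N) : N = ⊤ := by
  rw [eq_top_iff]
  intro z _
  rw [← mul_one z]
  exact mul_mem_of_mem N z h

/-- A polynomial of least degree in `N` outside `N₀` is either a nonzero constant or has the
critical degree, since `2 * m + n = 2 * r + 2` says `m = 1 - d`. -/
lemma eq_top_or_exists (hn : 3 ≤ n) {N₀ N : LieSubmodule ℂ (so n) (Rr n r)} (h : ¬ N ≤ N₀) :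
    N = ⊤ ∨ ∃ (m : ℕ) (g : MvPolynomial (Fin n) ℂ), m ≠ 0 ∧ 2 * m + n = 2 * r + 2 ∧
      g.IsHomogeneous m ∧ toRr n r g ∈ N ∧ toRr n r g ∉ N₀ ∧
      ∀ w, toRr n r (vecP ((n : ℂ) / 2 - r) w g) ∈ N₀ := by
  obtain ⟨m, g, hg, hgN, hgN₀, hP⟩ := (isStable_idealOf N).exists_isHomogeneous (by omega)
    (mt idealOf_le_iff.1 h)
  by_cases hm : m = 0
  · left
    subst hm
    obtain ⟨a, rfl⟩ : ∃ a, g = C a :=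
      ⟨_, totalDegree_eq_zero_iff_eq_C.1 (Nat.le_zero.1 hg.totalDegree_le)⟩
    have ha : a ≠ 0 := by
      rintro rfl
      exact hgN₀ (by rw [C_0]; exact Ideal.zero_mem _)
    apply eq_top_of_one_mem
    have h1 := mul_mem_of_mem N (toRr n r (C a⁻¹)) hgN
    rwa [← map_mul, ← C_mul, inv_mul_cancel₀ ha, C_1, map_one] at h1
  · right
    refine ⟨m, g, hm, ?_, hg, hgN, hgN₀, hP⟩
    by_contra hmr
    exact hgN₀ ((isStable_idealOf N₀).mem_of_vecP_mem hn (quadF_pow_mem_idealOf N₀) hm hmr hg hP)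

/-! ### Low degrees in `R_r`, and the simple case -/

/-- Polynomials without terms of degree less than `k`. -/
def LowVanish (k : ℕ) (f : MvPolynomial (Fin n) ℂ) : Prop :=
  ∀ s : Fin n →₀ ℕ, s.degree < k → coeff s f = 0

lemma LowVanish.mul {k : ℕ} {f : MvPolynomial (Fin n) ℂ} (hf : LowVanish k f)
    (g : MvPolynomial (Fin n) ℂ) : LowVanish k (g * f) := by
  intro s hs
  rw [coeff_mul]
  refine Finset.sum_eq_zero fun x hx => ?_
  rw [hf x.2, mul_zero]
  rw [Finset.HasAntidiagonal.mem_antidiagonal] at hx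
  rw [← hx, map_add] at hs
  omega

lemma LowVanish.add {k : ℕ} {f g : MvPolynomial (Fin n) ℂ} (hf : LowVanish k f)
    (hg : LowVanish k g) : LowVanish k (f + g) := fun s hs => by
  rw [coeff_add, hf s hs, hg s hs, add_zero]

lemma lowVanish_of_isHomogeneous {k m : ℕ} {f : MvPolynomial (Fin n) ℂ} (hf : f.IsHomogeneous m)
    (hkm : k ≤ m) : LowVanish k f := fun _ hs => hf.coeff_eq_zero (by omega)

lemma LowVanish.eq_zero {k m : ℕ} {f : MvPolynomial (Fin n) ℂ} (h : LowVanish k f)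
    (hf : f.IsHomogeneous m) (hkm : m < k) : f = 0 := by
  ext s
  by_cases hs : s.degree = m
  · exact h s (by omega)
  · exact hf.coeff_eq_zero hs

/-- Multiples of `F ^ r` start in degree `2r`, so polynomials of smaller degree embed into `Rr n r`.
-/
lemma lowVanish_of_toRr_eq_zero {f : MvPolynomial (Fin n) ℂ} (h : toRr n r f = 0) :
    LowVanish (2 * r) f := by
  rw [toRr_eq_zero_iff, Ideal.mem_span_singleton] at h
  obtain ⟨g, rfl⟩ := h
  rw [mul_comm (quadF n ^ r)]
  exact (lowVanish_of_isHomogeneous (isHomogeneous_quadF.pow r) le_rfl).mul g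

lemma nontrivial_Rr (hr : 1 ≤ r) : Nontrivial (Rr n r) := by
  refine ⟨1, 0, fun h => ?_⟩
  rw [← map_one (toRr n r)] at h
  exact one_ne_zero ((lowVanish_of_toRr_eq_zero h).eq_zero (isHomogeneous_one _ _) (by omega))

lemma one_ne_zero_Rr (hr : 1 ≤ r) : (1 : Rr n r) ≠ 0 :=
  have := nontrivial_Rr (n := n) hr
  one_ne_zero

lemma lieSpan_one : LieSubmodule.lieSpan ℂ (so n) {(1 : Rr n r)} = ⊤ :=
  eq_top_of_one_mem (LieSubmodule.subset_lieSpan (Set.mem_singleton _))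

lemma isHighestWeightVector_one (hn : 3 ≤ n) :
    IsHighestWeightVector (lamWeight n r) (1 : Rr n r) where
  nPos_lie := by
    rw [← map_one (toRr n r)]
    refine nPos_lie_eq_zero _ (fun p => ?_) (fun a p _ => ?_)
    · rw [lie_toRr, psi_E_one_up, vecP_of_isHomogeneous_zero (isHomogeneous_one _ _), map_zero]
    · rw [lie_toRr, psi_E_up_up]
      simp
  cartan_lie a := by
    rw [← map_one (toRr n r), lie_toRr, lamWeight_apply hn, ← map_smul]
    congr 1
    rcases Fin.eq_zero_or_eq_succ a with rfl | ⟨c, rfl⟩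
    · rw [if_pos rfl]
      change psi _ (E (one n) (one n)) 1 = _
      rw [psi_E_one_one, smul_eq_C_mul, ← C_1, dK_C, zero_add, ← C_mul, ← C_mul, ← C_neg]
      congr 1; ring
    · rw [if_neg (Fin.succ_ne_zero c), zero_smul]
      change psi _ (E (Idx.up (.inl c : SIdx n)) (Idx.up (.inl c : SIdx n))) 1 = _
      rw [psi_E_up_up]
      simp

/-- The critical equation `2 * m + n = 2 * r + 2` with `m ≠ 0` fails by parity for `n` odd, and
forces `2r ≥ n` otherwise. -/
lemma isIrreducible_Rr (hn : 3 ≤ n) (hr : 1 ≤ r) (h : Odd n ∨ Even n ∧ (r : ℝ) < n / 2) :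
    LieModule.IsIrreducible ℂ (so n) (Rr n r) := by
  have := nontrivial_Rr (n := n) hr
  refine LieModule.IsIrreducible.mk fun N hN => ?_
  rcases eq_top_or_exists hn (mt le_bot_iff.1 hN) with h1 | ⟨m, -, hm, hmr, -⟩
  · exact h1
  · exfalso
    rcases h with ⟨k, hk⟩ | ⟨⟨k, hk⟩, h⟩
    · omega
    · have h2 : 2 * r < n := by
        have : (2 : ℝ) * r < n := by linarith
        exact_mod_cast this
      omega

end Rr

/-! ## The socle of `R_r` -/

section socle

variable {n r : ℕ}

lemma laplacian_of_mem {m : ℕ} {h : MvPolynomial (Fin n) ℂ} (hh : h ∈ harmonicPoly n m) :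
    laplacian n h = 0 := hh.2

lemma dK_mem_harmonicPoly {m : ℕ} {h : MvPolynomial (Fin n) ℂ} (hh : h ∈ harmonicPoly n m)
    (K : Matrix (Fin n) (Fin n) ℂ) (hK : K.transpose = -K) : dK K h ∈ harmonicPoly n m := by
  refine ⟨?_, ?_⟩
  · rw [dK_eq]
    exact IsHomogeneous.sum _ _ _ fun i _ => IsHomogeneous.sum _ _ _ fun j _ =>
      (isHomogeneous_X_mul_pderiv i j hh.1).C_mul _
  · rw [SetLike.mem_coe, LinearMap.mem_ker, lap_dK_skew K hK, laplacian_of_mem hh, map_zero]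

lemma vecP_harmonic {m : ℕ} (hmr : 2 * m + n = 2 * r + 2) {h : MvPolynomial (Fin n) ℂ}
    (hh : h ∈ harmonicPoly n m) (w : Fin n → ℂ) : vecP ((n : ℂ) / 2 - r) w h = 0 := by
  have hc : (m : ℂ) - 1 + (n / 2 - r) = 0 := by
    have : ((2 * m + n : ℕ) : ℂ) = ((2 * r + 2 : ℕ) : ℂ) := by rw [hmr]
    push_cast at this
    linear_combination this / 2
  rw [vecP_of_isHomogeneous hh.1, laplacian_of_mem hh, hc, C_0]; ring

/-- The ideal of `R_r` generated by `H(m)`. -/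
def harmonicIdeal (n r m : ℕ) : Ideal (Rr n r) :=
  Ideal.span (toRr n r '' (harmonicPoly n m : Set (MvPolynomial (Fin n) ℂ)))

lemma lie_mem_harmonicIdeal {m : ℕ} (hmr : 2 * m + n = 2 * r + 2) (x : so n) {z : Rr n r}
    (hz : z ∈ harmonicIdeal n r m) : ⁅x, z⁆ ∈ harmonicIdeal n r m := by
  have hmem : ∀ {h}, h ∈ harmonicPoly n m → toRr n r h ∈ harmonicIdeal n r m :=
    fun hh => Ideal.subset_span ⟨_, hh, rfl⟩
  have hC : ∀ (c : ℂ) {y : Rr n r}, y ∈ harmonicIdeal n r m → c • y ∈ harmonicIdeal n r m :=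
    fun c y hy => by rw [Algebra.smul_def]; exact Ideal.mul_mem_left _ _ hy
  -- Stability under all `x` is carried through the induction, because multiplication by a
  -- coordinate is itself an element of `so n`, and moving `x` past it produces the action of
  -- another element.
  suffices h : z ∈ harmonicIdeal n r m ∧ ∀ x : so n, ⁅x, z⁆ ∈ harmonicIdeal n r m from h.2 x
  refine Submodule.span_induction
    (p := fun z _ => z ∈ harmonicIdeal n r m ∧ ∀ x : so n, ⁅x, z⁆ ∈ harmonicIdeal n r m)
    ?_ ?_ ?_ ?_ hz
  · rintro _ ⟨h, hh, rfl⟩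
    refine ⟨hmem hh, fun x => ?_⟩
    rw [lie_toRr, psi_eq, opT]
    change toRr n r (_ + vecP ((n : ℂ) / 2 - r) _ h + _) ∈ _
    rw [vecP_harmonic hmr hh, add_zero, dK_one_of_isHomogeneous hh.1, map_add, map_add]
    refine Ideal.add_mem _ (Ideal.add_mem _ ?_ ?_) (hmem (dK_mem_harmonicPoly hh _ (skew_blk x)))
    · rw [← add_mul, ← mul_assoc, map_mul]
      exact Ideal.mul_mem_left _ _ (hmem hh)
    · rw [map_mul]
      exact Ideal.mul_mem_left _ _ (hmem hh)
  · exact ⟨Ideal.zero_mem _, fun x => by rw [lie_zero]; exact Ideal.zero_mem _⟩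
  · rintro y z - - ⟨hy, hy'⟩ ⟨hz, hz'⟩
    exact ⟨Ideal.add_mem _ hy hz, fun x => by
      rw [lie_add]; exact Ideal.add_mem _ (hy' x) (hz' x)⟩
  · rintro a z - ⟨hz, hz'⟩
    obtain ⟨f, rfl⟩ := toRr_surjective n r a
    rw [smul_eq_mul]
    refine ⟨Ideal.mul_mem_left _ _ hz, ?_⟩
    induction f using MvPolynomial.induction_on with
    | C a =>
      intro x
      rw [← algebraMap_eq, AlgHom.commutes, ← Algebra.smul_def, lie_smul]
      exact hC a (hz' x)
    | add f g hf hg =>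
      intro x
      rw [map_add, add_mul, lie_add]
      exact Ideal.add_mem _ (hf x) (hg x)
    | mul_X f i hf =>
      intro x
      rw [mul_comm f, map_mul, mul_assoc, X_mul_eq_sum, lie_sum]
      refine Ideal.sum_mem _ fun p _ => ?_
      rw [lie_smul, leibniz_lie]
      refine hC _ (Ideal.add_mem _ (hf _) ?_)
      rw [lie_E_up_one]
      exact Ideal.mul_mem_left _ _ (hf x)

/-- The ideal generated by `H(m)` as a submodule, for `m = 1 - d`. -/
def harmonicSubmodule {n r m : ℕ} (hmr : 2 * m + n = 2 * r + 2) :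
    LieSubmodule ℂ (so n) (Rr n r) where
  toSubmodule := (harmonicIdeal n r m).restrictScalars ℂ
  lie_mem := lie_mem_harmonicIdeal hmr _

/-- The highest weight vector `U_2 ^ m` of `H(m)`. -/
def harmonicTop (n m : ℕ) (hn : 3 ≤ n) : MvPolynomial (Fin n) ℂ :=
  coordEquiv n (X (.inl ⟨0, by omega⟩) ^ m)

lemma harmonicTop_mem {m : ℕ} (hn : 3 ≤ n) : harmonicTop n m hn ∈ harmonicPoly n m :=
  coordEquiv_mem_harmonicPoly.2 (X_pow_mem_splitHarm _ (by simp [Idx.neg]) m)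

lemma harmonicTop_ne_zero {m : ℕ} (hn : 3 ≤ n) : harmonicTop n m hn ≠ 0 := by
  rw [harmonicTop, Ne, EmbeddingLike.map_eq_zero_iff]
  exact pow_ne_zero _ (X_ne_zero _)

/-- In the basis of the `ε_i` this is `μ = -ε_1 + (1 - d) ε_2`, the weight of `U_2 ^ (1 - d)`. -/
lemma muWeight_apply (hn : 3 ≤ n) (r : ℕ) (a : Fin (n / 2 + 1)) :
    muWeight n r a = if a = 0 then -1 else if (a : ℕ) = 1 then (r : ℂ) + 1 - n / 2 else 0 := by
  have h1 : 1 < n / 2 + 1 := by omega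
  rw [muWeight, Pi.add_apply, lamWeight_apply hn, Pi.smul_apply, simpleRoot, if_pos h1,
    Pi.sub_apply, eps, eps]
  simp only [← Fin.val_eq_zero_iff, smul_eq_mul]
  by_cases h2 : (a : ℕ) = 0
  · simp [h2]; ring
  · by_cases h3 : (a : ℕ) = 1
    · simp [h3]; ring
    · simp [h2, h3]

variable {m : ℕ} (hmr : 2 * m + n = 2 * r + 2)

lemma toRr_mem_harmonicSubmodule {h : MvPolynomial (Fin n) ℂ} (hh : h ∈ harmonicPoly n m) :
    toRr n r h ∈ harmonicSubmodule hmr := Ideal.subset_span ⟨_, hh, rfl⟩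

/-- Generators start in degree `m`, and `m < 2r`, so the relation `F ^ r` does not disturb the terms
below degree `m`. -/
lemma lowVanish_of_mem_harmonicSubmodule (hn : 3 ≤ n) {f : MvPolynomial (Fin n) ℂ}
    (hf : toRr n r f ∈ harmonicSubmodule hmr) : LowVanish m f := by
  have key : ∀ z ∈ harmonicIdeal n r m, ∃ g, LowVanish m g ∧ toRr n r g = z := by
    intro z hz
    refine Submodule.span_induction
      (p := fun z _ => ∃ g, LowVanish m g ∧ toRr n r g = z) ?_ ?_ ?_ ?_ hz
    · rintro _ ⟨h, hh, rfl⟩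
      exact ⟨h, lowVanish_of_isHomogeneous hh.1 le_rfl, rfl⟩
    · exact ⟨0, fun s _ => coeff_zero s, map_zero _⟩
    · rintro y z - - ⟨f, hf, rfl⟩ ⟨g, hg, rfl⟩
      exact ⟨f + g, hf.add hg, map_add _ _ _⟩
    · rintro a z - ⟨f, hf, rfl⟩
      obtain ⟨g, rfl⟩ := toRr_surjective n r a
      exact ⟨g * f, hf.mul g, map_mul _ _ _⟩
  obtain ⟨g, hg, hgf⟩ := key _ hf
  have h := lowVanish_of_toRr_eq_zero (r := r) (f := f - g) (by rw [map_sub, hgf, sub_self])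
  rw [← sub_add_cancel f g]
  exact LowVanish.add (fun s hs => h s (by omega)) hg

/-- In the critical degree `P_w g` is `w Δ₁ g`, of degree `m - 1`. Since the submodule has nothing
below degree `m`, this product vanishes already as a polynomial, and hence so does `Δ₁ g`. -/
lemma mem_harmonicPoly_of_vecP (hn : 3 ≤ n) {g : MvPolynomial (Fin n) ℂ} (hg : g.IsHomogeneous m)
    (hm : m ≠ 0) (h : ∀ w, toRr n r (vecP ((n : ℂ) / 2 - r) w g) ∈ harmonicSubmodule hmr) :
    g ∈ harmonicPoly n m := by
  refine ⟨hg, ?_⟩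
  have hc : (m : ℂ) - 1 + (n / 2 - r) = 0 := by
    have : ((2 * m + n : ℕ) : ℂ) = ((2 * r + 2 : ℕ) : ℂ) := by rw [hmr]
    push_cast at this
    linear_combination this / 2
  have h1 := (lowVanish_of_mem_harmonicSubmodule hmr hn (h (Pi.single ⟨0, by omega⟩ 1))).eq_zero
    (isHomogeneous_vecP hg _ _) (by omega)
  rw [vecP_of_isHomogeneous hg, hc, C_0, zero_mul, sub_zero, lf_single] at h1
  exact (mul_eq_zero.1 h1).resolve_left (X_ne_zero _)

/-- A witness of critical degree outside the submodule would be harmonic and hence inside it; only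
the constant case of `eq_top_or_exists` remains. -/
lemma eq_top_of_not_le_harmonicSubmodule (hn : 3 ≤ n) (N : LieSubmodule ℂ (so n) (Rr n r))
    (hN : ¬ N ≤ harmonicSubmodule hmr) : N = ⊤ := by
  rcases eq_top_or_exists hn hN with h | ⟨m', g, hm, hmr', hg, -, hg', hP⟩
  · exact h
  · obtain rfl : m' = m := by omega
    exact absurd (toRr_mem_harmonicSubmodule hmr (mem_harmonicPoly_of_vecP hmr hn hg hm hP)) hg'

/-- A proper nonzero `N` contains a nonzero harmonic polynomial of degree `m`, so by irreducibility
under rotations all of `H(m)` and the ideal it generates. -/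
lemma harmonicSubmodule_le_of_ne_bot (hn : 3 ≤ n) (N : LieSubmodule ℂ (so n) (Rr n r))
    (hN : N ≠ ⊥) : harmonicSubmodule hmr ≤ N := by
  rcases eq_top_or_exists hn (mt le_bot_iff.1 hN) with rfl | ⟨m', g, hm, hmr', hg, hgN, hg', hP⟩
  · exact le_top
  · obtain rfl : m' = m := by omega
    have hgH := mem_harmonicPoly_of_vecP hmr hn hg hm fun w =>
      (bot_le : ⊥ ≤ harmonicSubmodule hmr) (hP w)
    have h1 := harmonicPoly_le_of_stable hn ((n : ℂ) / 2 - r) ((idealOf N).restrictScalars ℂ)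
      (fun p q f hf => by
        change toRr n r _ ∈ N
        rw [← lie_toRr]
        exact N.lie_mem hf) hgN hgH (by
        rintro rfl
        exact hg' (by rw [map_zero]; exact LieSubmodule.zero_mem _))
    intro z hz
    refine Submodule.span_induction (p := fun z _ => z ∈ N) ?_ N.zero_mem
      (fun _ _ _ _ => N.add_mem) (fun a _ _ => mul_mem_of_mem N a) hz
    rintro _ ⟨h, hh, rfl⟩
    exact h1 hh

include hmr in
lemma toRr_harmonicTop_ne_zero (hn : 3 ≤ n) : toRr n r (harmonicTop n m hn) ≠ 0 := fun h =>
  harmonicTop_ne_zero hn ((lowVanish_of_toRr_eq_zero h).eq_zero (harmonicTop_mem hn).1 (by omega))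

lemma harmonicSubmodule_ne_bot (hn : 3 ≤ n) : harmonicSubmodule hmr ≠ ⊥ := fun h =>
  toRr_harmonicTop_ne_zero hmr hn (by
    rw [← LieSubmodule.mem_bot (R := ℂ) (L := so n), ← h]
    exact toRr_mem_harmonicSubmodule hmr (harmonicTop_mem hn))

lemma one_notMem_harmonicSubmodule (hn : 3 ≤ n) (hm : m ≠ 0) :
    (1 : Rr n r) ∉ harmonicSubmodule hmr := by
  intro h
  rw [← map_one (toRr n r)] at h
  exact one_ne_zero ((lowVanish_of_mem_harmonicSubmodule hmr hn h).eq_zero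
    (isHomogeneous_one _ _) (Nat.pos_of_ne_zero hm))

lemma isIrreducible_harmonicSubmodule (hn : 3 ≤ n) :
    LieModule.IsIrreducible ℂ (so n) (harmonicSubmodule hmr) := by
  have : Nontrivial (harmonicSubmodule hmr) :=
    (LieSubmodule.nontrivial_iff_ne_bot ℂ (so n) (Rr n r)).2 (harmonicSubmodule_ne_bot hmr hn)
  refine LieModule.IsIrreducible.mk fun N hN => ?_
  have h := harmonicSubmodule_le_of_ne_bot hmr hn (N.map (harmonicSubmodule hmr).incl) (by
    intro h
    apply hN
    rw [eq_bot_iff]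
    intro x hx
    have : (harmonicSubmodule hmr).incl x ∈ N.map (harmonicSubmodule hmr).incl :=
      LieSubmodule.mem_map_of_mem hx
    rw [h, LieSubmodule.mem_bot] at this
    exact (LieSubmodule.mem_bot _).2 (Subtype.ext this))
  rw [eq_top_iff]
  intro x _
  obtain ⟨y, hy, hyx⟩ := (LieSubmodule.mem_map _).1 (h x.2)
  rwa [← Subtype.ext hyx]

lemma socle_eq (hn : 3 ≤ n) : socle n (Rr n r) = harmonicSubmodule hmr := by
  apply le_antisymm
  · refine sSup_le fun N hN => ?_
    have hN : LieModule.IsIrreducible ℂ (so n) N := hN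
    have hN0 : N ≠ ⊥ :=
      (LieSubmodule.nontrivial_iff_ne_bot ℂ (so n) (Rr n r)).1
        (LieModule.nontrivial_of_isIrreducible ℂ (so n) N)
    have hle := harmonicSubmodule_le_of_ne_bot hmr hn N hN0
    rcases eq_bot_or_eq_top ((harmonicSubmodule hmr).comap N.incl) with h | h
    · exfalso
      apply harmonicSubmodule_ne_bot hmr hn
      rw [eq_bot_iff]
      intro x hx
      have : (⟨x, hle hx⟩ : N) ∈ (harmonicSubmodule hmr).comap N.incl := hx
      rw [h, LieSubmodule.mem_bot] at this
      exact (LieSubmodule.mem_bot _).2 (congrArg Subtype.val this)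
    · intro x hx
      have : (⟨x, hx⟩ : N) ∈ (harmonicSubmodule hmr).comap N.incl := h ▸ LieSubmodule.mem_top _
      exact this
  · exact le_sSup (isIrreducible_harmonicSubmodule hmr hn)

lemma isIrreducible_quotient (hn : 3 ≤ n) (hm : m ≠ 0) :
    LieModule.IsIrreducible ℂ (so n) (Rr n r ⧸ harmonicSubmodule hmr) := by
  have : Nontrivial (Rr n r ⧸ harmonicSubmodule hmr) :=
    ⟨LieSubmodule.Quotient.mk 1, 0, fun h =>
      one_notMem_harmonicSubmodule hmr hn hm (LieSubmodule.Quotient.mk_eq_zero'.1 h)⟩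
  refine LieModule.IsIrreducible.mk fun N hN => ?_
  have h := eq_top_of_not_le_harmonicSubmodule hmr hn
    (N.comap (LieSubmodule.Quotient.mk' (harmonicSubmodule hmr))) (by
    intro hle
    apply hN
    rw [eq_bot_iff]
    intro x hx
    obtain ⟨y, rfl⟩ := LieSubmodule.Quotient.surjective_mk' _ x
    exact (LieSubmodule.mem_bot _).2 (LieSubmodule.Quotient.mk_eq_zero'.2 (hle hx)))
  rw [eq_top_iff]
  intro x _
  obtain ⟨y, rfl⟩ := LieSubmodule.Quotient.surjective_mk' _ x
  have : y ∈ N.comap (LieSubmodule.Quotient.mk' (harmonicSubmodule hmr)) :=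
    h ▸ LieSubmodule.mem_top y
  exact this

lemma isHighestWeightVector_quotient (hn : 3 ≤ n) :
    IsHighestWeightVector (lamWeight n r)
      (LieSubmodule.Quotient.mk (1 : Rr n r) : Rr n r ⧸ harmonicSubmodule hmr) where
  nPos_lie x hx := by
    change LieSubmodule.Quotient.mk ⁅x, (1 : Rr n r)⁆ = _
    rw [(isHighestWeightVector_one hn).nPos_lie x hx]
    rfl
  cartan_lie a := by
    change LieSubmodule.Quotient.mk ⁅(cartan a : so n), (1 : Rr n r)⁆ = _
    rw [(isHighestWeightVector_one hn).cartan_lie]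
    rfl

lemma isHighestWeightVector_harmonicTop (hn : 3 ≤ n) :
    IsHighestWeightVector (muWeight n r)
      (⟨toRr n r (harmonicTop n m hn), toRr_mem_harmonicSubmodule hmr (harmonicTop_mem hn)⟩ :
        harmonicSubmodule hmr) where
  nPos_lie := by
    refine nPos_lie_eq_zero _ (fun p => Subtype.ext ?_) (fun a p hp => Subtype.ext ?_)
    · change ⁅(E (one n) p.up : so n), toRr n r (harmonicTop n m hn)⁆ = 0
      rw [lie_toRr, psi_E_one_up, vecP_harmonic hmr (harmonicTop_mem hn), map_zero]
    · change ⁅(E (Idx.up (.inl a : SIdx n)) p.up : so n), toRr n r (harmonicTop n m hn)⁆ = 0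
      rw [lie_toRr, harmonicTop, ← coordEquiv_rot,
        rot_X_pow_eq_zero _ (hp (by omega)) (by simp [Idx.neg]), map_zero, map_zero]
  cartan_lie a := by
    apply Subtype.ext
    change ⁅(cartan a : so n), toRr n r (harmonicTop n m hn)⁆ =
      muWeight n r a • toRr n r (harmonicTop n m hn)
    have hcast : 2 * (m : ℂ) + n = 2 * r + 2 := by exact_mod_cast hmr
    rw [lie_toRr, muWeight_apply hn, ← map_smul]
    congr 1
    rcases Fin.eq_zero_or_eq_succ a with rfl | ⟨c, rfl⟩
    · rw [if_pos rfl]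
      change psi _ (E (one n) (one n)) _ = _
      rw [psi_E_one_one, dK_one_of_isHomogeneous (harmonicTop_mem hn).1, ← add_mul, ← C_add,
        smul_eq_C_mul, ← neg_mul, ← C_neg]
      congr 2
      linear_combination -hcast / 2
    · rw [if_neg (Fin.succ_ne_zero c)]
      change psi _ (E (Idx.up (.inl c : SIdx n)) (Idx.up (.inl c : SIdx n))) _ = _
      rw [harmonicTop, ← coordEquiv_rot, ← map_smul]
      congr 1
      by_cases hc : (c : ℕ) = 0
      · have hc' : c = ⟨0, by omega⟩ := Fin.ext hc
        rw [if_pos (by simp [hc]), hc', rot_self_X_pow _ (by simp [Idx.neg])]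
        congr 1
        linear_combination hcast / 2
      · have hc' : c ≠ ⟨0, by omega⟩ := fun h => hc (congrArg Fin.val h)
        rw [if_neg (by simpa using hc), zero_smul,
          rot_X_pow_eq_zero _ (by simpa using hc') (by simp [Idx.neg])]

end socle

end
end ConformalSO

open ConformalSO
-- Assembly of the theorem
theorem theorem3p6 (n r : ℕ) (hn : 3 ≤ n) (hr : 1 ≤ r) :
    IsHighestWeightModule n (Rr n r) (lamWeight n r) ∧
    (Odd n ∨ (Even n ∧ (r : ℝ) < n / 2) →
      LieModule.IsIrreducible ℂ (so n) (Rr n r) ∧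
      Nonempty (Rr n r ≃ₗ⁅ℂ, so n⁆ SimpleHW n (lamWeight n r))) ∧
    (Even n ∧ (n / 2 : ℝ) ≤ r →
      -- the socle is simple, isomorphic to `L(μ)`
      LieModule.IsIrreducible ℂ (so n) (socle n (Rr n r)) ∧
      Nonempty (socle n (Rr n r) ≃ₗ⁅ℂ, so n⁆ SimpleHW n (muWeight n r)) ∧
      -- formulas for `μ`, where `d = n/2 - r` and `ℓ = n/2 + 1`
      (4 ≤ n / 2 + 1 → muWeight n r =
        ((n : ℂ) / 2 - r - 2) • fundWeight n 1 + (1 - ((n : ℂ) / 2 - r)) • fundWeight n 2) ∧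
      (n / 2 + 1 = 3 → muWeight n r = ((n : ℂ) / 2 - r - 2) • fundWeight n 1 +
        (1 - ((n : ℂ) / 2 - r)) • (fundWeight n 2 + fundWeight n 3)) ∧
      -- the quotient by the socle
      LieModule.IsIrreducible ℂ (so n) (Rr n r ⧸ socle n (Rr n r)) ∧
      FiniteDimensional ℂ (Rr n r ⧸ socle n (Rr n r)) ∧
      Nonempty ((Rr n r ⧸ socle n (Rr n r)) ≃ₗ⁅ℂ, so n⁆ SimpleHW n (lamWeight n r)) ∧
      Nonempty ((Rr n r ⧸ socle n (Rr n r)) ≃ₗ⁅ℂ, so n⁆ AmbHarmonic n (r - n / 2)) ∧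
      -- the socle is the ideal generated by `H(1 - d)`
      (socle n (Rr n r) : Set (Rr n r)) =
        (Ideal.span (toRr n r '' (harmonicPoly n (1 + (r - n / 2)) : Set (MvPolynomial (Fin n) ℂ))) :
          Set (Rr n r))) := by
  have hv := isHighestWeightVector_one (r := r) hn
  refine ⟨⟨1, one_ne_zero_Rr hr, hv.nPos_lie, hv.cartan_lie, lieSpan_one⟩, fun h => ?_, ?_⟩
  · exact ⟨isIrreducible_Rr hn hr h,
      hv.nonempty_equiv (one_ne_zero_Rr hr) (isIrreducible_Rr hn hr h)⟩
  rintro ⟨he, hnr⟩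
  have hnr' : n ≤ 2 * r := by
    have : (n : ℝ) ≤ 2 * r := by linarith
    exact_mod_cast this
  obtain ⟨k, hk⟩ := he
  -- As `n` is even and `n ≤ 2r`, neither the natural division nor the subtraction loses anything:
  -- `1 + (r - n / 2)` is `1 - d`.
  have hmr : 2 * (1 + (r - n / 2)) + n = 2 * r + 2 := by omega
  have hm : 1 + (r - n / 2) ≠ 0 := by omega
  rw [socle_eq hmr hn]
  have hQ := isIrreducible_quotient hmr hn hm
  obtain ⟨e⟩ := (isHighestWeightVector_quotient hmr hn).nonempty_equiv
    (fun h => one_notMem_harmonicSubmodule hmr hn hm (LieSubmodule.Quotient.mk_eq_zero'.1 h)) hQ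
  obtain ⟨e'⟩ := (isHighestWeightVector_ambTop hn ⟨k, hk⟩ (r := r) (by omega)).nonempty_equiv
    (ambTop_ne_zero n _) (isIrreducible_ambHarmonic hn _)
  -- Finite dimension is clear for harmonic polynomials and passes to the quotient of `Rr n r`
  -- because both are `L(λ)`.
  have : FiniteDimensional ℂ (AmbHarmonic n (r - n / 2)) := finite_splitHarm Idx.neg _
  refine ⟨isIrreducible_harmonicSubmodule hmr hn,
    (isHighestWeightVector_harmonicTop hmr hn).nonempty_equiv
      (fun h => toRr_harmonicTop_ne_zero hmr hn (congrArg Subtype.val h))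
      (isIrreducible_harmonicSubmodule hmr hn),
    fun h4 => ?_, fun h3 => ?_, hQ,
    Module.Finite.equiv (e.trans e'.symm).toLinearEquiv.symm, ⟨e⟩, ⟨e.trans e'.symm⟩, rfl⟩
  · funext a
    -- For `ℓ ≥ 4` the nodes `1` and `2` are not spin nodes, so `ϖ_1 = ε_1` and `ϖ_2 = ε_1 + ε_2`.
    have h1 : ¬ (1 = n / 2) := by omega
    have h2 : ¬ (2 = n / 2) := by omega
    have h5 : ¬ (1 = n / 2 + 1) := by omega
    have h6 : ¬ (2 = n / 2 + 1) := by omega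
    rw [muWeight_apply hn]
    simp only [Pi.add_apply, Pi.smul_apply, fundWeight, h1, h2, h5, h6, and_false, if_false,
      smul_eq_mul, ← Fin.val_eq_zero_iff]
    rcases Nat.lt_or_ge (a : ℕ) 2 with ha | ha
    · interval_cases (a : ℕ) <;> simp <;> ring
    · have h7 : ¬ (a : ℕ) = 0 := by omega
      have h8 : ¬ (a : ℕ) = 1 := by omega
      have h9 : ¬ (a : ℕ) < 1 := by omega
      have h10 : ¬ (a : ℕ) < 2 := by omega
      simp [h7, h8, h9, h10]
  · funext a
    have ha := a.2
    -- For `ℓ = 3` both `ϖ_2` and `ϖ_3` are half-spin weights, and their sum is `ε_1 + ε_2`.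
    have hn4 : n / 2 = 2 := by omega
    have he : Even n := ⟨k, hk⟩
    rw [muWeight_apply hn]
    simp only [Pi.add_apply, Pi.smul_apply, fundWeight, hn4, smul_eq_mul, ← Fin.val_eq_zero_iff, he]
    have ha' : (a : ℕ) < 3 := by omega
    interval_cases (a : ℕ) <;> norm_num <;> ring
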